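/- The machine is a word RAM with words of $w$ bits: a fixed program with a fixed finite number of registers, a working memory, read-only input, a write-only output stream, unit-cost arithmetic $(+,-,\times,\div,\bmod)$ and comparisons on words, and unit-cost drawing of a uniformly random element of $\{0,\dots,m-1\}$. Time is the number of elementary operations; space is the number of words of working memory (registers included, input and output not counted). Let $T=t_0\cdots t_{n-1}$ be a string over the integer alphabet $\{1,\dots,\sigma\}$, let $T_i=t_i\cdots t_{n-1}$, and let $\mathrm{LCP}(i,j)$ be the length of the longest common prefix of $T_i$ and $T_j$. For every constant $c\in\mathbb N$ the following holds, where the programs, the constant $K$ in the word length and the constants hidden in $O(\cdot)$ depend only on $c$, and where $w$ is any word length with $w\ge K(\lfloor\log_2(n+\sigma+b)\rfloor+1)$. 1. (Batched LCP queries.) There is a randomized program which, given $T$, a list of $b$ pairs $(i,j)$ of positions of $T$ and an integer $\alpha$ with $2\le\alpha\le b$, always halts within time $$O\Big(n\,\frac{\log b}{\log\alpha}+\frac{\alpha b\log b}{\log\alpha}\Big)$$ using $O(\alpha b)$ words of space, and with probability at least $1-n^{-c}$ outputs $\mathrm{LCP}(i,j)$ for all the pairs, in order. 2. (Sparse suffix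 tree.) There is a randomized program which, given $T$, a list of $b\ge 2$ distinct positions of $T$ and an integer $\alpha$ with $2\le\alpha\le b$, always halts within time $$O\Big(n\,\frac{\log^2 b}{\log\alpha}+\frac{\alpha b\log^2 b}{\log\alpha}\Big)$$ using $O(\alpha b)$ words of space, and with probability at least $1-n^{-c}$ outputs the sparse suffix tree of $T$ for these positions. This is the compacted trie of the $b$ suffixes: its nodes are the root, the ends of the $b$ suffixes, and the branching points. It is given as an array of nodes, each with its parent, an occurrence in $T$ (start and length) of its edge label and the suffix, if any, that ends there, with siblings ordered by the first letters of their edge labels. 3. For every real $\varepsilon$ with $0<\varepsilon\le 1$, the same program as in 2, run with $\alpha=\lceil b^{\varepsilon}\rceil$, always halts within time $$O\Big(\frac1\varepsilon\big(n\log b+b^{1+\varepsilon}\log b\big)\Big)$$ using $O(b^{1+\varepsilon})$ words of space, and is correct with probability at least $1-n^{-c}$; the hidden constants do not depend on $\varepsilon$. -/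

import Mathlib

namespace SparseSuffix

/-! ## A randomized word RAM

Programs are structured programs over a fixed finite set of registers, a random access
working memory, a read-only text, a read-only list of further input words, and a write-only
output stream. All quantities are words of `w` bits, that is, natural numbers below `2 ^ w`. -/

/-- The word operations. -/
inductive Op where
  | add | sub | mul | div | mod | lt | eq

/-- Addition and multiplication wrap around at `2 ^ w`; subtraction is cut off at `0`;
comparisons return `1` or `0`. -/
def Op.eval (w : ℕ) : Op → ℕ → ℕ → ℕ
  | .add, x, y => (x + y) % 2 ^ w
  | .sub, x, y => x - y
  | .mul, x, y => (x * y) % 2 ^ w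
  | .div, x, y => x / y
  | .mod, x, y => x % y
  | .lt, x, y => if x < y then 1 else 0
  | .eq, x, y => if x = y then 1 else 0

/-- Expressions over `k` registers. -/
inductive Expr (k : ℕ) where
  | lit (v : ℕ)
  | reg (r : Fin k)
  | bin (o : Op) (a b : Expr k)

def Expr.eval {k : ℕ} (w : ℕ) (ρ : Fin k → ℕ) : Expr k → ℕ
  | .lit v => v % 2 ^ w
  | .reg r => ρ r
  | .bin o a b => o.eval w (a.eval w ρ) (b.eval w ρ)

/-- The number of elementary operations needed to evaluate an expression. -/
def Expr.cost {k : ℕ} : Expr k → ℕ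
  | .lit _ => 1
  | .reg _ => 1
  | .bin _ a b => a.cost + b.cost + 1

/-- Programs with `k` registers. -/
inductive Cmd (k : ℕ) where
  | skip
  /-- `r := e` -/
  | set (r : Fin k) (e : Expr k)
  /-- `r := memory[e]` -/
  | load (r : Fin k) (e : Expr k)
  /-- `memory[a] := e` -/
  | store (a e : Expr k)
  /-- `r := text[e]` -/
  | text (r : Fin k) (e : Expr k)
  /-- `r := input[e]` -/
  | arg (r : Fin k) (e : Expr k)
  /-- `r :=` a fresh uniformly random element of `{0, …, e - 1}` -/
  | rand (r : Fin k) (e : Expr k)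
  /-- append `e` to the output stream -/
  | emit (e : Expr k)
  | seq (p q : Cmd k)
  /-- if `e ≠ 0` then `p` else `q` -/
  | ite (e : Expr k) (p q : Cmd k)
  /-- while `e ≠ 0` do `p` -/
  | loop (e : Expr k) (p : Cmd k)

/-- The state: registers, working memory, output written so far, the number of elementary
operations performed so far, and the least `s` such that all addresses of the working memory
accessed so far (for reading or for writing) are below `s`. -/
structure State (k : ℕ) where
  reg : Fin k → ℕ
  mem : ℕ → ℕ
  out : List ℕ
  time : ℕ
  peak : ℕ

/-- A configuration: the commands that remain to be executed, in order, and the state. -/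
structure Config (k : ℕ) where
  todo : List (Cmd k)
  st : State k

def State.setReg {k : ℕ} (s : State k) (r : Fin k) (v : ℕ) : State k :=
  { s with reg := Function.update s.reg r v }

def State.tick {k : ℕ} (s : State k) (t : ℕ) : State k :=
  { s with time := s.time + t }

/-- Record an access to address `a` of the working memory. -/
def State.touch {k : ℕ} (s : State k) (a : ℕ) : State k :=
  { s with peak := max s.peak (a + 1) }

/-- The uniform distribution on `{0, …, m - 1}` (the value `0` if `m = 0`). -/
noncomputable def uniformBelow (m : ℕ) : PMF ℕ :=
  if h : 0 < m then
    PMF.uniformOfFinset (Finset.range m) (Finset.nonempty_range_iff.mpr h.ne')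
  else PMF.pure 0

/-- Execution of one command, with word length `w`, text `T` and further input `x`. -/
noncomputable def Cmd.exec {k : ℕ} (w : ℕ) (T x : List ℕ) (rest : List (Cmd k)) (s : State k) :
    Cmd k → PMF (Config k)
  | .skip => PMF.pure ⟨rest, s.tick 1⟩
  | .set r e => PMF.pure ⟨rest, (s.setReg r (e.eval w s.reg)).tick (e.cost + 1)⟩
  | .load r e =>
      PMF.pure ⟨rest, ((s.setReg r (s.mem (e.eval w s.reg))).touch (e.eval w s.reg)).tick
        (e.cost + 1)⟩
  | .store a e =>
      PMF.pure ⟨rest, (({ s with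
        mem := Function.update s.mem (a.eval w s.reg) (e.eval w s.reg) } : State k).touch
          (a.eval w s.reg)).tick (a.cost + e.cost + 1)⟩
  | .text r e =>
      PMF.pure ⟨rest, (s.setReg r (T.getD (e.eval w s.reg) 0 % 2 ^ w)).tick (e.cost + 1)⟩
  | .arg r e =>
      PMF.pure ⟨rest, (s.setReg r (x.getD (e.eval w s.reg) 0 % 2 ^ w)).tick (e.cost + 1)⟩
  | .rand r e =>
      (uniformBelow (e.eval w s.reg)).map fun v => ⟨rest, (s.setReg r v).tick (e.cost + 1)⟩
  | .emit e =>
      PMF.pure ⟨rest, ({ s with out := s.out ++ [e.eval w s.reg] } : State k).tick (e.cost + 1)⟩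
  | .seq p q => PMF.pure ⟨p :: q :: rest, s.tick 1⟩
  | .ite e p q =>
      PMF.pure ⟨(if e.eval w s.reg ≠ 0 then p else q) :: rest, s.tick (e.cost + 1)⟩
  | .loop e p =>
      PMF.pure ⟨if e.eval w s.reg ≠ 0 then p :: .loop e p :: rest else rest,
        s.tick (e.cost + 1)⟩

/-- One step of the machine; a configuration in which nothing remains to be done has halted. -/
noncomputable def step {k : ℕ} (w : ℕ) (T x : List ℕ) (g : Config k) : PMF (Config k) :=
  match g.todo with
  | [] => PMF.pure g
  | p :: rest => p.exec w T x rest g.st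

/-- The distribution of the configuration after `N` steps. -/
noncomputable def run {k : ℕ} (w : ℕ) (T x : List ℕ) : ℕ → Config k → PMF (Config k)
  | 0, g => PMF.pure g
  | N + 1, g => (step w T x g).bind (run w T x N)

/-- The initial configuration: registers and working memory are zero. -/
def start {k : ℕ} (P : Cmd k) : Config k :=
  ⟨[P], ⟨fun _ => 0, fun _ => 0, [], 0, 0⟩⟩

/-- On word length `w`, text `T` and further input `x`, whatever the random choices, the program
`P` halts after at most `τ` elementary operations having used at most `s` words of space
(registers included; the read-only input and the output stream are not counted), and the
probability that its output violates `Good` is at most `δ`. -/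
def Achieves {k : ℕ} (P : Cmd k) (w : ℕ) (T x : List ℕ) (Good : List ℕ → Prop)
    (τ s δ : ℝ) : Prop :=
  ∃ N : ℕ,
    (∀ g ∈ (run w T x N (start P)).support,
      g.todo = [] ∧ (g.st.time : ℝ) ≤ τ ∧ ((k + g.st.peak : ℕ) : ℝ) ≤ s) ∧
    (run w T x N (start P)).toOuterMeasure {g | ¬ Good g.st.out} ≤ ENNReal.ofReal δ

/-! ## Longest common prefixes and sparse suffix trees

Positions of the text are numbered from `0`; the suffix of `T` at position `i` is `T.drop i`. -/

/-- The length of the longest common prefix of two strings. -/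
def lcp : List ℕ → List ℕ → ℕ
  | a :: s, b :: t => if a = b then lcp s t + 1 else 0
  | _, _ => 0

/-- The answers to a batch of longest common prefix queries on suffixes of `T`. -/
def lcpAnswers (T : List ℕ) (Q : List (ℕ × ℕ)) : List ℕ :=
  Q.map fun q => lcp (T.drop q.1) (T.drop q.2)

/-- The input words, besides the text, for a batch `Q` of queries: the length of the text, the
alphabet size, the number of queries, the parameter `α`, and the queries. -/
def lcpInput (T : List ℕ) (σ : ℕ) (Q : List (ℕ × ℕ)) (α : ℕ) : List ℕ :=
  [T.length, σ, Q.length, α] ++ Q.flatMap fun q => [q.1, q.2]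

/-- The input words, besides the text, for the construction of a sparse suffix tree. -/
def treeInput (T : List ℕ) (σ : ℕ) (I : List ℕ) (α : ℕ) : List ℕ :=
  [T.length, σ, I.length, α] ++ I

/-- A node of a tree stored as an array: the index of its parent, start and length of an
occurrence in the text of the label of the edge from its parent, and its mark, which is `i + 1`
if the node represents the suffix at the interesting position `i`, and `0` if it represents no
such suffix. -/
structure TreeNode where
  parent : ℕ
  start : ℕ
  len : ℕ
  mark : ℕ

/-- The array `V` is the sparse suffix tree of `T` for the positions in `I`, the path label of
node `k` being `str k`. No terminator is assumed: a suffix which is a proper prefix of another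
one is represented by an inner node. Node `0` is the root; siblings are stored in increasing
order of the first letters of their (nonempty) edge labels, which are thus distinct. -/
structure IsSparseSuffixTreeWith (T I : List ℕ) (V : List TreeNode) (str : ℕ → List ℕ) :
    Prop where
  root : V[0]? = some ⟨0, 0, 0, 0⟩
  str_root : str 0 = []
  edge : ∀ (k : ℕ) (v : TreeNode), 0 < k → V[k]? = some v →
    v.parent < V.length ∧ 0 < v.len ∧ v.start + v.len ≤ T.length ∧
      str k = str v.parent ++ (T.drop v.start).take v.len
  siblings : ∀ (j k : ℕ) (u v : TreeNode), 0 < j → j < k → V[j]? = some u → V[k]? = some v →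
    u.parent = v.parent → T.getD u.start 0 < T.getD v.start 0
  mark_sound : ∀ (k : ℕ) (v : TreeNode), V[k]? = some v → v.mark ≠ 0 →
    ∃ i ∈ I, v.mark = i + 1 ∧ str k = T.drop i
  mark_complete : ∀ i ∈ I, ∃ v ∈ V, v.mark = i + 1
  branching : ∀ (k : ℕ) (v : TreeNode), 0 < k → V[k]? = some v → v.mark = 0 →
    ∃ (i j : ℕ) (u u' : TreeNode), 0 < i ∧ i < j ∧ V[i]? = some u ∧ V[j]? = some u' ∧
      u.parent = k ∧ u'.parent = k

/-- The array `V` is the sparse suffix tree of `T` for the positions in `I`. -/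
def IsSparseSuffixTree (T I : List ℕ) (V : List TreeNode) : Prop :=
  ∃ str : ℕ → List ℕ, IsSparseSuffixTreeWith T I V str

/-- The words that represent an array of nodes. -/
def encodeTree (V : List TreeNode) : List ℕ :=
  V.flatMap fun v => [v.parent, v.start, v.len, v.mark]

/-- The output words represent the sparse suffix tree of `T` for the positions in `I`. -/
def IsTreeOutput (T I : List ℕ) (out : List ℕ) : Prop :=
  ∃ V : List TreeNode, out = encodeTree V ∧ IsSparseSuffixTree T I V

/-- `T` is a string over the integer alphabet `{1, …, σ}`. -/
def OverAlphabet (σ : ℕ) (T : List ℕ) : Prop :=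
  ∀ t ∈ T, 1 ≤ t ∧ t ≤ σ

end SparseSuffix

namespace SparseSuffix

/-! ## A program logic for the word RAM -/

section Logic

variable {k : ℕ} {w : ℕ} {T x : List ℕ}

/-! Comparisons of substrings are replaced by comparisons of fingerprints. A seed `u < σ p³` encodes
a multiplier `a < σ p` and an element `r` of the field with `p²` elements. The multiplier defines a
hash `h` from letters to residues, and the prefix of length `i` receives the value `∑ h(t_m) r^m`
over `m < i`. Two substrings of equal length are compared through the values at their four ends and
the powers of `r` at their two starts. Equal substrings always pass (`same_of_eq`). Different
substrings disagree at some letter; the hashes of the two letters collide for at most `5σ`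
multipliers (`card_charHash_eq`), and otherwise the test succeeds only if `r` is a root of a nonzero
polynomial of degree at most `n`. If `n ≤ c³` and `12c² < p`, at most a fraction `1/c` of the seeds
is misled (`card_same_le`).

The size of `p` is a compromise. With `c` the rounded-up cube root of `n`, a prime between `12c²`
and `24c²` is found by trial division in `O(c² · c) = O(n)` steps, with no randomness and no error.
Such a prime may be far smaller than `n`, hence the quadratic extension, whose `p²` elements
outnumber the possible roots. A nonresidue is found by Euler's criterion, again in `O(n)` steps.

A constant number `κ = 3(e + 3)` of independent seeds suffices for the failure exponent `e`. At most
`n³` triples of two starts and a length are at stake, and every draw divides the expected number of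
triples that mislead all seeds so far by at least `c` (`sum_card_fooled_le`). So with probability at
least `1 - n³ c^(-κ) ≥ 1 - n^(-e)` none is left (`Ach.drawLoop`, `pow_bound`).

One pass over the text per seed stores the fingerprints of the prefixes whose lengths are multiples
of `g = ⌊n/(αb)⌋ + 1`; these are at most `αb` per seed, and any other prefix is reached in fewer
than `g` steps. A query tests the lengths `R 2^i` with `R = ⌊n/b⌋ + 1` in decreasing order and
finishes with `R` comparisons of letters, so it makes only `O(log b)` tests of cost `O(g)`.
Altogether `b` queries cost `O(n + b + (n/α + b) log b)`, which is within the required bound because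
`log α ≤ α`.

For the tree, the suffixes are extracted in increasing order from a tournament, each extraction
needing `O(log b)` queries, and are inserted into a compacted trie along its rightmost path, which
is kept on a stack. The branching depth of a new suffix is its common prefix with its predecessor,
and popping the stack is paid for by amortization. This costs one more factor `log b`, which cancels
up to `1/ε` if `α = ⌈b^ε⌉`, since then `log α ≥ ε log b`.

The only random commands are the draws of the seeds; everything else is specified by the
deterministic `wp`. Time and space bounds are shown for all outcomes of the draws, correctness only
under `GoodSeeds`. -/

theorem run_add (N M : ℕ) (g : Config k) :
    run w T x (N + M) g = (run w T x N g).bind (run w T x M) := by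
  induction N generalizing g with
  | zero => simp [run]
  | succ N ih =>
    rw [Nat.add_right_comm]
    simp only [run, PMF.bind_bind]
    congr 1
    funext g'
    exact ih g'

theorem run_nil (N : ℕ) (s : State k) : run w T x N ⟨[], s⟩ = PMF.pure ⟨[], s⟩ := by
  induction N with
  | zero => rfl
  | succ N ih => simp [run, step, ih]

variable (w T x) in
/-- The command `c` deterministically transforms `s` into `s'`. -/
def Runs (c : Cmd k) (s s' : State k) : Prop :=
  ∃ N, ∀ rest, run w T x N ⟨c :: rest, s⟩ = PMF.pure ⟨rest, s'⟩

theorem Runs.of_exec {c : Cmd k} {s s' : State k}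
    (h : ∀ rest, c.exec w T x rest s = PMF.pure ⟨rest, s'⟩) : Runs w T x c s s' :=
  ⟨1, fun rest => by simp [run, step, h]⟩

theorem Runs.seq {p q : Cmd k} {s s₁ s₂ : State k} (h₁ : Runs w T x p (s.tick 1) s₁)
    (h₂ : Runs w T x q s₁ s₂) : Runs w T x (.seq p q) s s₂ := by
  obtain ⟨N, hN⟩ := h₁
  obtain ⟨M, hM⟩ := h₂
  refine ⟨1 + (N + M), fun rest => ?_⟩
  rw [run_add]
  simp [run, step, Cmd.exec, hN, hM, run_add N M]

theorem Runs.ite {e : Expr k} {p q : Cmd k} {s s' : State k}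
    (h : Runs w T x (if e.eval w s.reg ≠ 0 then p else q) (s.tick (e.cost + 1)) s') :
    Runs w T x (.ite e p q) s s' := by
  obtain ⟨N, hN⟩ := h
  refine ⟨1 + N, fun rest => ?_⟩
  rw [run_add]
  simp only [run, step, Cmd.exec, PMF.pure_bind, PMF.bind_pure]
  exact hN rest

theorem Runs.loop_false {e : Expr k} {p : Cmd k} {s : State k} (he : e.eval w s.reg = 0) :
    Runs w T x (.loop e p) s (s.tick (e.cost + 1)) :=
  .of_exec fun rest => by simp [Cmd.exec, he]

theorem Runs.loop_true {e : Expr k} {p : Cmd k} {s s₁ s₂ : State k}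
    (he : e.eval w s.reg ≠ 0) (h₁ : Runs w T x p (s.tick (e.cost + 1)) s₁)
    (h₂ : Runs w T x (.loop e p) s₁ s₂) : Runs w T x (.loop e p) s s₂ := by
  obtain ⟨N, hN⟩ := h₁
  obtain ⟨M, hM⟩ := h₂
  refine ⟨1 + (N + M), fun rest => ?_⟩
  rw [run_add]
  simp [run, step, Cmd.exec, hN, hM, he, run_add N M]

variable (w T x) in
/-- A precondition under which a command without random choices ends in a state satisfying `Q`. -/
def wp : Cmd k → (State k → Prop) → State k → Prop
  | .skip, Q, s => Q ⟨s.reg, s.mem, s.out, s.time + 1, s.peak⟩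
  | .set r e, Q, s =>
      Q ⟨Function.update s.reg r (e.eval w s.reg), s.mem, s.out, s.time + (e.cost + 1), s.peak⟩
  | .load r e, Q, s =>
      Q ⟨Function.update s.reg r (s.mem (e.eval w s.reg)), s.mem, s.out, s.time + (e.cost + 1),
        max s.peak (e.eval w s.reg + 1)⟩
  | .store a e, Q, s =>
      Q ⟨s.reg, Function.update s.mem (a.eval w s.reg) (e.eval w s.reg), s.out,
        s.time + (a.cost + e.cost + 1), max s.peak (a.eval w s.reg + 1)⟩
  | .text r e, Q, s =>
      Q ⟨Function.update s.reg r (T.getD (e.eval w s.reg) 0 % 2 ^ w), s.mem, s.out,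
        s.time + (e.cost + 1), s.peak⟩
  | .arg r e, Q, s =>
      Q ⟨Function.update s.reg r (x.getD (e.eval w s.reg) 0 % 2 ^ w), s.mem, s.out,
        s.time + (e.cost + 1), s.peak⟩
  -- Draws have no deterministic outcome; they are treated by `Ach.rand` alone.
  | .rand _ _, _, _ => False
  | .emit e, Q, s =>
      Q ⟨s.reg, s.mem, s.out ++ [e.eval w s.reg], s.time + (e.cost + 1), s.peak⟩
  | .seq p q, Q, s => wp p (wp q Q) ⟨s.reg, s.mem, s.out, s.time + 1, s.peak⟩
  | .ite e p q, Q, s =>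
      if e.eval w s.reg = 0 then wp q Q ⟨s.reg, s.mem, s.out, s.time + (e.cost + 1), s.peak⟩
      else wp p Q ⟨s.reg, s.mem, s.out, s.time + (e.cost + 1), s.peak⟩
  -- A loop asks for an actual execution, so that `wp` itself needs no invariants; these enter
  -- through `wp_while` and `wp_for`.
  | .loop e p, Q, s => ∃ s', Runs w T x (.loop e p) s s' ∧ Q s'

theorem wp_sound (c : Cmd k) {Q : State k → Prop} {s : State k} (h : wp w T x c Q s) :
    ∃ s', Runs w T x c s s' ∧ Q s' := by
  induction c generalizing Q s with
  | rand r e => exact h.elim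
  | seq p q ihp ihq =>
    obtain ⟨s₁, h₁, h⟩ := ihp h
    obtain ⟨s₂, h₂, h⟩ := ihq h
    exact ⟨s₂, .seq h₁ h₂, h⟩
  | ite e p q ihp ihq =>
    rw [wp] at h
    split_ifs at h with he
    · obtain ⟨s', h', h⟩ := ihq h
      exact ⟨s', .ite (by simpa [he, State.tick] using h'), h⟩
    · obtain ⟨s', h', h⟩ := ihp h
      exact ⟨s', .ite (by simpa [he, State.tick] using h'), h⟩
  | loop e p => exact h
  | _ => exact ⟨_, .of_exec fun rest => rfl, h⟩

theorem wp_mono (c : Cmd k) {Q Q' : State k → Prop} (hQ : ∀ s, Q s → Q' s) {s : State k}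
    (h : wp w T x c Q s) : wp w T x c Q' s := by
  induction c generalizing Q Q' s with
  | rand r e => exact h
  | seq p q ihp ihq => exact ihp (fun _ => ihq hQ) h
  | ite e p q ihp ihq =>
    rw [wp] at h ⊢
    split_ifs at h ⊢ with he
    · exact ihq hQ h
    · exact ihp hQ h
  | loop e p => exact h.imp fun s' h => ⟨h.1, hQ _ h.2⟩
  | _ => exact hQ _ h

/-- Total correctness of loops, with a measure that decreases. -/
theorem wp_while {e : Expr k} {p : Cmd k} {Q : State k → Prop} (I : ℕ → State k → Prop)
    (hb : ∀ m s, I m s → e.eval w s.reg ≠ 0 →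
      wp w T x p (fun s' => ∃ m' < m, I m' s')
        ⟨s.reg, s.mem, s.out, s.time + (e.cost + 1), s.peak⟩)
    (he : ∀ m s, I m s → e.eval w s.reg = 0 →
      Q ⟨s.reg, s.mem, s.out, s.time + (e.cost + 1), s.peak⟩)
    {m : ℕ} {s : State k} (hs : I m s) : wp w T x (.loop e p) Q s := by
  induction m using Nat.strong_induction_on generalizing s with
  | _ m ih =>
    by_cases h0 : e.eval w s.reg = 0
    · exact ⟨_, .loop_false h0, he _ _ hs h0⟩
    · obtain ⟨s₁, h₁, m', hm', hI⟩ := wp_sound p (hb _ _ hs h0)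
      obtain ⟨s₂, h₂, hQ⟩ := ih m' hm' hI
      exact ⟨s₂, .loop_true h0 h₁ h₂, hQ⟩

/-- Total correctness of counting loops. -/
theorem wp_for {e : Expr k} {p : Cmd k} {Q : State k → Prop} (n : ℕ) (I : ℕ → State k → Prop)
    (hc : ∀ i s, i ≤ n → I i s → (e.eval w s.reg = 0 ↔ i = n))
    (hb : ∀ i s, i < n → I i s → wp w T x p (I (i + 1))
        ⟨s.reg, s.mem, s.out, s.time + (e.cost + 1), s.peak⟩)
    (he : ∀ s, I n s → Q ⟨s.reg, s.mem, s.out, s.time + (e.cost + 1), s.peak⟩)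
    {s : State k} (hs : I 0 s) : wp w T x (.loop e p) Q s := by
  refine wp_while (fun m s => ∃ i, i + m = n ∧ I i s) ?_ ?_ (m := n) ⟨0, by omega, hs⟩
  · rintro m s ⟨i, hi, hI⟩ h0
    have h0 := mt (hc i s (by omega) hI).2 h0
    refine wp_mono _ ?_ (hb i s (by omega) hI)
    exact fun s' h => ⟨m - 1, by omega, i + 1, by omega, h⟩
  · rintro m s ⟨i, hi, hI⟩ h0
    have h0 := (hc i s (by omega) hI).1 h0
    subst h0
    exact he s hI

/-! ### Randomized executions -/

variable (w T x) in
/-- From the configuration `g` the machine always halts in a state satisfying `A`, and the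
probability that `B` holds in this state is at most `ε`. -/
def Ach (A B : State k → Prop) (ε : ENNReal) (g : Config k) : Prop :=
  ∃ N, (∀ g' ∈ (run w T x N g).support, g'.todo = [] ∧ A g'.st) ∧
    (run w T x N g).toOuterMeasure {g' | B g'.st} ≤ ε

variable {A B : State k → Prop} {ε : ENNReal}

theorem Ach.mono_eps {ε' : ENNReal} {g : Config k} (h : Ach w T x A B ε g) (hε : ε ≤ ε') :
    Ach w T x A B ε' g := by
  obtain ⟨N, h₁, h₂⟩ := h
  exact ⟨N, h₁, h₂.trans hε⟩

theorem Ach.of_run {N : ℕ} {g g' : Config k} (h : run w T x N g = PMF.pure g')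
    (h' : Ach w T x A B ε g') : Ach w T x A B ε g := by
  obtain ⟨M, h₁, h₂⟩ := h'
  refine ⟨N + M, ?_, ?_⟩
  · rw [run_add, h, PMF.pure_bind]; exact h₁
  · rw [run_add, h, PMF.pure_bind]; exact h₂

theorem Ach.of_wp {c : Cmd k} {rest : List (Cmd k)} {Q : State k → Prop} {s : State k}
    (h : wp w T x c Q s) (h' : ∀ s', Q s' → Ach w T x A B ε ⟨rest, s'⟩) :
    Ach w T x A B ε ⟨c :: rest, s⟩ := by
  obtain ⟨s', ⟨N, hN⟩, hQ⟩ := wp_sound c h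
  exact .of_run (hN rest) (h' s' hQ)

theorem Ach.halt_good {s : State k} (hA : A s) (hB : ¬ B s) : Ach w T x A B 0 ⟨[], s⟩ := by
  refine ⟨0, ?_, ?_⟩
  · simp [run, hA]
  · simp [run, hB]

theorem Ach.halt {s : State k} (hA : A s) : Ach w T x A B 1 ⟨[], s⟩ := by
  refine ⟨0, ?_, ?_⟩
  · simp [run, hA]
  · by_cases hB : B s <;> simp [run, hB]

theorem Ach.seq {p q : Cmd k} {rest : List (Cmd k)} {s : State k}
    (h : Ach w T x A B ε ⟨p :: q :: rest, ⟨s.reg, s.mem, s.out, s.time + 1, s.peak⟩⟩) :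
    Ach w T x A B ε ⟨.seq p q :: rest, s⟩ :=
  .of_run (N := 1) (by simp [run, step, Cmd.exec, State.tick]) h

theorem Ach.loop_true {e : Expr k} {p : Cmd k} {rest : List (Cmd k)} {s : State k}
    (he : e.eval w s.reg ≠ 0)
    (h : Ach w T x A B ε ⟨p :: .loop e p :: rest,
      ⟨s.reg, s.mem, s.out, s.time + (e.cost + 1), s.peak⟩⟩) :
    Ach w T x A B ε ⟨.loop e p :: rest, s⟩ :=
  .of_run (N := 1) (by simp [run, step, Cmd.exec, State.tick, he]) h

theorem Ach.loop_false {e : Expr k} {p : Cmd k} {rest : List (Cmd k)} {s : State k}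
    (he : e.eval w s.reg = 0)
    (h : Ach w T x A B ε ⟨rest, ⟨s.reg, s.mem, s.out, s.time + (e.cost + 1), s.peak⟩⟩) :
    Ach w T x A B ε ⟨.loop e p :: rest, s⟩ :=
  .of_run (N := 1) (by simp [run, step, Cmd.exec, State.tick, he]) h

/-- Halted configurations are fixed points of `step`. This lets the branches after a random draw,
which may halt at different times, be run for a common number of steps. -/
theorem run_eq_of_halted {N M : ℕ} (hNM : N ≤ M) {g : Config k}
    (h : ∀ g' ∈ (run w T x N g).support, g'.todo = []) :
    run w T x M g = run w T x N g := by
  obtain ⟨d, rfl⟩ := Nat.exists_eq_add_of_le hNM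
  rw [run_add]
  conv_rhs => rw [← PMF.bind_pure (run w T x N g)]
  ext a
  simp only [PMF.bind_apply]
  refine tsum_congr fun g' => ?_
  by_cases hg : run w T x N g g' = 0
  · simp [hg]
  · have := h g' ((PMF.mem_support_iff _ _).2 hg)
    obtain ⟨todo, st⟩ := g'
    subst this
    rw [run_nil]

/-- The failure probability of a uniform draw is the average of the failure probabilities of its
outcomes, while the guarantee `A` must hold for each of them. -/
theorem Ach.rand {r : Fin k} {e : Expr k} {rest : List (Cmd k)} {s : State k} {m : ℕ}
    (hm : 0 < m) (he : e.eval w s.reg = m) (ε : ℕ → ENNReal)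
    (h : ∀ v < m, Ach w T x A B (ε v)
      ⟨rest, ⟨Function.update s.reg r v, s.mem, s.out, s.time + (e.cost + 1), s.peak⟩⟩) :
    Ach w T x A B ((∑ v ∈ Finset.range m, ε v) / m) ⟨.rand r e :: rest, s⟩ := by
  have hrun : ∀ N, run w T x (1 + N) ⟨.rand r e :: rest, s⟩ =
      (uniformBelow m).bind fun v => run w T x N
        ⟨rest, ⟨Function.update s.reg r v, s.mem, s.out, s.time + (e.cost + 1), s.peak⟩⟩ := by
    intro N
    rw [run_add]
    simp only [run, step, Cmd.exec, he, PMF.bind_pure, PMF.bind_map]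
    rfl
  choose! N hN hε using h
  obtain ⟨M, hM⟩ : ∃ M, ∀ v < m, N v ≤ M :=
    ⟨(Finset.range m).sup N, fun v hv => Finset.le_sup (Finset.mem_range.2 hv)⟩
  have hEq : ∀ v < m, run w T x M _ = _ := fun v hv =>
    run_eq_of_halted (hM v hv) fun g' hg' => (hN v hv g' hg').1
  have hu : ∀ v, uniformBelow m v = if v < m then (m : ENNReal)⁻¹ else 0 := by
    intro v
    simp [uniformBelow, hm, PMF.uniformOfFinset_apply]
  refine ⟨1 + M, ?_, ?_⟩
  · intro g' hg'
    rw [hrun, PMF.mem_support_bind_iff] at hg'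
    obtain ⟨v, hv, hg'⟩ := hg'
    rw [PMF.mem_support_iff, hu] at hv
    have hv : v < m := by by_contra h; simp [h] at hv
    rw [hEq v hv] at hg'
    exact hN v hv g' hg'
  · rw [hrun, PMF.toOuterMeasure_bind_apply, tsum_eq_sum (s := Finset.range m)]
    · rw [ENNReal.div_eq_inv_mul, Finset.mul_sum]
      refine Finset.sum_le_sum fun v hv => ?_
      have hv := Finset.mem_range.1 hv
      rw [hu, if_pos hv, hEq v hv]
      gcongr
      exact hε v hv
    · intro v hv
      rw [hu, if_neg (by simpa using hv), zero_mul]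

end Logic

end SparseSuffix

namespace SparseSuffix

/-! ## Fingerprints -/

/-- A universal hash function on characters. -/
def charHash (σ p a ch : ℕ) : ℕ := a * ch % (σ * p) / σ

/-- The elements `f0 + f1 √ν` and `p0 + p1 √ν` of a quadratic extension of `ℤ / p`. -/
structure Pt where
  f0 : ℕ
  f1 : ℕ
  p0 : ℕ
  p1 : ℕ

def Pt.next (p ν r0 r1 h : ℕ) (z : Pt) : Pt :=
  ⟨(z.f0 + h * z.p0) % p, (z.f1 + h * z.p1) % p, (z.p0 * r0 + ν * (z.p1 * r1)) % p,
    (z.p0 * r1 + z.p1 * r0) % p⟩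

/-- The fingerprint of the prefix of length `i` of `T` with seed `u`, together with the `i`-th power
of the base point. -/
def pref (σ p ν : ℕ) (T : List ℕ) (u : ℕ) : ℕ → Pt
  | 0 => ⟨0, 0, 1, 0⟩
  | i + 1 => (pref σ p ν T u i).next p ν (u / p % p) (u % p)
      (charHash σ p (u / (p * p)) (T.getD i 0))

/-- The test for equality of two substrings, given the fingerprints of the prefixes before and
after them. -/
def Pt.Match (p ν : ℕ) (A B C D : Pt) : Prop :=
  -- These are the coordinates of `C · r^j + B · r^i = D · r^i + A · r^j`, that is, of `(C - A) r^j
  -- = (D - B) r^i` with the negative terms moved to the other side to avoid subtraction of natural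
  -- numbers.
  (C.f0 * B.p0 + ν * (C.f1 * B.p1) + (B.f0 * A.p0 + ν * (B.f1 * A.p1))) % p =
    (D.f0 * A.p0 + ν * (D.f1 * A.p1) + (A.f0 * B.p0 + ν * (A.f1 * B.p1))) % p ∧
  (C.f0 * B.p1 + C.f1 * B.p0 + (B.f0 * A.p1 + B.f1 * A.p0)) % p =
    (D.f0 * A.p1 + D.f1 * A.p0 + (A.f0 * B.p1 + A.f1 * B.p0)) % p

instance (p ν : ℕ) (A B C D : Pt) : Decidable (Pt.Match p ν A B C D) := by
  unfold Pt.Match; infer_instance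

/-- The fingerprints with seed `u` do not distinguish the substrings of length `L` at `i` and `j`. -/
def Same (σ p ν : ℕ) (T : List ℕ) (i j L u : ℕ) : Prop :=
  Pt.Match p ν (pref σ p ν T u i) (pref σ p ν T u j) (pref σ p ν T u (i + L))
    (pref σ p ν T u (j + L))

instance (σ p ν : ℕ) (T : List ℕ) (i j L u : ℕ) : Decidable (Same σ p ν T i j L u) := by
  unfold Same; infer_instance

theorem charHash_lt {σ p a ch : ℕ} (hσ : 0 < σ) (hp : 0 < p) : charHash σ p a ch < p := by
  rw [charHash, Nat.div_lt_iff_lt_mul hσ, Nat.mul_comm p]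
  exact Nat.mod_lt _ (by positivity)

theorem pref_lt {σ p ν : ℕ} {T : List ℕ} {u : ℕ} (hp : 1 < p) (i : ℕ) :
    (pref σ p ν T u i).f0 < p ∧ (pref σ p ν T u i).f1 < p ∧ (pref σ p ν T u i).p0 < p ∧
      (pref σ p ν T u i).p1 < p := by
  have h0 : 0 < p := by omega
  cases i with
  | zero => exact ⟨h0, h0, hp, h0⟩
  | succ i => exact ⟨Nat.mod_lt _ h0, Nat.mod_lt _ h0, Nat.mod_lt _ h0, Nat.mod_lt _ h0⟩

/-- If `c` and `d` collide, then `a c` and `a d` have residues modulo `σ p` in the same block of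
length `σ`, so `a (c - d)` is within distance `σ` of a multiple `q σ p` with `q ≤ c - d`. For fixed
`q` such `a` lie in an interval of length at most `2σ / (c - d)`. -/
theorem card_charHash_eq_aux {σ p c d : ℕ} (hp : 2 ≤ p) (hc : c ≤ σ) (hd : 1 ≤ d)
    (hdc : d < c) :
    ((Finset.range (σ * p)).filter fun a => charHash σ p a c = charHash σ p a d).card ≤ 5 * σ := by
  have hσ : 0 < σ := by omega
  obtain ⟨e, rfl⟩ := Nat.exists_eq_add_of_lt hdc
  set e' := e + 1 with he'
  set B : ℕ → Finset ℕ := fun q =>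
    (Finset.range (σ * p)).filter fun a => q * (σ * p) < a * e' + σ ∧ a * e' < q * (σ * p) + σ
  have hB : ∀ q, (B q).card ≤ 2 * σ / e' + 1 := by
    intro q
    rcases (B q).eq_empty_or_nonempty with h | h
    · simp [h]
    · have hm := Finset.min'_mem _ h
      set a₀ := (B q).min' h
      have hs : B q ⊆ Finset.Icc a₀ (a₀ + 2 * σ / e') := by
        intro a ha
        have h₁ : a₀ ≤ a := Finset.min'_le _ _ ha
        simp only [B, Finset.mem_filter] at ha hm
        rw [Finset.mem_Icc]
        refine ⟨h₁, ?_⟩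
        obtain ⟨t, rfl⟩ := Nat.exists_eq_add_of_le h₁
        have : t ≤ 2 * σ / e' := by
          rw [Nat.le_div_iff_mul_le (by omega)]
          have h₂ := ha.2.2
          rw [Nat.add_mul] at h₂
          omega
        omega
      refine (Finset.card_le_card hs).trans ?_
      rw [Nat.card_Icc]
      generalize 2 * σ / e' = y
      omega
  have hsub : ((Finset.range (σ * p)).filter fun a =>
      charHash σ p a (d + e + 1) = charHash σ p a d) ⊆ (Finset.range (e' + 1)).biUnion B := by
    intro a ha
    rw [Finset.mem_filter, Finset.mem_range] at ha
    obtain ⟨ha, h⟩ := ha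
    simp only [Finset.mem_biUnion, Finset.mem_range, B, Finset.mem_filter]
    rw [charHash, charHash] at h
    set M := σ * p with hM
    have hMσ : 2 * σ ≤ M := by rw [hM, Nat.mul_comm]; exact Nat.mul_le_mul_left _ hp
    set q₁ := a * (d + e + 1) / M
    set q₂ := a * d / M
    have e₁ : a * (d + e + 1) = M * q₁ + a * (d + e + 1) % M := (Nat.div_add_mod _ _).symm
    have e₂ : a * d = M * q₂ + a * d % M := (Nat.div_add_mod _ _).symm
    set x₁ := a * (d + e + 1) % M
    set x₂ := a * d % M
    have f₁ := Nat.div_add_mod x₁ σ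
    have f₂ := Nat.div_add_mod x₂ σ
    have g₁ := Nat.mod_lt x₁ hσ
    have g₂ := Nat.mod_lt x₂ hσ
    rw [h] at f₁
    have hsum : a * (d + e + 1) = a * d + a * e' := by rw [he']; ring
    have hae : a * e' ≤ M * e' := Nat.mul_le_mul_right _ ha.le
    have hx₁ : x₁ < M := Nat.mod_lt _ (by omega)
    have hx₂ : x₂ < M := Nat.mod_lt _ (by omega)
    have hq : q₂ ≤ q₁ := Nat.div_le_div_right (Nat.mul_le_mul_left _ (by omega))
    obtain ⟨q, hq⟩ := Nat.exists_eq_add_of_le hq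
    rw [hq, Nat.mul_add M] at e₁
    refine ⟨q, ?_, ha, ?_, ?_⟩
    · by_contra hcon
      have : M * (e' + 1) ≤ M * q := Nat.mul_le_mul_left _ (by omega)
      rw [Nat.mul_add, Nat.mul_one] at this
      omega
    · rw [Nat.mul_comm q]; omega
    · rw [Nat.mul_comm q]; omega
  refine (Finset.card_le_card hsub).trans (Finset.card_biUnion_le.trans ?_)
  refine (Finset.sum_le_sum fun q _ => hB q).trans ?_
  rw [Finset.sum_const, Finset.card_range, smul_eq_mul]
  -- The count is at most `(e' + 1)(2σ/e' + 1) ≤ 2σ + 2σ + e' + 1`; since `d ≥ 1`, also `e' + 1 ≤ c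
  -- ≤ σ`.
  have h₁ := Nat.mul_div_le (2 * σ) e'
  have h₂ := Nat.div_le_self (2 * σ) e'
  have : (e' + 1) * (2 * σ / e' + 1) = e' * (2 * σ / e') + 2 * σ / e' + e' + 1 := by ring
  omega

theorem card_charHash_eq {σ p c d : ℕ} (hp : 2 ≤ p) (hc : 1 ≤ c ∧ c ≤ σ) (hd : 1 ≤ d ∧ d ≤ σ)
    (hcd : c ≠ d) :
    ((Finset.range (σ * p)).filter fun a => charHash σ p a c = charHash σ p a d).card ≤ 5 * σ := by
  rcases lt_or_gt_of_ne hcd with h | h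
  · simp_rw [eq_comm (a := charHash σ p _ c)]
    exact card_charHash_eq_aux hp hd.2 hc.1 h
  · exact card_charHash_eq_aux hp hc.2 hd.1 h

/-! ### The field with `p²` elements and the number of misleading seeds. -/

section Field

open Polynomial

variable {σ p ν : ℕ} {T : List ℕ}

/-- Identifies the machine's four residues with a polynomial value and a power in the quadratic
extension. The second coordinate of the base point can be `u` instead of `u % p`, since the cast to
`ZMod p` reduces it. -/
theorem pref_cast (u i : ℕ) :
    (⟨(pref σ p ν T u i).f0, (pref σ p ν T u i).f1⟩ : QuadraticAlgebra (ZMod p) ν 0) =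
      ∑ m ∈ Finset.range i, (charHash σ p (u / (p * p)) (T.getD m 0) :
        QuadraticAlgebra (ZMod p) ν 0) * ⟨((u / p : ℕ) : ZMod p), (u : ZMod p)⟩ ^ m ∧
    (⟨(pref σ p ν T u i).p0, (pref σ p ν T u i).p1⟩ : QuadraticAlgebra (ZMod p) ν 0) =
      ⟨((u / p : ℕ) : ZMod p), (u : ZMod p)⟩ ^ i := by
  induction i with
  | zero =>
    constructor
    · simp [pref, QuadraticAlgebra.ext_iff]
    · simp only [pref, Nat.cast_one, Nat.cast_zero, pow_zero]; rfl
  | succ i ih =>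
    rw [Finset.sum_range_succ, ← ih.1, pow_succ, ← ih.2]
    constructor
    · simp [pref, Pt.next, QuadraticAlgebra.ext_iff]
    · simp [pref, Pt.next, mul_assoc, add_comm]

/-- Few seeds fail to distinguish given different substrings. -/
theorem card_same_le (hp : p.Prime) (hν : ¬ IsSquare (ν : ZMod p)) {n c i j L m : ℕ}
    (hT : OverAlphabet σ T) (hn : T.length = n) (hc : n ≤ c ^ 3) (hpc : 12 * c ^ 2 < p)
    (hi : i + L ≤ n) (hj : j + L ≤ n) (hm : m < L)
    (hne : T.getD (i + m) 0 ≠ T.getD (j + m) 0) :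
    c * ((Finset.range (σ * p * p * p)).filter fun u => Same σ p ν T i j L u).card ≤
      σ * p * p * p := by
  have := Fact.mk hp
  -- As `ν` is a nonresidue, `X² - ν` has no root, which makes the quadratic algebra a field; this
  -- is needed for counting roots.
  have : Fact (∀ r : ZMod p, r ^ 2 ≠ ν + 0 * r) :=
    ⟨fun r h => hν ⟨r, by rw [← pow_two, h]; ring⟩⟩
  have hp0 := hp.pos
  have hchar : ∀ i < n, 1 ≤ T.getD i 0 ∧ T.getD i 0 ≤ σ := by
    intro i hi
    rw [List.getD_eq_getElem _ _ (by omega)]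
    exact hT _ (List.getElem_mem _)
  have hσ : 0 < σ := by have := hchar (i + m) (by omega); omega
  set S := (Finset.range (σ * p * p * p)).filter fun u => Same σ p ν T i j L u
  set bad := (Finset.range (σ * p)).filter fun a =>
    charHash σ p a (T.getD (i + m) 0) = charHash σ p a (T.getD (j + m) 0)
  have hbad : bad.card ≤ 5 * σ :=
    card_charHash_eq hp.two_le (hchar _ (by omega)) (hchar _ (by omega)) hne
  have hmap : ∀ u ∈ S, u / (p * p) ∈ Finset.range (σ * p) := by
    intro u hu
    rw [Finset.mem_range, Nat.div_lt_iff_lt_mul (by positivity)]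
    simpa [mul_assoc] using (Finset.mem_filter.1 hu).1
  have hdec : ∀ u, u = u / (p * p) * (p * p) + (u / p % p * p + u % p) := by
    intro u
    rw [← Nat.div_div_eq_div_mul]
    have h₁ := Nat.div_add_mod u p
    have h₂ := Nat.div_add_mod (u / p) p
    calc u = p * (u / p) + u % p := h₁.symm
      _ = p * (p * (u / p / p) + u / p % p) + u % p := by rw [h₂]
      _ = _ := by ring
  -- Seeds are sorted by their multiplier: a colliding `a` may spoil all `p²` base points, any other
  -- `a` at most `n` of them.
  have hfib : ∀ a ∈ Finset.range (σ * p),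
      (S.filter fun u => u / (p * p) = a).card ≤ (if a ∈ bad then p * p else 0) + n := by
    intro a ha
    by_cases hab : a ∈ bad
    · rw [if_pos hab]
      refine le_trans ?_ (Nat.le_add_right _ _)
      have : (S.filter fun u => u / (p * p) = a) ⊆ Finset.Ico (a * (p * p)) (a * (p * p) + p * p) := by
        intro u hu
        have hu := (Finset.mem_filter.1 hu).2
        have h₁ := Nat.div_add_mod u (p * p)
        have h₂ := Nat.mod_lt u (show 0 < p * p by positivity)
        rw [hu, Nat.mul_comm] at h₁
        rw [Finset.mem_Ico]
        omega
      simpa using Finset.card_le_card this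
    · rw [if_neg hab, zero_add]
      let K := QuadraticAlgebra (ZMod p) (ν : ZMod p) 0
      let h : ℕ → K := fun i => (charHash σ p a (T.getD i 0) : ℕ)
      let D : K[X] := ∑ m ∈ Finset.range L, C (h (i + m) - h (j + m)) * X ^ m
      have hD : D ≠ 0 := by
        intro h0
        -- If the coefficient at the position of disagreement vanished, two hash values below `p`
        -- would agree modulo `p`, hence be equal, and `a` would be in `bad`.
        have h1 : D.coeff m = 0 := by rw [h0, coeff_zero]
        simp only [D, finsetSum_coeff, coeff_C_mul, coeff_X_pow, mul_ite, mul_one, mul_zero,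
          Finset.sum_ite_eq, Finset.mem_range, hm, if_true] at h1
        have h2 : ((charHash σ p a (T.getD (i + m) 0) : ℕ) : ZMod p) =
            (charHash σ p a (T.getD (j + m) 0) : ℕ) := by
          have := congrArg QuadraticAlgebra.re (sub_eq_zero.1 h1)
          simp only [h] at this
          exact this
        rw [ZMod.natCast_eq_natCast_iff', Nat.mod_eq_of_lt (charHash_lt hσ hp0),
          Nat.mod_eq_of_lt (charHash_lt hσ hp0)] at h2
        exact hab (Finset.mem_filter.2 ⟨ha, h2⟩)
      have hdeg : D.natDegree ≤ L - 1 := by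
        refine natDegree_sum_le_of_forall_le _ _ fun m hm => ?_
        refine (natDegree_C_mul_X_pow_le _ _).trans ?_
        have := Finset.mem_range.1 hm
        omega
      -- The test can pass at `r = 0` whatever `D` is, so `0` is counted as a root too; the degree
      -- stays at most `L ≤ n`.
      have hXD : X * D ≠ 0 := mul_ne_zero X_ne_zero hD
      classical
      have hroots : (X * D).roots.toFinset.card ≤ n := by
        refine (Multiset.toFinset_card_le _).trans ((card_roots' _).trans ?_)
        rw [natDegree_mul X_ne_zero hD, natDegree_X]
        omega
      refine le_trans (Finset.card_le_card_of_injOn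
        (fun u => (⟨((u / p : ℕ) : ZMod p), (u : ZMod p)⟩ : K)) ?_ ?_) hroots
      · intro u hu
        obtain ⟨hu, hua⟩ := Finset.mem_filter.1 (Finset.mem_coe.1 hu)
        have hs := (Finset.mem_filter.1 hu).2
        rw [Finset.mem_coe, Multiset.mem_toFinset, mem_roots hXD, IsRoot.def, eval_mul, eval_X]
        beta_reduce
        set r : K := ⟨((u / p : ℕ) : ZMod p), (u : ZMod p)⟩
        by_cases hr : r = 0
        · rw [hr, zero_mul]
        have key : ∀ i, ((⟨(pref σ p ν T u i).f0, (pref σ p ν T u i).f1⟩ : K) =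
              ∑ m ∈ Finset.range i, h m * r ^ m) ∧
            (⟨(pref σ p ν T u i).p0, (pref σ p ν T u i).p1⟩ : K) = r ^ i := by
          intro i
          have := pref_cast (σ := σ) (p := p) (ν := ν) (T := T) u i
          rw [hua] at this
          exact this
        have hF : ∀ i, ∑ m ∈ Finset.range (i + L), h m * r ^ m =
            ∑ m ∈ Finset.range i, h m * r ^ m +
              r ^ i * ∑ m ∈ Finset.range L, h (i + m) * r ^ m := by
          intro i
          rw [Finset.sum_range_add, Finset.mul_sum]
          congr 1
          exact Finset.sum_congr rfl fun m _ => by rw [pow_add]; ring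
        obtain ⟨s₀, s₁⟩ := hs
        have hmatch : (⟨(pref σ p ν T u (i + L)).f0, (pref σ p ν T u (i + L)).f1⟩ : K) *
              ⟨(pref σ p ν T u j).p0, (pref σ p ν T u j).p1⟩ +
              ⟨(pref σ p ν T u j).f0, (pref σ p ν T u j).f1⟩ *
              ⟨(pref σ p ν T u i).p0, (pref σ p ν T u i).p1⟩ =
            (⟨(pref σ p ν T u (j + L)).f0, (pref σ p ν T u (j + L)).f1⟩ : K) *
              ⟨(pref σ p ν T u i).p0, (pref σ p ν T u i).p1⟩ +
              ⟨(pref σ p ν T u i).f0, (pref σ p ν T u i).f1⟩ *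
              ⟨(pref σ p ν T u j).p0, (pref σ p ν T u j).p1⟩ := by
          rw [← Nat.ModEq, ← ZMod.natCast_eq_natCast_iff] at s₀ s₁
          push_cast at s₀ s₁
          apply QuadraticAlgebra.ext
          · simpa [mul_assoc] using s₀
          · simpa [mul_assoc] using s₁
        rw [(key _).1, (key _).1, (key _).1, (key _).1, (key _).2, (key _).2, hF, hF] at hmatch
        have hfin : r ^ i * r ^ j * eval r D = 0 := by
          simp only [D, eval_finsetSum, eval_mul, eval_C, eval_pow, eval_X, sub_mul,
            Finset.sum_sub_distrib]
          linear_combination hmatch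
        rcases mul_eq_zero.1 hfin with h0 | h0
        · rcases mul_eq_zero.1 h0 with h0 | h0
          · exact absurd (eq_zero_of_pow_eq_zero h0) hr
          · exact absurd (eq_zero_of_pow_eq_zero h0) hr
        · rw [h0, mul_zero]
      -- With the multiplier fixed, the base point determines the two lower digits of `u` in base
      -- `p`, hence `u`.
      · intro u hu v hv huv
        have hua := (Finset.mem_filter.1 (Finset.mem_coe.1 hu)).2
        have hva := (Finset.mem_filter.1 (Finset.mem_coe.1 hv)).2
        have h₀ := congrArg QuadraticAlgebra.re huv
        have h₁ := congrArg QuadraticAlgebra.im huv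
        simp only [ZMod.natCast_eq_natCast_iff'] at h₀ h₁
        rw [hdec u, hdec v, hua, hva, h₀, h₁]
  have hcard : S.card ≤ 5 * σ * (p * p) + σ * p * n := by
    rw [Finset.card_eq_sum_card_fiberwise hmap]
    refine (Finset.sum_le_sum hfib).trans ?_
    rw [Finset.sum_add_distrib, Finset.sum_const, Finset.card_range, smul_eq_mul,
      ← Finset.sum_filter, Finset.sum_const, smul_eq_mul]
    refine Nat.add_le_add_right (Nat.mul_le_mul_right _ ?_) _
    refine le_trans (Finset.card_le_card ?_) hbad
    intro a ha
    exact (Finset.mem_filter.1 ha).2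
  refine (Nat.mul_le_mul_left c hcard).trans ?_
  have hc1 : c ≤ c ^ 2 := Nat.le_self_pow (by norm_num) c
  -- From `12c² < p`: `5cp ≤ (5/12) p²` because `c ≤ c²`, and `cn ≤ c⁴ ≤ p²/144`.
  have e1 : c * (5 * p + n) ≤ p * p := by
    have a1 : c * (5 * p) ≤ p * p - 7 * c * p := by
      have : 12 * c * p ≤ p * p := Nat.mul_le_mul_right _ (by omega)
      have : 12 * c * p = c * (5 * p) + 7 * c * p := by ring
      omega
    have a2 : c * n ≤ c ^ 2 * c ^ 2 := by
      calc c * n ≤ c * c ^ 3 := Nat.mul_le_mul_left _ hc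
        _ = _ := by ring
    have a3 : 12 * c ^ 2 * p ≤ p * p := Nat.mul_le_mul_right _ hpc.le
    have a4 : 12 * c ^ 2 * (12 * c ^ 2) ≤ 12 * c ^ 2 * p := Nat.mul_le_mul_left _ hpc.le
    have a5 : 12 * (c * p) ≤ 12 * (c ^ 2 * p) := by gcongr
    nlinarith
  calc c * (5 * σ * (p * p) + σ * p * n) = σ * p * (c * (5 * p + n)) := by ring
    _ ≤ σ * p * (p * p) := Nat.mul_le_mul_left _ e1
    _ = _ := by ring

end Field

end SparseSuffix

namespace SparseSuffix

/-! ## Longest common prefixes from fingerprints -/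

/-- Bertrand's postulate bounds the search for a prime; `2 ≤ s < p` makes `p` odd, so a nonsquare
exists. -/
theorem exists_prime_nonresidue {s : ℕ} (hs : 2 ≤ s) :
    (∃ q, q.Prime ∧ s < q ∧ q ≤ 2 * s) ∧
      ∀ p, p.Prime → s < p → ∃ a, 1 ≤ a ∧ a < p ∧ ¬ IsSquare (a : ZMod p) := by
  refine ⟨Nat.exists_prime_lt_and_le_two_mul s (by omega), fun p hp hsp => ?_⟩
  have := Fact.mk hp
  obtain ⟨z, hz⟩ := FiniteField.exists_nonsquare (F := ZMod p)
    (by rw [ZMod.ringChar_zmod_n]; omega)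
  refine ⟨z.val, ?_, ZMod.val_lt z, by rwa [ZMod.natCast_zmod_val]⟩
  rw [Nat.one_le_iff_ne_zero, ne_eq, ZMod.val_eq_zero]
  rintro rfl
  exact hz ⟨0, by simp⟩

/-- Euler's criterion in terms of remainders of natural numbers, which one modular power decides. -/
theorem not_isSquare_iff {p a : ℕ} (hp : p.Prime) (h2 : 2 < p) (ha : 1 ≤ a) (hap : a < p) :
    ¬ IsSquare (a : ZMod p) ↔ a ^ (p / 2) % p = p - 1 := by
  have := Fact.mk hp
  have ha0 : (a : ZMod p) ≠ 0 := by
    rw [ne_eq, ZMod.natCast_eq_zero_iff]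
    exact fun h => absurd (Nat.le_of_dvd (by omega) h) (by omega)
  have hne : (-1 : ZMod p) ≠ 1 := by
    have : Fact (2 < p) := ⟨h2⟩
    exact ZMod.neg_one_ne_one
  have e : a ^ (p / 2) % p = p - 1 ↔ (a : ZMod p) ^ (p / 2) = -1 := by
    have h : ((a ^ (p / 2) : ℕ) : ZMod p) = ((p - 1 : ℕ) : ZMod p) ↔ _ :=
      ZMod.natCast_eq_natCast_iff' _ _ _
    rw [Nat.mod_eq_of_lt (show p - 1 < p by omega)] at h
    rw [← h, Nat.cast_sub (by omega)]
    simp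
  rw [e, ZMod.euler_criterion p ha0]
  rcases ZMod.pow_div_two_eq_neg_one_or_one p ha0 with h | h
  · simp [h, hne.symm]
  · simp [h, hne]

/-! ### Longest common prefixes and the search for them. -/

section Lcp

theorem getD_drop (T : List ℕ) (i m : ℕ) : (T.drop i).getD m 0 = T.getD (i + m) 0 := by
  simp [List.getD]

theorem lcp_le (s t : List ℕ) : lcp s t ≤ s.length ∧ lcp s t ≤ t.length := by
  induction s generalizing t with
  | nil => simp [lcp]
  | cons a s ih =>
    cases t with
    | nil => simp [lcp]
    | cons b t =>
      rw [lcp]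
      split_ifs
      · simpa using ih t
      · simp

theorem getD_eq_of_lt_lcp (s t : List ℕ) {m : ℕ} (hm : m < lcp s t) :
    s.getD m 0 = t.getD m 0 := by
  induction s generalizing t m with
  | nil => simp [lcp] at hm
  | cons a s ih =>
    cases t with
    | nil => simp [lcp] at hm
    | cons b t =>
      rw [lcp] at hm
      split_ifs at hm with h
      · cases m with
        | zero => simpa using h
        | succ m => simpa using ih t (m := m) (by omega)
      · omega

theorem getD_lcp_ne (s t : List ℕ) (hs : lcp s t < s.length) (ht : lcp s t < t.length) :
    s.getD (lcp s t) 0 ≠ t.getD (lcp s t) 0 := by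
  induction s generalizing t with
  | nil => simp at hs
  | cons a s ih =>
    cases t with
    | nil => simp at ht
    | cons b t =>
      rw [lcp] at hs ht ⊢
      split_ifs at hs ht ⊢ with h
      · simpa using ih t (by simpa using hs) (by simpa using ht)
      · simpa using h

theorem le_lcp (s t : List ℕ) {l : ℕ} (hs : l ≤ s.length) (ht : l ≤ t.length)
    (h : ∀ m < l, s.getD m 0 = t.getD m 0) : l ≤ lcp s t := by
  by_contra hl
  push Not at hl
  exact getD_lcp_ne s t (by omega) (by omega) (h _ hl)

variable (T : List ℕ)

/-- The length of the longest common prefix of two suffixes. -/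
def suffixLcp (i j : ℕ) : ℕ := lcp (T.drop i) (T.drop j)

/-- The length of the shorter one of two suffixes. -/
def shorter (i j : ℕ) : ℕ := if i < j then T.length - j else T.length - i

theorem shorter_eq (i j : ℕ) : shorter T i j = min (T.length - i) (T.length - j) := by
  unfold shorter; split_ifs <;> omega

theorem suffixLcp_le (i j : ℕ) : suffixLcp T i j ≤ shorter T i j := by
  have := lcp_le (T.drop i) (T.drop j)
  simp only [List.length_drop] at this
  rw [shorter_eq]
  exact le_min this.1 this.2

variable {T}

theorem getD_eq_of_lt_suffixLcp {i j m : ℕ} (hm : m < suffixLcp T i j) :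
    T.getD (i + m) 0 = T.getD (j + m) 0 := by
  simpa only [getD_drop] using getD_eq_of_lt_lcp _ _ hm

theorem getD_suffixLcp_ne {i j : ℕ} (h : suffixLcp T i j < shorter T i j) :
    T.getD (i + suffixLcp T i j) 0 ≠ T.getD (j + suffixLcp T i j) 0 := by
  rw [shorter_eq, lt_min_iff] at h
  unfold suffixLcp at h ⊢
  have := getD_lcp_ne (T.drop i) (T.drop j) (by simpa using h.1) (by simpa using h.2)
  simpa only [getD_drop] using this

theorem le_suffixLcp {i j l : ℕ} (hl : l ≤ shorter T i j)
    (h : ∀ m < l, T.getD (i + m) 0 = T.getD (j + m) 0) : l ≤ suffixLcp T i j := by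
  rw [shorter_eq, le_min_iff] at hl
  refine le_lcp _ _ (by simpa using hl.1) (by simpa using hl.2) fun m hm => ?_
  simpa only [getD_drop] using h m hm

/-- Binary search for the longest common prefix, up to multiples of `R`. -/
def descend (R m : ℕ) (test : ℕ → ℕ → Prop) [∀ a b, Decidable (test a b)] : ℕ → ℕ → ℕ
  | 0, l => l
  | e + 1, l =>
      descend R m test e (if l + R * 2 ^ e ≤ m ∧ test l (R * 2 ^ e) then l + R * 2 ^ e else l)

variable (T) in
/-- Naive extension of a common prefix by `e` comparisons of characters. -/
def advance (i j m : ℕ) : ℕ → ℕ → ℕ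
  | 0, l => l
  | e + 1, l =>
      advance i j m e (if l < m ∧ T.getD (i + l) 0 = T.getD (j + l) 0 then l + 1 else l)

theorem descend_le {R m : ℕ} {test : ℕ → ℕ → Prop} [∀ a b, Decidable (test a b)] (e : ℕ)
    {l : ℕ} (hl : l ≤ m) : descend R m test e l ≤ m := by
  induction e generalizing l with
  | zero => exact hl
  | succ e ih =>
    apply ih
    split_ifs with h
    · exact h.1
    · exact hl

theorem advance_le {i j m : ℕ} (e : ℕ) {l : ℕ} (hl : l ≤ m) : advance T i j m e l ≤ m := by
  induction e generalizing l with
  | zero => exact hl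
  | succ e ih =>
    apply ih
    split_ifs with h
    · exact h.1
    · exact hl

/-- The invariant places the longest common prefix in `[l, l + R 2^e)`, and each round halves this
interval. A refused step exceeds the shorter suffix or reveals a difference; either way the lower
half remains. Since the first `l` letters are already known to agree, only the following block is
tested. -/
theorem descend_spec {R i j : ℕ} {test : ℕ → ℕ → Prop} [∀ a b, Decidable (test a b)]
    (htest : ∀ l L, l + L ≤ shorter T i j →
      (test l L ↔ ∀ m < L, T.getD (i + l + m) 0 = T.getD (j + l + m) 0)) (e : ℕ) {l : ℕ}
    (h₁ : l ≤ suffixLcp T i j) (h₂ : suffixLcp T i j < l + R * 2 ^ e) :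
    descend R (shorter T i j) test e l ≤ suffixLcp T i j ∧
      suffixLcp T i j < descend R (shorter T i j) test e l + R := by
  induction e generalizing l with
  | zero => exact ⟨h₁, by simpa [descend] using h₂⟩
  | succ e ih =>
    rw [descend]
    have hle := suffixLcp_le T i j
    have hpow : R * 2 ^ (e + 1) = R * 2 ^ e + R * 2 ^ e := by ring
    split_ifs with h
    · have ht := (htest _ _ h.1).1 h.2
      apply ih
      · refine le_suffixLcp h.1 fun m hm => ?_
        by_cases hml : m < l
        · exact getD_eq_of_lt_suffixLcp (by omega)
        · have := ht (m - l) (by omega)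
          rwa [show i + l + (m - l) = i + m by omega, show j + l + (m - l) = j + m by omega] at this
      · omega
    · apply ih h₁
      by_contra hcon
      push Not at hcon
      refine h ⟨by omega, (htest _ _ (by omega)).2 fun m hm => ?_⟩
      rw [add_assoc, add_assoc]
      exact getD_eq_of_lt_suffixLcp (by omega)

/-- Once `l` is the longest common prefix, the end of the shorter suffix or a mismatch blocks every
further step, so surplus rounds are harmless. -/
theorem advance_spec {i j : ℕ} (e : ℕ) {l : ℕ} (h₁ : l ≤ suffixLcp T i j)
    (h₂ : suffixLcp T i j ≤ l + e) : advance T i j (shorter T i j) e l = suffixLcp T i j := by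
  induction e generalizing l with
  | zero => rw [advance]; omega
  | succ e ih =>
    rw [advance]
    have hle := suffixLcp_le T i j
    by_cases hl : l < suffixLcp T i j
    · rw [if_pos ⟨by omega, getD_eq_of_lt_suffixLcp hl⟩]
      exact ih (by omega) (by omega)
    · have hl : l = suffixLcp T i j := by omega
      rw [if_neg]
      · exact ih h₁ (by omega)
      · rintro ⟨h, h'⟩
        subst hl
        exact getD_suffixLcp_ne h h'

/-- All fingerprints of two substrings agree. -/
def SameAll (σ p ν : ℕ) (T : List ℕ) (κ : ℕ) (u : ℕ → ℕ) (i j L : ℕ) : Prop :=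
  ∀ t < κ, Same σ p ν T i j L (u t)

instance (σ p ν : ℕ) (T : List ℕ) (κ : ℕ) (u : ℕ → ℕ) (i j L : ℕ) :
    Decidable (SameAll σ p ν T κ u i j L) := by
  unfold SameAll; infer_instance

/-- The result of the search for the longest common prefix with seeds `u`. -/
def hashLcp (σ p ν : ℕ) (T : List ℕ) (κ : ℕ) (u : ℕ → ℕ) (R Λ i j : ℕ) : ℕ :=
  advance T i j (shorter T i j) R
    (descend R (shorter T i j) (fun l L => SameAll σ p ν T κ u (i + l) (j + l) L) Λ 0)

/-- The seeds distinguish all pairs of different substrings. -/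
def GoodSeeds (σ p ν : ℕ) (T : List ℕ) (κ : ℕ) (u : ℕ → ℕ) : Prop :=
  ∀ i j L, i + L ≤ T.length → j + L ≤ T.length → SameAll σ p ν T κ u i j L →
    ∀ m < L, T.getD (i + m) 0 = T.getD (j + m) 0

theorem hashLcp_le (σ p ν : ℕ) (T : List ℕ) (κ : ℕ) (u : ℕ → ℕ) (R Λ i j : ℕ) :
    hashLcp σ p ν T κ u R Λ i j ≤ shorter T i j :=
  advance_le _ (descend_le _ (Nat.zero_le _))

/-- Fingerprints of equal substrings agree. -/
theorem same_of_eq {σ p ν u i j L : ℕ}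
    (h : ∀ m < L, T.getD (i + m) 0 = T.getD (j + m) 0) : Same σ p ν T i j L u := by
  let K := QuadraticAlgebra (ZMod p) (ν : ZMod p) 0
  let h' : ℕ → K := fun i => (charHash σ p (u / (p * p)) (T.getD i 0) : ℕ)
  let r : K := ⟨((u / p : ℕ) : ZMod p), (u : ZMod p)⟩
  have key : ∀ i, ((⟨(pref σ p ν T u i).f0, (pref σ p ν T u i).f1⟩ : K) =
        ∑ m ∈ Finset.range i, h' m * r ^ m) ∧
      (⟨(pref σ p ν T u i).p0, (pref σ p ν T u i).p1⟩ : K) = r ^ i :=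
    fun i => pref_cast u i
  have hF : ∀ i, ∑ m ∈ Finset.range (i + L), h' m * r ^ m =
      ∑ m ∈ Finset.range i, h' m * r ^ m +
        r ^ i * ∑ m ∈ Finset.range L, h' (i + m) * r ^ m := by
    intro i
    rw [Finset.sum_range_add, Finset.mul_sum]
    congr 1
    exact Finset.sum_congr rfl fun m _ => by rw [pow_add]; ring
  have hS : ∑ m ∈ Finset.range L, h' (i + m) * r ^ m =
      ∑ m ∈ Finset.range L, h' (j + m) * r ^ m :=
    Finset.sum_congr rfl fun m hm => by simp only [h', h m (Finset.mem_range.1 hm)]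
  have hmatch : (⟨(pref σ p ν T u (i + L)).f0, (pref σ p ν T u (i + L)).f1⟩ : K) *
        ⟨(pref σ p ν T u j).p0, (pref σ p ν T u j).p1⟩ +
        ⟨(pref σ p ν T u j).f0, (pref σ p ν T u j).f1⟩ *
        ⟨(pref σ p ν T u i).p0, (pref σ p ν T u i).p1⟩ =
      (⟨(pref σ p ν T u (j + L)).f0, (pref σ p ν T u (j + L)).f1⟩ : K) *
        ⟨(pref σ p ν T u i).p0, (pref σ p ν T u i).p1⟩ +
        ⟨(pref σ p ν T u i).f0, (pref σ p ν T u i).f1⟩ *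
        ⟨(pref σ p ν T u j).p0, (pref σ p ν T u j).p1⟩ := by
    rw [(key _).1, (key _).1, (key _).1, (key _).1, (key _).2, (key _).2, hF, hF, hS]
    ring
  have h₀ := congrArg QuadraticAlgebra.re hmatch
  have h₁ := congrArg QuadraticAlgebra.im hmatch
  simp only [QuadraticAlgebra.re_add, QuadraticAlgebra.im_add, QuadraticAlgebra.re_mul,
    QuadraticAlgebra.im_mul] at h₀ h₁
  constructor
  · rw [← Nat.ModEq, ← ZMod.natCast_eq_natCast_iff]
    push_cast
    linear_combination h₀
  · rw [← Nat.ModEq, ← ZMod.natCast_eq_natCast_iff]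
    push_cast
    linear_combination h₁

/-- Good seeds make the test exact. The assumption `n < R 2^Λ` makes the initial interval large
enough, and the uncertainty left, less than `R`, is removed by `R` comparisons of letters. -/
theorem hashLcp_eq {σ p ν κ R Λ : ℕ} {u : ℕ → ℕ} (hu : GoodSeeds σ p ν T κ u)
    (hR : T.length < R * 2 ^ Λ) {i j : ℕ} (hi : i ≤ T.length) (hj : j ≤ T.length) :
    hashLcp σ p ν T κ u R Λ i j = lcp (T.drop i) (T.drop j) := by
  have hle := suffixLcp_le T i j
  have hs := shorter_eq T i j
  obtain ⟨h₁, h₂⟩ := descend_spec (T := T) (R := R) (i := i) (j := j)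
    (test := fun l L => SameAll σ p ν T κ u (i + l) (j + l) L)
    (fun l L hl => ⟨fun h => hu _ _ _ (by omega) (by omega) h, fun h t _ => same_of_eq h⟩)
    Λ (Nat.zero_le _) (by omega)
  exact advance_spec R h₁ (by omega)

end Lcp

/-! ### Counting bad seeds -/

section Seeds

open Classical in
/-- The pairs of different substrings which are not distinguished by the seeds `u t`, `t < e`. -/
noncomputable def fooled (σ p ν : ℕ) (T : List ℕ) (u : ℕ → ℕ) (e : ℕ) : Finset (ℕ × ℕ × ℕ) :=
  -- The third component is the length minus one, since empty substrings never differ.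
  (Finset.range T.length ×ˢ Finset.range T.length ×ˢ Finset.range T.length).filter fun τ =>
    τ.1 + (τ.2.2 + 1) ≤ T.length ∧ τ.2.1 + (τ.2.2 + 1) ≤ T.length ∧
      (∃ m < τ.2.2 + 1, T.getD (τ.1 + m) 0 ≠ T.getD (τ.2.1 + m) 0) ∧
      ∀ t < e, Same σ p ν T τ.1 τ.2.1 (τ.2.2 + 1) (u t)

variable {σ p ν : ℕ} {T : List ℕ} {u : ℕ → ℕ}

theorem card_fooled_le (e : ℕ) : (fooled σ p ν T u e).card ≤ T.length ^ 3 := by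
  refine (Finset.card_filter_le _ _).trans ?_
  simp only [Finset.card_product, Finset.card_range]
  exact le_of_eq (by ring)

theorem goodSeeds_of_fooled_eq_empty {κ : ℕ} (h : fooled σ p ν T u κ = ∅) :
    GoodSeeds σ p ν T κ u := by
  intro i j L hi hj hs m hm
  by_contra hne
  obtain ⟨L, rfl⟩ : ∃ L', L = L' + 1 := ⟨L - 1, by omega⟩
  have : (i, j, L) ∈ fooled σ p ν T u κ := by
    simp only [fooled, Finset.mem_filter, Finset.mem_product, Finset.mem_range]
    exact ⟨⟨by omega, by omega, by omega⟩, hi, hj, ⟨m, hm, hne⟩, hs⟩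
  rw [h] at this
  simp at this

/-- A fresh random seed leaves only few pairs undistinguished on average. -/
theorem sum_card_fooled_le (hp : p.Prime) (hν : ¬ IsSquare (ν : ZMod p)) {c : ℕ}
    (hT : OverAlphabet σ T) (hc : T.length ≤ c ^ 3) (hpc : 12 * c ^ 2 < p) (e : ℕ) :
    c * ∑ v ∈ Finset.range (σ * p * p * p), (fooled σ p ν T (Function.update u e v) (e + 1)).card ≤
      (fooled σ p ν T u e).card * (σ * p * p * p) := by
  classical
  have hf : ∀ v, fooled σ p ν T (Function.update u e v) (e + 1) =
      (fooled σ p ν T u e).filter fun τ => Same σ p ν T τ.1 τ.2.1 (τ.2.2 + 1) v := by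
    intro v
    ext τ
    simp only [fooled, Finset.mem_filter, Nat.lt_succ_iff_lt_or_eq, Function.update_apply]
    constructor
    · rintro ⟨h₀, h₁, h₂, h₃, h₄⟩
      refine ⟨⟨h₀, h₁, h₂, h₃, fun t ht => ?_⟩, ?_⟩
      · simpa [ht.ne] using h₄ t (.inl ht)
      · simpa using h₄ e (.inr rfl)
    · rintro ⟨⟨h₀, h₁, h₂, h₃, h₄⟩, h₅⟩
      refine ⟨h₀, h₁, h₂, h₃, fun t ht => ?_⟩
      rcases ht with ht | rfl
      · simpa [ht.ne] using h₄ t ht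
      · simpa using h₅
  simp_rw [hf, Finset.card_filter]
  -- Exchanging the sums counts, for each triple not yet distinguished, the new seeds that fail on
  -- it; `card_same_le` bounds this number.
  rw [Finset.sum_comm, Finset.mul_sum, ← smul_eq_mul (fooled σ p ν T u e).card, ← Finset.sum_const]
  refine Finset.sum_le_sum fun τ hτ => ?_
  rw [← Finset.card_filter]
  simp only [fooled, Finset.mem_filter] at hτ
  obtain ⟨-, h₁, h₂, ⟨m, hm, hne⟩, -⟩ := hτ
  exact card_same_le hp hν hT rfl hc hpc h₁ h₂ hm hne

end Seeds

end SparseSuffix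

namespace SparseSuffix

/-! ## Programs -/

local infixr:30 " ;; " => Cmd.seq
local prefix:max "°" => @Expr.reg 64
local prefix:max "♯" => @Expr.lit 64
local infixl:65 " +ₑ " => Expr.bin Op.add
local infixl:65 " -ₑ " => Expr.bin Op.sub
local infixl:70 " *ₑ " => Expr.bin Op.mul
local infixl:70 " /ₑ " => Expr.bin Op.div
local infixl:70 " %ₑ " => Expr.bin Op.mod
local infix:50 " <ₑ " => Expr.bin Op.lt
local infix:50 " =ₑ " => Expr.bin Op.eq

/-- The parameters of the computation which do not change after the preparations: the word length,
the text, the alphabet size, the field, the distance `g` and number `G` of the sampled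
positions, the length `R` at which comparisons become naive, and the number of seeds. -/
structure Par where
  w : ℕ
  T : List ℕ
  σ : ℕ
  p : ℕ
  ν : ℕ
  g : ℕ
  G : ℕ
  R : ℕ
  Λ : ℕ
  κ : ℕ

/-- The conditions `w₁` to `w₄` exclude wrapping around: `w₁` in the product of multiplier and
letter, `w₂` in sums of products of up to three residues, `w₃` in table addresses, `w₄` in positions
and lengths. -/
structure Par.Ok (P : Par) : Prop where
  alph : OverAlphabet P.σ P.T
  σ_pos : 0 < P.σ
  p_gt : 1 < P.p
  ν_lt : P.ν < P.p
  g_pos : 0 < P.g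
  R_pos : 0 < P.R
  G_eq : P.G = P.T.length / P.g + 1
  w₁ : P.σ * P.p * P.σ < 2 ^ P.w
  w₂ : 8 * (P.p * P.p * P.p) ≤ 2 ^ P.w
  w₃ : P.κ + 4 * (P.κ * P.G) + 4 < 2 ^ P.w
  w₄ : 8 * P.T.length + P.R + P.R * 2 ^ P.Λ + P.κ + 64 < 2 ^ P.w

theorem Par.Ok.getD_le {P : Par} (h : P.Ok) (i : ℕ) : P.T.getD i 0 ≤ P.σ := by
  by_cases hi : i < P.T.length
  · rw [List.getD_eq_getElem _ _ hi]; exact (h.alph _ (List.getElem_mem _)).2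
  · rw [List.getD_eq_default _ _ (by omega)]; omega

/-- The parameters are in their registers. -/
def Par.Regs (P : Par) (ρ : Fin 64 → ℕ) : Prop :=
  ρ 0 = P.T.length ∧ ρ 1 = P.σ ∧ ρ 5 = P.p ∧ ρ 6 = P.ν ∧ ρ 7 = P.σ * P.p ∧ ρ 8 = P.g ∧
    ρ 9 = P.G ∧ ρ 10 = P.R ∧ ρ 11 = P.R * 2 ^ P.Λ

/-- `ρ` and `ρ'` agree on the registers below `m`. -/
def Agree (m : ℕ) (ρ ρ' : Fin 64 → ℕ) : Prop := ∀ r : Fin 64, (r : ℕ) < m → ρ' r = ρ r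

theorem Agree.refl (m : ℕ) (ρ : Fin 64 → ℕ) : Agree m ρ ρ := fun _ _ => rfl

theorem Agree.trans {m : ℕ} {ρ₁ ρ₂ ρ₃ : Fin 64 → ℕ} (h : Agree m ρ₁ ρ₂) (h' : Agree m ρ₂ ρ₃) :
    Agree m ρ₁ ρ₃ := fun r hr => (h' r hr).trans (h r hr)

theorem Agree.mono {m m' : ℕ} {ρ₁ ρ₂ : Fin 64 → ℕ} (h : Agree m ρ₁ ρ₂) (hm : m' ≤ m) :
    Agree m' ρ₁ ρ₂ := fun r hr => h r (by omega)

theorem Agree.update {m : ℕ} {ρ₁ ρ₂ : Fin 64 → ℕ} (h : Agree m ρ₁ ρ₂) {r : Fin 64}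
    (hr : m ≤ r) (v : ℕ) : Agree m ρ₁ (Function.update ρ₂ r v) := fun r' hr' => by
  rw [Function.update_of_ne (by rintro rfl; omega), h r' hr']

/-- Registers are layered: the parameters lie below `12`, and from the tree through the tournament
and the search to the fingerprints, inner routines write only to registers with higher numbers.
Hence `Agree m` is the frame condition of each routine. -/
theorem Par.Regs.agree {P : Par} {ρ ρ' : Fin 64 → ℕ} (h : P.Regs ρ) (h' : Agree 12 ρ ρ') :
    P.Regs ρ' := by
  unfold Par.Regs at h ⊢
  simpa only [h' 0 (by decide), h' 1 (by decide), h' 5 (by decide), h' 6 (by decide),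
    h' 7 (by decide), h' 8 (by decide), h' 9 (by decide), h' 10 (by decide),
    h' 11 (by decide)] using h

/-! ### Computing and comparing fingerprints on the machine. -/

/-- The registers from `r` on contain `z`. -/
def HoldsPt (ρ : Fin 64 → ℕ) (z : Pt) : Prop :=
  ρ 53 = z.f0 ∧ ρ 54 = z.f1 ∧ ρ 55 = z.p0 ∧ ρ 56 = z.p1

/-- The decoded seed `u` is in its registers. -/
def HoldsSeed (p u : ℕ) (ρ : Fin 64 → ℕ) : Prop :=
  ρ 57 = u / (p * p) ∧ ρ 58 = u / p % p ∧ ρ 59 = u % p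

/-- Extend the fingerprint of a prefix by one character. -/
def stepCmd : Cmd 64 :=
  .text 60 (°52) ;; .set 60 (°57 *ₑ °60 %ₑ °7 /ₑ °1) ;;
  .set 53 ((°53 +ₑ °60 *ₑ °55) %ₑ °5) ;; .set 54 ((°54 +ₑ °60 *ₑ °56) %ₑ °5) ;;
  .set 61 ((°55 *ₑ °58 +ₑ °6 *ₑ (°56 *ₑ °59)) %ₑ °5) ;;
  .set 56 ((°55 *ₑ °59 +ₑ °56 *ₑ °58) %ₑ °5) ;; .set 55 (°61)

variable {P : Par} {x : List ℕ}

set_option linter.unusedSimpArgs false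

theorem bit_eq_zero {p : Prop} [Decidable p] : (if p then 1 else 0) = 0 ↔ ¬ p := by simp

theorem mod_two_pow {a w : ℕ} (h : a < 2 ^ w) : a % 2 ^ w = a := Nat.mod_eq_of_lt h

/-- This specification and the following ones are in continuation form: `Q` is arbitrary, and `hQ`
lists all that later code may know about the final state. The numerical time bounds are generous. -/
theorem wp_stepCmd (hP : P.Ok) {Q : State 64 → Prop} {s : State 64} {u y : ℕ}
    (hR : P.Regs s.reg) (hu : u < P.σ * P.p * P.p * P.p) (hs : HoldsSeed P.p u s.reg)
    (hz : HoldsPt s.reg (pref P.σ P.p P.ν P.T u y)) (hy : s.reg 52 = y)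
    (hQ : ∀ ρ t, t ≤ s.time + 60 → Agree 53 s.reg ρ → HoldsSeed P.p u ρ →
      HoldsPt ρ (pref P.σ P.p P.ν P.T u (y + 1)) → Q ⟨ρ, s.mem, s.out, t, s.peak⟩) :
    wp P.w P.T x stepCmd Q s := by
  obtain ⟨ρ, μ, o, t, pk⟩ := s
  obtain ⟨h0, h1, h5, h6, h7, -⟩ := hR
  obtain ⟨hs1, hs2, hs3⟩ := hs
  obtain ⟨hz1, hz2, hz3, hz4⟩ := hz
  dsimp only at *
  obtain ⟨l1, l2, l3, l4⟩ := pref_lt (σ := P.σ) (ν := P.ν) (T := P.T) (u := u) hP.p_gt y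
  have hp := hP.p_gt
  have hpp : 0 < P.p := by omega
  have w₂ := hP.w₂
  have hch := hP.getD_le y
  have ha : u / (P.p * P.p) < P.σ * P.p := by
    rw [Nat.div_lt_iff_lt_mul (by positivity)]; simpa [mul_assoc] using hu
  have hh := charHash_lt (a := u / (P.p * P.p)) (ch := P.T.getD y 0) hP.σ_pos hpp
  have hr0 := Nat.mod_lt (u / P.p) hpp
  have hr1 := Nat.mod_lt u hpp
  have hν := hP.ν_lt
  generalize hzz : pref P.σ P.p P.ν P.T u y = z at *
  have hb1 : u / (P.p * P.p) * P.T.getD y 0 < 2 ^ P.w :=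
    lt_of_le_of_lt (Nat.mul_le_mul ha.le hch) hP.w₁
  have hb0 : P.T.getD y 0 < 2 ^ P.w := by
    refine lt_of_le_of_lt hch (lt_of_le_of_lt ?_ hP.w₁)
    exact Nat.le_mul_of_pos_left _ (by have := hP.σ_pos; positivity)
  -- Every product of two or three residues is at most `p³`; with `w₂` this shows that no operation
  -- below wraps around.
  have m2 : ∀ {a b : ℕ}, a < P.p → b < P.p → a * b ≤ P.p * P.p * P.p := fun ha hb =>
    (Nat.mul_le_mul ha.le hb.le).trans (Nat.le_mul_of_pos_right _ hpp)
  have m3 : ∀ {a b c : ℕ}, a < P.p → b < P.p → c < P.p → a * (b * c) ≤ P.p * P.p * P.p :=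
    fun ha hb hc => by rw [← mul_assoc]; exact Nat.mul_le_mul (Nat.mul_le_mul ha.le hb.le) hc.le
  have hpl : P.p ≤ P.p * P.p * P.p := Nat.le_mul_of_pos_left _ (by positivity)
  have c1 := m2 hh l3
  have c2 := m2 hh l4
  have c3 := m2 l3 hr0
  have c4 := m3 hν l4 hr1
  have c5 := m2 l4 hr1
  have c6 := m2 l3 hr1
  have c7 := m2 l4 hr0
  have hpos : 0 < P.p * P.p * P.p := by positivity
  unfold charHash at *
  simp only [stepCmd, wp, Expr.eval, Op.eval, Expr.cost, Function.update_apply,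
    Fin.reduceEq, if_true, if_false, hy, h1, h5, h6, h7, hs1, hs2, hs3, hz1, hz2, hz3, hz4]
  simp (disch := omega) only [mod_two_pow]
  refine hQ _ _ (by omega) ?_ ?_ ?_
  · repeat' refine Agree.update ?_ (by decide) _
    exact Agree.refl _ _
  · simp [HoldsSeed, hs1, hs2, hs3]
  · simp [HoldsPt, pref, Pt.next, hzz, charHash]

/-- The seeds and the fingerprints of the prefixes at the sampled positions are in the memory. -/
structure Par.Tables (P : Par) (u μ : ℕ → ℕ) : Prop where
  seed : ∀ t < P.κ, μ t = u t
  f0 : ∀ t < P.κ, ∀ q < P.G, μ (P.κ + 4 * (t * P.G + q)) = (pref P.σ P.p P.ν P.T (u t) (q * P.g)).f0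
  f1 : ∀ t < P.κ, ∀ q < P.G,
    μ (P.κ + 4 * (t * P.G + q) + 1) = (pref P.σ P.p P.ν P.T (u t) (q * P.g)).f1
  p0 : ∀ t < P.κ, ∀ q < P.G,
    μ (P.κ + 4 * (t * P.G + q) + 2) = (pref P.σ P.p P.ν P.T (u t) (q * P.g)).p0
  p1 : ∀ t < P.κ, ∀ q < P.G,
    μ (P.κ + 4 * (t * P.G + q) + 3) = (pref P.σ P.p P.ν P.T (u t) (q * P.g)).p1

/-- The fingerprint of the prefix whose length is in register `51`. -/
def prefCmd (κ : ℕ) : Cmd 64 :=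
  .set 52 (°51 /ₑ °8) ;; .set 61 (♯κ +ₑ ♯4 *ₑ (°40 *ₑ °9 +ₑ °52)) ;;
  .load 53 (°61) ;; .load 54 (°61 +ₑ ♯1) ;; .load 55 (°61 +ₑ ♯2) ;; .load 56 (°61 +ₑ ♯3) ;;
  .set 52 (°52 *ₑ °8) ;; .loop (°52 <ₑ °51) (stepCmd ;; .set 52 (°52 +ₑ ♯1))

/-- The nearest sampled prefix has length `⌊X/g⌋ g`, so fewer than `g` steps are missing; this is
the source of the factor `g` in the cost of a test. -/
theorem wp_prefCmd (hP : P.Ok) {Q : State 64 → Prop} {s : State 64} {u : ℕ → ℕ} {t X B : ℕ}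
    (hR : P.Regs s.reg) (hu : u t < P.σ * P.p * P.p * P.p) (ht : t < P.κ)
    (hs : HoldsSeed P.p (u t) s.reg) (hM : P.Tables u s.mem)
    (h40 : s.reg 40 = t) (h51 : s.reg 51 = X) (hX : X ≤ P.T.length)
    (hpk : s.peak ≤ B) (hB : P.κ + 4 * (P.κ * P.G) ≤ B)
    (hQ : ∀ ρ t' pk, t' ≤ s.time + 60 + 80 * P.g → pk ≤ B → Agree 52 s.reg ρ →
      HoldsSeed P.p (u t) ρ → HoldsPt ρ (pref P.σ P.p P.ν P.T (u t) X) →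
      Q ⟨ρ, s.mem, s.out, t', pk⟩) :
    wp P.w P.T x (prefCmd P.κ) Q s := by
  obtain ⟨ρ, μ, o, τ, pk⟩ := s
  dsimp only at *
  have hR' := hR
  obtain ⟨h0, h1, h5, h6, h7, h8, h9, -⟩ := hR
  obtain ⟨hs1, hs2, hs3⟩ := hs
  -- The `+ 1` in the definition of `G` gives even the whole text, `X = n`, a valid index.
  have hq : X / P.g < P.G := by
    rw [hP.G_eq, Nat.lt_succ_iff]; exact Nat.div_le_div_right hX
  have hqg := Nat.div_mul_le_self X P.g
  have hqm := Nat.mod_add_div X P.g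
  rw [Nat.mul_comm] at hqm
  have hmod := Nat.mod_lt X hP.g_pos
  have w₃ := hP.w₃
  have w₄ := hP.w₄
  have htq : t * P.G + X / P.g + 1 ≤ P.κ * P.G := by
    have : (t + 1) * P.G ≤ P.κ * P.G := Nat.mul_le_mul_right _ ht
    rw [Nat.add_mul] at this
    omega
  have e0 := hM.f0 t ht _ hq
  have e1 := hM.f1 t ht _ hq
  have e2 := hM.p0 t ht _ hq
  have e3 := hM.p1 t ht _ hq
  generalize hqq : X / P.g = q at *
  simp only [prefCmd, wp, Expr.eval, Op.eval, Expr.cost, Function.update_apply,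
    Fin.reduceEq, if_true, if_false, h8, h9, h40, h51, hqq]
  simp (disch := omega) only [mod_two_pow, e0, e1, e2, e3]
  generalize hq' : q * P.g = y at *
  refine wp_for (X - y) (fun i s => Agree 52 ρ s.reg ∧ HoldsSeed P.p (u t) s.reg ∧
      HoldsPt s.reg (pref P.σ P.p P.ν P.T (u t) (y + i)) ∧ s.reg 52 = y + i ∧ s.mem = μ ∧
      s.out = o ∧ s.time ≤ τ + 50 + 70 * i ∧ s.peak ≤ B) ?_ ?_ ?_ ?_
  · rintro i ⟨ρ', _, _, _, _⟩ hi ⟨hA, -, -, h52, -⟩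
    dsimp only at *
    simp only [Expr.eval, Op.eval, h52, hA 51 (by decide), h51]
    rw [bit_eq_zero]
    omega
  · rintro i ⟨ρ', μ', o', t', pk'⟩ hi ⟨hA, hS, hZ, h52, rfl, rfl, htm, hpk'⟩
    dsimp only at *
    simp only [wp]
    refine wp_stepCmd hP (y := y + i) (u := u t) (hR'.agree (hA.mono (by omega))) hu hS hZ h52 ?_
    intro ρ₂ t₂ ht₂ hA₂ hS₂ hZ₂
    dsimp only at *
    simp only [Expr.eval, Op.eval, Expr.cost, hA₂ 52 (by decide), h52]
    simp (disch := omega) only [mod_two_pow]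
    have hc : Expr.cost (k := 64) (°52 <ₑ °51) = 3 := rfl
    refine ⟨(hA.trans (hA₂.mono (by omega))).update (by decide) _, ?_, ?_, ?_, by trivial,
      by trivial, by omega, hpk'⟩
    · simpa [HoldsSeed] using hS₂
    · simpa [HoldsPt, add_assoc] using hZ₂
    · simp [add_assoc]
  · rintro ⟨ρ', μ', o', t', pk'⟩ ⟨hA, hS, hZ, h52, rfl, rfl, htm, hpk'⟩
    dsimp only at *
    have hc : Expr.cost (k := 64) (°52 <ₑ °51) = 3 := rfl
    rw [Nat.add_sub_cancel' (by omega)] at hZ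
    exact hQ _ _ _ (by omega) hpk' hA hS hZ
  · dsimp only
    refine ⟨?_, ?_, ?_, ?_, rfl, rfl, by omega, by omega⟩
    · repeat' refine Agree.update ?_ (by decide) _
      exact Agree.refl _ _
    · simp [HoldsSeed, hs1, hs2, hs3]
    · simp [HoldsPt]
    · simp

/-- Compare the fingerprints, for the seed whose number is in register `40`, of the substrings of
length `ρ 34` that follow the first `ρ 32` characters of the suffixes at `ρ 30` and `ρ 31`. -/
def matchBody (κ : ℕ) : Cmd 64 :=
  .load 61 (°40) ;; .set 57 (°61 /ₑ (°5 *ₑ °5)) ;; .set 58 (°61 /ₑ °5 %ₑ °5) ;;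
  .set 59 (°61 %ₑ °5) ;;
  .set 51 (°30 +ₑ °32) ;; prefCmd κ ;;
  .set 41 (°53) ;; .set 42 (°54) ;; .set 43 (°55) ;; .set 44 (°56) ;;
  .set 51 (°31 +ₑ °32) ;; prefCmd κ ;;
  .set 45 (°53) ;; .set 46 (°54) ;; .set 47 (°55) ;; .set 48 (°56) ;;
  .set 51 (°30 +ₑ °32 +ₑ °34) ;; prefCmd κ ;;
  .set 49 (°53) ;; .set 50 (°54) ;;
  .set 51 (°31 +ₑ °32 +ₑ °34) ;; prefCmd κ ;;
  .ite ((°49 *ₑ °47 +ₑ °6 *ₑ (°50 *ₑ °48) +ₑ (°45 *ₑ °43 +ₑ °6 *ₑ (°46 *ₑ °44))) %ₑ °5 =ₑ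
      (°53 *ₑ °43 +ₑ °6 *ₑ (°54 *ₑ °44) +ₑ (°41 *ₑ °47 +ₑ °6 *ₑ (°42 *ₑ °48))) %ₑ °5)
    (.ite ((°49 *ₑ °48 +ₑ °50 *ₑ °47 +ₑ (°45 *ₑ °44 +ₑ °46 *ₑ °43)) %ₑ °5 =ₑ
        (°53 *ₑ °44 +ₑ °54 *ₑ °43 +ₑ (°41 *ₑ °48 +ₑ °42 *ₑ °47)) %ₑ °5)
      .skip (.set 36 (♯0)))
    (.set 36 (♯0)) ;;
  .set 40 (°40 +ₑ ♯1)

set_option maxHeartbeats 1000000 in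
-- Four prefixes are fingerprinted, which gives `320 = 4 · 80` in front of `g`. Register `36` is
-- only ever cleared, so over all seeds it accumulates the conjunction of the tests.
theorem wp_matchBody (hP : P.Ok) {Q : State 64 → Prop} {s : State 64} {u : ℕ → ℕ}
    {t I J l L B : ℕ}
    (hR : P.Regs s.reg) (hu : u t < P.σ * P.p * P.p * P.p) (ht : t < P.κ)
    (hM : P.Tables u s.mem) (h40 : s.reg 40 = t)
    (h30 : s.reg 30 = I) (h31 : s.reg 31 = J) (h32 : s.reg 32 = l) (h34 : s.reg 34 = L)
    (hI : I + l + L ≤ P.T.length) (hJ : J + l + L ≤ P.T.length)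
    (hpk : s.peak ≤ B) (hB : P.κ + 4 * (P.κ * P.G) ≤ B)
    (hQ : ∀ ρ t' pk, t' ≤ s.time + 500 + 320 * P.g → pk ≤ B → Agree 36 s.reg ρ →
      ρ 36 = (if Same P.σ P.p P.ν P.T (I + l) (J + l) L (u t) then s.reg 36 else 0) →
      ρ 40 = t + 1 → Q ⟨ρ, s.mem, s.out, t', pk⟩) :
    wp P.w P.T x (matchBody P.κ) Q s := by
  obtain ⟨ρ, μ, o, τ, pk⟩ := s
  dsimp only at *
  have hR' := hR
  obtain ⟨h0, h1, h5, h6, h7, h8, h9, -⟩ := hR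
  have hp := hP.p_gt
  have hpp : 0 < P.p := by omega
  have w₂ := hP.w₂
  have w₄ := hP.w₄
  have hpl : P.p * P.p ≤ P.p * P.p * P.p := Nat.le_mul_of_pos_right _ hpp
  have hpl' : P.p ≤ P.p * P.p := Nat.le_mul_of_pos_left _ hpp
  have hsu := hM.seed t ht
  have hνp := hP.ν_lt
  simp only [matchBody, wp, Expr.eval, Op.eval, Expr.cost, Function.update_apply, Fin.reduceEq,
    if_true, if_false, h5, h30, h31, h32, h40, hsu]
  simp (disch := omega) only [mod_two_pow]
  have ag : ∀ {ρ₁ ρ₂ : Fin 64 → ℕ}, Agree 40 ρ ρ₁ → Agree 52 ρ₁ ρ₂ → Agree 40 ρ ρ₂ :=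
    fun h h' => h.trans (h'.mono (by omega))
  refine wp_prefCmd hP (X := I + l) (B := B) (hR'.agree ?_) hu ht ?_ hM ?_ ?_ (by omega) ?_ hB ?_
  · repeat' refine Agree.update ?_ (by decide) _
    exact Agree.refl _ _
  · simp [HoldsSeed]
  · simp [h40]
  · simp
  · simp only; omega
  intro ρ₁ t₁ pk₁ ht₁ hpk₁ hA₁ hS₁ hZ₁
  have g₁ : Agree 40 ρ ρ₁ := by
    refine ag ?_ hA₁
    repeat' refine Agree.update ?_ (by decide) _
    exact Agree.refl _ _
  have h40₁ : ρ₁ 40 = t := by simpa [h40] using hA₁ 40 (by decide)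
  obtain ⟨a0, a1, a2, a3⟩ := hZ₁
  simp only [Function.update_apply, Fin.reduceEq, if_true, if_false, a0, a1, a2, a3,
    g₁ 31 (by decide), g₁ 32 (by decide), h31, h32]
  simp (disch := omega) only [mod_two_pow]
  refine wp_prefCmd hP (X := J + l) (B := B) (hR'.agree ?_) hu ht ?_ hM ?_ ?_ (by omega) hpk₁ hB ?_
  · repeat' refine Agree.update ?_ (by decide) _
    exact g₁.mono (by omega)
  · simpa [HoldsSeed] using hS₁
  · simp [h40₁]
  · simp
  intro ρ₂ t₂ pk₂ ht₂ hpk₂ hA₂ hS₂ hZ₂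
  have g₂ : Agree 40 ρ ρ₂ := by
    refine ag ?_ hA₂
    repeat' refine Agree.update ?_ (by decide) _
    exact g₁
  have h40₂ : ρ₂ 40 = t := by simpa [h40₁] using hA₂ 40 (by decide)
  have a0₂ := hA₂ 41 (by decide)
  have a1₂ := hA₂ 42 (by decide)
  have a2₂ := hA₂ 43 (by decide)
  have a3₂ := hA₂ 44 (by decide)
  simp only [Function.update_apply, Fin.reduceEq, if_true, if_false] at a0₂ a1₂ a2₂ a3₂
  obtain ⟨b0, b1, b2, b3⟩ := hZ₂
  simp only [Function.update_apply, Fin.reduceEq, if_true, if_false, b0, b1, b2, b3,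
    g₂ 30 (by decide), g₂ 32 (by decide), g₂ 34 (by decide), h30, h32, h34]
  simp (disch := omega) only [mod_two_pow]
  refine wp_prefCmd hP (X := I + l + L) (B := B) (hR'.agree ?_) hu ht ?_ hM ?_ ?_ hI hpk₂ hB ?_
  · repeat' refine Agree.update ?_ (by decide) _
    exact g₂.mono (by omega)
  · simpa [HoldsSeed] using hS₂
  · simp [h40₂]
  · simp
  intro ρ₃ t₃ pk₃ ht₃ hpk₃ hA₃ hS₃ hZ₃
  have g₃ : Agree 40 ρ ρ₃ := by
    refine ag ?_ hA₃
    repeat' refine Agree.update ?_ (by decide) _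
    exact g₂
  have h40₃ : ρ₃ 40 = t := by simpa [h40₂] using hA₃ 40 (by decide)
  have a0₃ := hA₃ 41 (by decide)
  have a1₃ := hA₃ 42 (by decide)
  have a2₃ := hA₃ 43 (by decide)
  have a3₃ := hA₃ 44 (by decide)
  have b0₃ := hA₃ 45 (by decide)
  have b1₃ := hA₃ 46 (by decide)
  have b2₃ := hA₃ 47 (by decide)
  have b3₃ := hA₃ 48 (by decide)
  simp only [Function.update_apply, Fin.reduceEq, if_true, if_false, a0₂, a1₂, a2₂,
    a3₂] at a0₃ a1₃ a2₃ a3₃ b0₃ b1₃ b2₃ b3₃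
  obtain ⟨c0, c1, -, -⟩ := hZ₃
  simp only [Function.update_apply, Fin.reduceEq, if_true, if_false, c0, c1,
    g₃ 31 (by decide), g₃ 32 (by decide), g₃ 34 (by decide), h31, h32, h34]
  simp (disch := omega) only [mod_two_pow]
  refine wp_prefCmd hP (X := J + l + L) (B := B) (hR'.agree ?_) hu ht ?_ hM ?_ ?_ hJ hpk₃ hB ?_
  · repeat' refine Agree.update ?_ (by decide) _
    exact g₃.mono (by omega)
  · simpa [HoldsSeed] using hS₃
  · simp [h40₃]
  · simp
  intro ρ₄ t₄ pk₄ ht₄ hpk₄ hA₄ hS₄ hZ₄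
  have g₄ : Agree 40 ρ ρ₄ := by
    refine ag ?_ hA₄
    repeat' refine Agree.update ?_ (by decide) _
    exact g₃
  have h40₄ : ρ₄ 40 = t := by simpa [h40₃] using hA₄ 40 (by decide)
  have a0₄ := hA₄ 41 (by decide)
  have a1₄ := hA₄ 42 (by decide)
  have a2₄ := hA₄ 43 (by decide)
  have a3₄ := hA₄ 44 (by decide)
  have b0₄ := hA₄ 45 (by decide)
  have b1₄ := hA₄ 46 (by decide)
  have b2₄ := hA₄ 47 (by decide)
  have b3₄ := hA₄ 48 (by decide)
  have c0₄ := hA₄ 49 (by decide)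
  have c1₄ := hA₄ 50 (by decide)
  simp only [Function.update_apply, Fin.reduceEq, if_true, if_false, a0₃, a1₃, a2₃, a3₃,
    b0₃, b1₃, b2₃, b3₃] at a0₄ a1₄ a2₄ a3₄ b0₄ b1₄ b2₄ b3₄ c0₄ c1₄
  obtain ⟨d0, d1, -, -⟩ := hZ₄
  have h5₄ : ρ₄ 5 = P.p := (g₄ 5 (by decide)).trans h5
  have h6₄ : ρ₄ 6 = P.ν := (g₄ 6 (by decide)).trans h6
  obtain ⟨lA0, lA1, lA2, lA3⟩ := pref_lt (σ := P.σ) (ν := P.ν) (T := P.T) (u := u t) hp (I + l)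
  obtain ⟨lB0, lB1, lB2, lB3⟩ := pref_lt (σ := P.σ) (ν := P.ν) (T := P.T) (u := u t) hp (J + l)
  obtain ⟨lC0, lC1, -, -⟩ := pref_lt (σ := P.σ) (ν := P.ν) (T := P.T) (u := u t) hp (I + l + L)
  obtain ⟨lD0, lD1, -, -⟩ := pref_lt (σ := P.σ) (ν := P.ν) (T := P.T) (u := u t) hp (J + l + L)
  have m2 : ∀ {a b : ℕ}, a < P.p → b < P.p → a * b ≤ P.p * P.p * P.p := fun ha hb =>
    (Nat.mul_le_mul ha.le hb.le).trans (Nat.le_mul_of_pos_right _ hpp)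
  have m3 : ∀ {b c : ℕ}, b < P.p → c < P.p → P.ν * (b * c) ≤ P.p * P.p * P.p :=
    fun hb hc => by
      rw [← mul_assoc]; exact Nat.mul_le_mul (Nat.mul_le_mul hP.ν_lt.le hb.le) hc.le
  have n1 := m2 lC0 lB2
  have n2 := m3 lC1 lB3
  have n2' := m2 lC1 lB3
  have n3 := m2 lB0 lA2
  have n4 := m3 lB1 lA3
  have n4' := m2 lB1 lA3
  have n5 := m2 lD0 lA2
  have n6 := m3 lD1 lA3
  have n6' := m2 lD1 lA3
  have n7 := m2 lA0 lB2
  have n8 := m3 lA1 lB3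
  have n8' := m2 lA1 lB3
  have n9 := m2 lC0 lB3
  have n10 := m2 lC1 lB2
  have n11 := m2 lB0 lA3
  have n12 := m2 lB1 lA2
  have n13 := m2 lD0 lA3
  have n14 := m2 lD1 lA2
  have n15 := m2 lA0 lB3
  have n16 := m2 lA1 lB2
  have hpos : 0 < P.p * P.p * P.p := by positivity
  simp only [Function.update_apply, Fin.reduceEq, if_true, if_false, h5₄, h6₄, h40₄, a0₄, a1₄, a2₄,
    a3₄, b0₄, b1₄, b2₄, b3₄, c0₄, c1₄, d0, d1]
  clear hA₁ hA₂ hA₃ hA₄ hS₁ hS₂ hS₃ hS₄ a0 a1 a2 a3 b0 b1 b2 b3 c0 c1 d0 d1 a0₂ a1₂ a2₂ a3₂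
    a0₃ a1₃ a2₃ a3₃ b0₃ b1₃ b2₃ b3₃ a0₄ a1₄ a2₄ a3₄ b0₄ b1₄ b2₄ b3₄ c0₄ c1₄ lA0 lA1 lA2 lA3
    lB0 lB1 lB2 lB3 lC0 lC1 lD0 lD1
  simp (disch := omega) only [mod_two_pow]
  have h36 : ρ₄ 36 = ρ 36 := g₄ 36 (by decide)
  dsimp only at *
  simp only [bit_eq_zero, ite_not]
  split_ifs with q1 q2
  · refine hQ _ _ _ (by omega) hpk₄ ?_ ?_ ?_
    · repeat' refine Agree.update ?_ (by decide) _
      exact g₄.mono (by omega)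
    · rw [if_pos]
      · simp [h36]
      · exact ⟨q1, q2⟩
    · simp
  · refine hQ _ _ _ (by omega) hpk₄ ?_ ?_ ?_
    · repeat' refine Agree.update ?_ (by decide) _
      exact g₄.mono (by omega)
    · rw [if_neg]
      · simp
      · exact fun h => q2 h.2
    · simp
  · refine hQ _ _ _ (by omega) hpk₄ ?_ ?_ ?_
    · repeat' refine Agree.update ?_ (by decide) _
      exact g₄.mono (by omega)
    · rw [if_neg]
      · simp
      · exact fun h => q1 h.1
    · simp

/-- Compare all fingerprints of two substrings. -/
def matchCmd (κ : ℕ) : Cmd 64 :=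
  .set 36 (♯1) ;; .set 40 (♯0) ;; .loop (°40 <ₑ ♯κ) (matchBody κ)

theorem wp_matchCmd (hP : P.Ok) {Q : State 64 → Prop} {s : State 64} {u : ℕ → ℕ}
    {I J l L B : ℕ}
    (hR : P.Regs s.reg) (hu : ∀ t < P.κ, u t < P.σ * P.p * P.p * P.p)
    (hM : P.Tables u s.mem)
    (h30 : s.reg 30 = I) (h31 : s.reg 31 = J) (h32 : s.reg 32 = l) (h34 : s.reg 34 = L)
    (hI : I + l + L ≤ P.T.length) (hJ : J + l + L ≤ P.T.length)
    (hpk : s.peak ≤ B) (hB : P.κ + 4 * (P.κ * P.G) ≤ B)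
    (hQ : ∀ ρ t' pk, t' ≤ s.time + 20 + P.κ * (510 + 320 * P.g) → pk ≤ B → Agree 36 s.reg ρ →
      ρ 36 = (if SameAll P.σ P.p P.ν P.T P.κ u (I + l) (J + l) L then 1 else 0) →
      Q ⟨ρ, s.mem, s.out, t', pk⟩) :
    wp P.w P.T x (matchCmd P.κ) Q s := by
  obtain ⟨ρ, μ, o, τ, pk⟩ := s
  dsimp only at *
  have w₄ := hP.w₄
  simp only [matchCmd, wp, Expr.eval, Expr.cost]
  simp (disch := omega) only [mod_two_pow]
  have hc : Expr.cost (k := 64) (°40 <ₑ ♯P.κ) = 3 := rfl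
  refine wp_for P.κ (fun i s => Agree 36 ρ s.reg ∧ s.reg 40 = i ∧
      s.reg 36 = (if SameAll P.σ P.p P.ν P.T i u (I + l) (J + l) L then 1 else 0) ∧
      s.mem = μ ∧ s.out = o ∧ s.time ≤ τ + 10 + i * (510 + 320 * P.g) ∧ s.peak ≤ B) ?_ ?_ ?_ ?_
  · rintro i ⟨ρ', _, _, _, _⟩ hi ⟨hA, h40, -⟩
    dsimp only at *
    simp only [Expr.eval, Op.eval, h40]
    rw [bit_eq_zero, mod_two_pow (by omega)]
    omega
  · rintro i ⟨ρ', μ', o', t', pk'⟩ hi ⟨hA, h40, h36, rfl, rfl, htm, hpk'⟩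
    dsimp only at *
    refine wp_matchBody hP (t := i) (u := u) (I := I) (J := J) (l := l) (L := L) (B := B)
      (hR.agree (hA.mono (by omega))) (hu i hi) hi hM h40 ?_ ?_ ?_ ?_ hI hJ hpk' hB ?_
    · exact (hA 30 (by decide)).trans h30
    · exact (hA 31 (by decide)).trans h31
    · exact (hA 32 (by decide)).trans h32
    · exact (hA 34 (by decide)).trans h34
    intro ρ₂ t₂ pk₂ ht₂ hpk₂ hA₂ h36₂ h40₂
    dsimp only at *
    refine ⟨hA.trans hA₂, h40₂, ?_, rfl, rfl, ?_, hpk₂⟩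
    · rw [h36₂, h36]
      simp only [SameAll, Nat.lt_succ_iff_lt_or_eq, or_imp, forall_and, forall_eq]
      split_ifs <;> simp_all
    · rw [Nat.add_mul]
      omega
  · rintro ⟨ρ', μ', o', t', pk'⟩ ⟨hA, h40, h36, rfl, rfl, htm, hpk'⟩
    dsimp only at *
    exact hQ _ _ _ (by omega) hpk' hA h36
  · dsimp only
    refine ⟨?_, by simp, by simp [SameAll], rfl, rfl, by omega, hpk⟩
    repeat' refine Agree.update ?_ (by decide) _
    exact Agree.refl _ _

/-! ### The search for a longest common prefix on the machine. -/

/-- The binary search for the longest common prefix. -/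
def descendCmd (κ : ℕ) : Cmd 64 :=
  .loop (°10 <ₑ °34 +ₑ ♯1)
    (.ite (°33 <ₑ °32 +ₑ °34) .skip
      (matchCmd κ ;; .ite (°36) (.set 32 (°32 +ₑ °34)) .skip) ;;
    .set 34 (°34 /ₑ ♯2))

/-- The naive extension of a common prefix. -/
def advanceCmd : Cmd 64 :=
  .loop (°35 <ₑ °10)
    (.ite (°32 <ₑ °33)
      (.text 37 (°30 +ₑ °32) ;; .text 38 (°31 +ₑ °32) ;;
        .ite (°37 =ₑ °38) (.set 32 (°32 +ₑ ♯1)) .skip)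
      .skip ;;
    .set 35 (°35 +ₑ ♯1))

/-- The search for the longest common prefix of the suffixes at `ρ 30` and `ρ 31`. -/
def lcpCmd (κ : ℕ) : Cmd 64 :=
  .ite (°30 <ₑ °31) (.set 33 (°0 -ₑ °31)) (.set 33 (°0 -ₑ °30)) ;;
  .set 32 (♯0) ;; .set 34 (°11) ;; descendCmd κ ;; .set 35 (♯0) ;; advanceCmd

/-- A bound for the time needed by `lcpCmd`. -/
def Par.lcpTime (P : Par) : ℕ :=
  100 + (P.Λ + 1) * (60 + P.κ * (510 + 320 * P.g)) + P.R * 60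

/-- The result computed by `lcpCmd` with seeds `u`. -/
def Par.lcp (P : Par) (u : ℕ → ℕ) (i j : ℕ) : ℕ :=
  hashLcp P.σ P.p P.ν P.T P.κ u P.R (P.Λ + 1) i j

theorem Par.lcp_le (P : Par) (u : ℕ → ℕ) (i j : ℕ) :
    P.lcp u i j ≤ P.T.length - i ∧ P.lcp u i j ≤ P.T.length - j := by
  have := hashLcp_le P.σ P.p P.ν P.T P.κ u P.R (P.Λ + 1) i j
  rw [shorter_eq] at this
  exact le_min_iff.1 this

theorem wp_descendCmd (hP : P.Ok) {Q : State 64 → Prop} {s : State 64} {u : ℕ → ℕ}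
    {I J B : ℕ}
    (hR : P.Regs s.reg) (hu : ∀ t < P.κ, u t < P.σ * P.p * P.p * P.p)
    (hM : P.Tables u s.mem)
    (h30 : s.reg 30 = I) (h31 : s.reg 31 = J) (h32 : s.reg 32 = 0)
    (h33 : s.reg 33 = shorter P.T I J) (h34 : s.reg 34 = P.R * 2 ^ P.Λ)
    (hI : I < P.T.length) (hJ : J < P.T.length)
    (hpk : s.peak ≤ B) (hB : P.κ + 4 * (P.κ * P.G) ≤ B)
    (hQ : ∀ ρ t' pk, t' ≤ s.time + 10 + (P.Λ + 1) * (60 + P.κ * (510 + 320 * P.g)) → pk ≤ B →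
      Agree 32 s.reg ρ → ρ 33 = shorter P.T I J →
      ρ 32 = descend P.R (shorter P.T I J)
        (fun l L => SameAll P.σ P.p P.ν P.T P.κ u (I + l) (J + l) L) (P.Λ + 1) 0 →
      Q ⟨ρ, s.mem, s.out, t', pk⟩) :
    wp P.w P.T x (descendCmd P.κ) Q s := by
  obtain ⟨ρ, μ, o, τ, pk⟩ := s
  dsimp only at *
  have w₄ := hP.w₄
  have hRp := hP.R_pos
  have hsh := shorter_eq P.T I J
  set m := shorter P.T I J
  set D := descend P.R m (fun l L => SameAll P.σ P.p P.ν P.T P.κ u (I + l) (J + l) L)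
  have hpow : ∀ i ≤ P.Λ, P.R * 2 ^ (P.Λ + 1 - i) / 2 = P.R * 2 ^ (P.Λ - i) ∧
      P.R ≤ P.R * 2 ^ (P.Λ - i) ∧ P.R * 2 ^ (P.Λ - i) ≤ P.R * 2 ^ P.Λ := by
    intro i hi
    refine ⟨?_, Nat.le_mul_of_pos_right _ (by positivity), ?_⟩
    · rw [Nat.succ_sub hi, pow_succ, ← mul_assoc, Nat.mul_div_cancel _ (by norm_num)]
    · exact Nat.mul_le_mul_left _ (Nat.pow_le_pow_right (by norm_num) (by omega))
  have hRL := (hpow 0 (by omega)).2.1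
  rw [Nat.sub_zero] at hRL
  -- The block length is written as `R 2^(Λ+1-i) / 2` so that the formula also covers the exit,
  -- where the register contains `R / 2 < R`. Its value determines the round, so no counter is
  -- needed. The search state is described by what `descend` will still make of it.
  refine wp_for (P.Λ + 1) (fun i s => Agree 32 ρ s.reg ∧ s.reg 33 = m ∧
      s.reg 34 = P.R * 2 ^ (P.Λ + 1 - i) / 2 ∧ s.reg 32 ≤ m ∧
      D (P.Λ + 1 - i) (s.reg 32) = D (P.Λ + 1) 0 ∧
      s.mem = μ ∧ s.out = o ∧ s.time ≤ τ + i * (60 + P.κ * (510 + 320 * P.g)) ∧ s.peak ≤ B)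
    ?_ ?_ ?_ ?_
  · rintro i ⟨ρ', _, _, _, _⟩ hi ⟨hA, h33, h34, -⟩
    dsimp only at *
    have h10 := (hR.agree (hA.mono (by omega))).2.2.2.2.2.2.2.1
    simp only [Expr.eval, Op.eval, h34, h10]
    rw [bit_eq_zero]
    rcases Nat.lt_succ_iff_lt_or_eq.1 (Nat.lt_succ_of_le hi) with hi | rfl
    · obtain ⟨q₁, q₂, q₃⟩ := hpow i (by omega)
      rw [q₁]
      simp (disch := omega) only [mod_two_pow]
      omega
    · simp only [Nat.sub_self, pow_zero, mul_one]
      simp (disch := omega) only [mod_two_pow]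
      exact iff_of_true (by omega) trivial
  · rintro i ⟨ρ', μ', o', t', pk'⟩ hi ⟨hA, h33, h34, hlm, hD, rfl, rfl, htm, hpk'⟩
    dsimp only at *
    obtain ⟨q₁, q₂, q₃⟩ := hpow i (by omega)
    rw [q₁] at h34
    have hc : Expr.cost (k := 64) (°10 <ₑ °34 +ₑ ♯1) = 5 := rfl
    have e₁ : P.Λ + 1 - i = (P.Λ - i) + 1 := by omega
    have e₂ : P.Λ + 1 - (i + 1) = P.Λ - i := by omega
    have e₃ : P.R * 2 ^ (P.Λ - i) / 2 = P.R * 2 ^ (P.Λ + 1 - (i + 1)) / 2 := by rw [e₂]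
    rw [e₁] at hD
    replace hD : D (P.Λ - i) (if ρ' 32 + P.R * 2 ^ (P.Λ - i) ≤ m ∧ SameAll P.σ P.p P.ν P.T P.κ u
        (I + ρ' 32) (J + ρ' 32) (P.R * 2 ^ (P.Λ - i)) then ρ' 32 + P.R * 2 ^ (P.Λ - i)
        else ρ' 32) = D (P.Λ + 1) 0 := hD
    generalize hL : P.R * 2 ^ (P.Λ - i) = L at *
    generalize hl : ρ' 32 = l at *
    simp only [wp, Expr.eval, Op.eval, Expr.cost, h33, h34, hl]
    simp (disch := omega) only [mod_two_pow]
    simp only [bit_eq_zero, ite_not]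
    split_ifs with hlt
    · refine ⟨hA.update (by decide) _, by simpa using h33, ?_, ?_, ?_, by trivial, by trivial, ?_,
        hpk'⟩
      · simpa using e₃
      · simpa [hl] using hlm
      · rw [if_neg (fun h => absurd h.1 (by omega))] at hD
        simpa [hl, e₂] using hD
      · rw [Nat.add_mul]; omega
    · refine wp_matchCmd hP (u := u) (I := I) (J := J) (l := l) (L := L) (B := B)
        (hR.agree (hA.mono (by omega))) hu hM ?_ ?_ hl h34 (by omega) (by omega) hpk' hB ?_
      · exact (hA 30 (by decide)).trans h30
      · exact (hA 31 (by decide)).trans h31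
      intro ρ₂ t₂ pk₂ ht₂ hpk₂ hA₂ h36
      have a32 : ρ₂ 32 = l := (hA₂ 32 (by decide)).trans hl
      have a33 : ρ₂ 33 = m := (hA₂ 33 (by decide)).trans h33
      have a34 : ρ₂ 34 = L := (hA₂ 34 (by decide)).trans h34
      dsimp only at *
      simp only [h36, a32, a34, bit_eq_zero, ite_not]
      split_ifs with hs
      · rw [if_pos ⟨by omega, hs⟩] at hD
        simp (disch := omega) only [mod_two_pow, Function.update_apply, Fin.reduceEq, if_true,
          if_false, a34]
        refine ⟨?_, by simpa using a33, ?_, ?_, ?_, by trivial, by trivial, ?_, hpk₂⟩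
        · repeat' refine Agree.update ?_ (by decide) _
          exact hA.trans (hA₂.mono (by omega))
        · simpa using e₃
        · omega
        · simpa [e₂] using hD
        · rw [Nat.add_mul]; omega
      · rw [if_neg (fun h => hs h.2)] at hD
        simp (disch := omega) only [mod_two_pow, Function.update_apply, Fin.reduceEq, if_true,
          if_false, a34]
        refine ⟨?_, by simpa using a33, ?_, ?_, ?_, by trivial, by trivial, ?_, hpk₂⟩
        · repeat' refine Agree.update ?_ (by decide) _
          exact hA.trans (hA₂.mono (by omega))
        · simpa using e₃
        · omega
        · simpa [e₂, a32] using hD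
        · rw [Nat.add_mul]; omega
  · rintro ⟨ρ', μ', o', t', pk'⟩ ⟨hA, h33, h34, hlm, hD, rfl, rfl, htm, hpk'⟩
    dsimp only at *
    have hc : Expr.cost (k := 64) (°10 <ₑ °34 +ₑ ♯1) = 5 := rfl
    rw [Nat.sub_self] at hD
    exact hQ _ _ _ (by omega) hpk' hA h33 hD
  · dsimp only
    refine ⟨Agree.refl _ _, h33, ?_, by omega, by rw [h32]; rfl, rfl, rfl, by omega, hpk⟩
    have := (hpow 0 (by omega)).1
    rw [h34, this, Nat.sub_zero]

theorem wp_advanceCmd (hP : P.Ok) {Q : State 64 → Prop} {s : State 64} {I J l : ℕ}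
    (hR : P.Regs s.reg)
    (h30 : s.reg 30 = I) (h31 : s.reg 31 = J) (h32 : s.reg 32 = l) (h35 : s.reg 35 = 0)
    (h33 : s.reg 33 = shorter P.T I J) (hl : l ≤ shorter P.T I J)
    (hI : I < P.T.length) (hJ : J < P.T.length)
    (hQ : ∀ ρ t', t' ≤ s.time + 10 + P.R * 60 → Agree 32 s.reg ρ →
      ρ 32 = advance P.T I J (shorter P.T I J) P.R l → Q ⟨ρ, s.mem, s.out, t', s.peak⟩) :
    wp P.w P.T x advanceCmd Q s := by
  obtain ⟨ρ, μ, o, τ, pk⟩ := s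
  dsimp only at *
  have w₄ := hP.w₄
  have hsh := shorter_eq P.T I J
  set m := shorter P.T I J
  have hch : ∀ i, P.T.getD i 0 % 2 ^ P.w = P.T.getD i 0 := fun i => by
    refine mod_two_pow (lt_of_le_of_lt (hP.getD_le i) (lt_of_le_of_lt ?_ hP.w₁))
    have := hP.σ_pos
    have := hP.p_gt
    exact Nat.le_mul_of_pos_left _ (by positivity)
  refine wp_for P.R (fun i s => Agree 32 ρ s.reg ∧ s.reg 33 = m ∧ s.reg 35 = i ∧ s.reg 32 ≤ m ∧
      advance P.T I J m (P.R - i) (s.reg 32) = advance P.T I J m P.R l ∧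
      s.mem = μ ∧ s.out = o ∧ s.time ≤ τ + i * 60 ∧ s.peak = pk)
    ?_ ?_ ?_ ?_
  · rintro i ⟨ρ', _, _, _, _⟩ hi ⟨hA, h33, h35, -⟩
    dsimp only at *
    have h10 := (hR.agree (hA.mono (by omega))).2.2.2.2.2.2.2.1
    simp only [Expr.eval, Op.eval, h35, h10]
    rw [bit_eq_zero]
    omega
  · rintro i ⟨ρ', μ', o', t', pk'⟩ hi ⟨hA, h33, h35, hlm, hD, rfl, rfl, htm, rfl⟩
    dsimp only at *
    have hc : Expr.cost (k := 64) (°35 <ₑ °10) = 3 := rfl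
    have e₁ : P.R - i = (P.R - (i + 1)) + 1 := by omega
    rw [e₁, advance] at hD
    generalize hl' : ρ' 32 = l' at *
    have a30 := (hA 30 (by decide)).trans h30
    have a31 := (hA 31 (by decide)).trans h31
    simp only [wp, Expr.eval, Op.eval, Expr.cost, Function.update_apply, Fin.reduceEq,
      if_true, if_false, h33, h35, hl', a30, a31]
    simp (disch := omega) only [mod_two_pow, hch, bit_eq_zero, ite_not]
    split_ifs with h₁ h₂
    · rw [if_pos ⟨h₁, h₂⟩] at hD
      refine ⟨?_, by trivial, by simp, by omega, by simpa using hD, by trivial,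
        by trivial, by omega, by trivial⟩
      repeat' refine Agree.update ?_ (by decide) _
      exact hA
    · rw [if_neg (fun h => h₂ h.2)] at hD
      refine ⟨?_, by trivial, by simp, by omega, by simpa [hl'] using hD, by trivial,
        by trivial, by omega, by trivial⟩
      repeat' refine Agree.update ?_ (by decide) _
      exact hA
    · rw [if_neg (fun h => h₁ h.1)] at hD
      refine ⟨?_, by trivial, by simp, by omega, by simpa [hl'] using hD, by trivial,
        by trivial, by omega, by trivial⟩
      repeat' refine Agree.update ?_ (by decide) _
      exact hA
  · rintro ⟨ρ', μ', o', t', pk'⟩ ⟨hA, h33, h34, hlm, hD, rfl, rfl, htm, rfl⟩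
    dsimp only at *
    have hc : Expr.cost (k := 64) (°35 <ₑ °10) = 3 := rfl
    rw [Nat.sub_self] at hD
    exact hQ _ _ (by omega) hA hD
  · dsimp only
    exact ⟨Agree.refl _ _, h33, h35, by omega, by rw [h32]; rfl, rfl, rfl, by omega, rfl⟩

theorem wp_lcpCmd (hP : P.Ok) {Q : State 64 → Prop} {s : State 64} {u : ℕ → ℕ}
    {I J B : ℕ}
    (hR : P.Regs s.reg) (hu : ∀ t < P.κ, u t < P.σ * P.p * P.p * P.p)
    (hM : P.Tables u s.mem)
    (h30 : s.reg 30 = I) (h31 : s.reg 31 = J)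
    (hI : I < P.T.length) (hJ : J < P.T.length)
    (hpk : s.peak ≤ B) (hB : P.κ + 4 * (P.κ * P.G) ≤ B)
    (hQ : ∀ ρ t' pk, t' ≤ s.time + P.lcpTime → pk ≤ B → Agree 32 s.reg ρ →
      ρ 32 = P.lcp u I J → Q ⟨ρ, s.mem, s.out, t', pk⟩) :
    wp P.w P.T x (lcpCmd P.κ) Q s := by
  obtain ⟨ρ, μ, o, τ, pk⟩ := s
  dsimp only at *
  have w₄ := hP.w₄
  have h0 := hR.1
  have h11 := hR.2.2.2.2.2.2.2.2
  have main : ∀ τ' ≤ τ + 40, wp P.w P.T x (descendCmd P.κ)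
      (wp P.w P.T x (.set 35 (♯0) ;; advanceCmd) Q)
      ⟨Function.update (Function.update (Function.update ρ 33 (shorter P.T I J)) 32 0) 34
        (P.R * 2 ^ P.Λ), μ, o, τ', pk⟩ := by
    intro τ' hτ'
    refine wp_descendCmd hP (u := u) (I := I) (J := J) (B := B) (hR.agree ?_) hu hM
      (by simpa using h30) (by simpa using h31) (by simp) (by simp) (by simp) hI hJ hpk hB ?_
    · repeat' refine Agree.update ?_ (by decide) _
      exact Agree.refl _ _
    intro ρ₁ t₁ pk₁ ht₁ hpk₁ hA₁ h33 h32
    have g₁ : Agree 32 ρ ρ₁ := by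
      refine Agree.trans ?_ hA₁
      repeat' refine Agree.update ?_ (by decide) _
      exact Agree.refl _ _
    simp only [wp, Expr.eval, Expr.cost]
    simp (disch := omega) only [mod_two_pow]
    refine wp_advanceCmd hP (I := I) (J := J) (hR.agree ?_) ?_ ?_ rfl (by simp) ?_ ?_ hI hJ ?_
    · repeat' refine Agree.update ?_ (by decide) _
      exact g₁.mono (by omega)
    · simpa [h30] using g₁ 30 (by decide)
    · simpa [h31] using g₁ 31 (by decide)
    · simpa using h33
    · simp only [Function.update_apply, Fin.reduceEq, if_false, h32]
      exact descend_le _ (Nat.zero_le _)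
    intro ρ₂ t₂ ht₂ hA₂ h32₂
    simp only [Function.update_apply, Fin.reduceEq, if_false, h32] at h32₂
    refine hQ _ _ _ ?_ hpk₁ ?_ h32₂
    · unfold Par.lcpTime
      dsimp only at *
      omega
    · exact g₁.trans ((Agree.update (Agree.refl _ _) (by decide) _).trans hA₂)
  simp only [lcpCmd, wp, Expr.eval, Op.eval, Expr.cost, Function.update_apply, Fin.reduceEq,
    if_true, if_false, h30, h31, h0, h11]
  simp (disch := omega) only [mod_two_pow, bit_eq_zero, ite_not]
  unfold shorter at main
  split_ifs at main ⊢ with h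
  · exact main _ (by omega)
  · exact main _ (by omega)

/-! ### Choosing the field and the sampling parameters in linear time. -/

/-- The least `c ≥ 1` with `n ≤ c ^ 3`. -/
def rootCmd : Cmd 64 :=
  .set 4 (♯1) ;; .loop (°4 *ₑ °4 *ₑ °4 <ₑ °0) (.set 4 (°4 +ₑ ♯1))

/-- Minimality gives `(c - 1)³ < n`, and `c ≤ 2(c - 1)` for `c ≥ 2`, whence `c³ ≤ 8n`; through this,
costs of order `c³` become linear in `n`. -/
theorem wp_rootCmd {w n : ℕ} {T : List ℕ} {Q : State 64 → Prop} {s : State 64} (hn : 1 ≤ n)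
    (h0 : s.reg 0 = n) (hw : n ^ 3 < 2 ^ w)
    (hQ : ∀ ρ t c, t ≤ s.time + 20 + 20 * c → Agree 4 s.reg ρ → ρ 4 = c → 1 ≤ c → c ≤ n →
      n ≤ c ^ 3 → c ^ 3 ≤ 8 * n → Q ⟨ρ, s.mem, s.out, t, s.peak⟩) :
    wp w T x rootCmd Q s := by
  obtain ⟨ρ, μ, o, τ, pk⟩ := s
  dsimp only at *
  have hn3 : n ≤ n ^ 3 := Nat.le_self_pow (by norm_num) n
  simp only [rootCmd, wp, Expr.eval, Expr.cost]
  simp (disch := omega) only [mod_two_pow]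
  have hsmall : ∀ c, c ≤ n → c ≤ c * c ∧ c * c ≤ c * c * c ∧ c * c * c < 2 ^ w := by
    intro c hc
    refine ⟨Nat.le_mul_self c, ?_, ?_⟩
    · rcases c.eq_zero_or_pos with rfl | h
      · simp
      · exact Nat.le_mul_of_pos_right _ h
    refine lt_of_le_of_lt ?_ hw
    calc c * c * c = c ^ 3 := by ring
      _ ≤ n ^ 3 := Nat.pow_le_pow_left hc 3
  refine wp_while (fun m s => Agree 4 ρ s.reg ∧ 1 ≤ s.reg 4 ∧ s.reg 4 + m = n ∧
      (s.reg 4 = 1 ∨ (s.reg 4 - 1) ^ 3 < n) ∧ s.mem = μ ∧ s.out = o ∧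
      s.time ≤ τ + 10 + 12 * s.reg 4 ∧ s.peak = pk) (m := n - 1) ?_ ?_ ?_
  · rintro m ⟨ρ', μ', o', t', pk'⟩ ⟨hA, h1, hm, hc, rfl, rfl, ht, rfl⟩ hcond
    dsimp only at *
    have h0' := (hA 0 (by decide)).trans h0
    generalize hc4 : ρ' 4 = c at *
    obtain ⟨q₁, q₂, q₃⟩ := hsmall c (by omega)
    simp only [wp, Expr.eval, Op.eval, Expr.cost, hc4, h0'] at hcond ⊢
    simp (disch := omega) only [mod_two_pow, ne_eq, bit_eq_zero, not_not] at hcond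
    have hw' : c + 1 < 2 ^ w := by omega
    simp (disch := omega) only [mod_two_pow]
    refine ⟨m - 1, by omega, hA.update (by decide) _, by simp, by simp; omega, .inr ?_, by trivial,
      by trivial, by simp; omega, by trivial⟩
    simpa [pow_succ] using hcond
  · rintro m ⟨ρ', μ', o', t', pk'⟩ ⟨hA, h1, hm, hc, rfl, rfl, ht, rfl⟩ hcond
    dsimp only at *
    have h0' := (hA 0 (by decide)).trans h0
    generalize hc4 : ρ' 4 = c at *
    obtain ⟨q₁, q₂, q₃⟩ := hsmall c (by omega)
    simp only [Expr.eval, Op.eval, hc4, h0'] at hcond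
    simp (disch := omega) only [mod_two_pow, bit_eq_zero, not_lt] at hcond
    simp only [Expr.cost]
    refine hQ _ _ c (by omega) hA hc4 h1 (by omega) (by simpa [pow_succ] using hcond) ?_
    rcases hc with rfl | hc
    · omega
    · rcases h1.eq_or_lt with rfl | h1
      · omega
      obtain ⟨d, rfl⟩ : ∃ d, c = d + 1 := ⟨c - 1, by omega⟩
      rw [Nat.add_sub_cancel] at hc
      have : (d + 1) ^ 3 ≤ (2 * d) ^ 3 := Nat.pow_le_pow_left (by omega) 3
      rw [mul_pow] at this
      omega
  · dsimp only
    refine ⟨Agree.update (Agree.refl _ _) (by decide) _, by simp, by simp; omega, by simp, rfl, rfl,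
      by simp only [Function.update_self]; omega, rfl⟩

/-- Trial division: register `13` tells whether `ρ 5` is composite. -/
def trialCmd : Cmd 64 :=
  .set 14 (♯2) ;; .set 13 (♯0) ;;
  .loop (°14 *ₑ °14 <ₑ °5 +ₑ ♯1)
    (.ite (°5 %ₑ °14) .skip (.set 13 (♯1)) ;; .set 14 (°14 +ₑ ♯1))

theorem wp_trialCmd {w q : ℕ} {T : List ℕ} {Q : State 64 → Prop} {s : State 64} (hq : 4 ≤ q)
    (h5 : s.reg 5 = q) (hw : 4 * q < 2 ^ w)
    (hQ : ∀ ρ t, t ≤ s.time + 20 + 30 * Nat.sqrt q → Agree 13 s.reg ρ →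
      ρ 13 = (if q.Prime then 0 else 1) → Q ⟨ρ, s.mem, s.out, t, s.peak⟩) :
    wp w T x trialCmd Q s := by
  obtain ⟨ρ, μ, o, τ, pk⟩ := s
  dsimp only at *
  simp only [trialCmd, wp, Expr.eval, Expr.cost]
  simp (disch := omega) only [mod_two_pow]
  have h2 : 2 ≤ Nat.sqrt q := Nat.le_sqrt.2 (by omega)
  have hsq : ∀ d, d ≤ Nat.sqrt q + 1 → d * d ≤ 4 * q := by
    intro d hd
    have h1 : (Nat.sqrt q + 1) ≤ 2 * Nat.sqrt q := by omega
    calc d * d ≤ (2 * Nat.sqrt q) * (2 * Nat.sqrt q) :=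
          Nat.mul_le_mul (hd.trans h1) (hd.trans h1)
      _ = 4 * (Nat.sqrt q * Nat.sqrt q) := by ring
      _ ≤ _ := Nat.mul_le_mul_left _ (Nat.sqrt_le q)
  have hc : Expr.cost (k := 64) (°14 *ₑ °14 <ₑ °5 +ₑ ♯1) = 7 := rfl
  -- The trial divisors are `2, …, √q`. The loop does not stop at a divisor, so the number of rounds
  -- is fixed.
  refine wp_for (Nat.sqrt q - 1) (fun i s => Agree 13 ρ s.reg ∧ s.reg 14 = i + 2 ∧
      (s.reg 13 = 0 ∧ (∀ d, 2 ≤ d → d < i + 2 → ¬ d ∣ q) ∨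
        s.reg 13 = 1 ∧ ∃ d, 2 ≤ d ∧ d ≤ Nat.sqrt q ∧ d ∣ q) ∧
      s.mem = μ ∧ s.out = o ∧ s.time ≤ τ + 10 + i * 25 ∧ s.peak = pk) ?_ ?_ ?_ ?_
  · rintro i ⟨ρ', _, _, _, _⟩ hi ⟨hA, h14, -⟩
    dsimp only at *
    have h5' := (hA 5 (by decide)).trans h5
    have := hsq (i + 2) (by omega)
    simp only [Expr.eval, Op.eval, h14, h5']
    simp (disch := omega) only [mod_two_pow, bit_eq_zero, Nat.lt_succ_iff, ← Nat.le_sqrt]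
    omega
  · rintro i ⟨ρ', μ', o', t', pk'⟩ hi ⟨hA, h14, hd, rfl, rfl, ht, rfl⟩
    dsimp only at *
    have h5' := (hA 5 (by decide)).trans h5
    have hi' : i + 2 + 1 < 2 ^ w := by
      have := Nat.sqrt_le_self q
      omega
    simp only [wp, Expr.eval, Op.eval, Expr.cost, h14, h5', Function.update_apply, Fin.reduceEq,
      if_true, if_false]
    simp (disch := omega) only [mod_two_pow]
    have hA' : ∀ v, Agree 13 ρ (Function.update ρ' 14 v) := fun v => hA.update (by decide) _
    split_ifs with hdvd
    · refine ⟨Agree.update (Agree.update hA (by decide) _) (by decide) _, by simp, .inr ?_,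
        by trivial, by trivial, by omega, by trivial⟩
      exact ⟨by simp, i + 2, by omega, by omega, Nat.dvd_of_mod_eq_zero hdvd⟩
    · refine ⟨hA' _, by simp, ?_, by trivial, by trivial, by omega, by trivial⟩
      refine hd.imp (fun h => ⟨by simpa using h.1, fun d hd hdi => ?_⟩)
        (fun h => ⟨by simpa using h.1, h.2⟩)
      rcases Nat.lt_succ_iff_lt_or_eq.1 hdi with hdi | rfl
      · exact h.2 d hd (by omega)
      · exact fun hdv => hdvd (Nat.mod_eq_zero_of_dvd hdv)
  · rintro ⟨ρ', μ', o', t', pk'⟩ ⟨hA, h14, hd, rfl, rfl, ht, rfl⟩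
    dsimp only at *
    refine hQ _ _ (by omega) hA ?_
    rcases hd with ⟨h13, hd⟩ | ⟨h13, d, hd2, hds, hdq⟩
    · rw [if_pos, h13]
      rw [Nat.prime_def_le_sqrt]
      exact ⟨by omega, fun m hm hmq => hd m hm (by omega)⟩
    · rw [if_neg, h13]
      rw [Nat.prime_def_le_sqrt]
      exact fun h => h.2 d hd2 hds hdq
  · dsimp only
    refine ⟨?_, by simp, .inl ⟨by simp, fun d hd hd' => by omega⟩, rfl, rfl, by simp, rfl⟩
    repeat' refine Agree.update ?_ (by decide) _
    exact Agree.refl _ _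

/-- The least prime above `12 c ^ 2`. -/
def primeCmd : Cmd 64 :=
  .set 5 (♯12 *ₑ (°4 *ₑ °4) +ₑ ♯1) ;; .set 13 (♯1) ;;
  .loop (°13) (trialCmd ;; .ite (°13) (.set 5 (°5 +ₑ ♯1)) .skip)

/-- By Bertrand's postulate at most `12c²` candidates occur, and each needs at most `5c` trial
divisions, because `q ≤ 24c² ≤ (5c)²`. The total is `O(c³)`. -/
theorem wp_primeCmd {w c : ℕ} {T : List ℕ} {Q : State 64 → Prop} {s : State 64} (hc : 1 ≤ c)
    (h4 : s.reg 4 = c) (hw : 100 * c ^ 2 < 2 ^ w)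
    (hQ : ∀ ρ t p, t ≤ s.time + 3000 * c ^ 3 → Agree 5 s.reg ρ → ρ 5 = p → p.Prime →
      12 * c ^ 2 < p → p ≤ 24 * c ^ 2 → Q ⟨ρ, s.mem, s.out, t, s.peak⟩) :
    wp w T x primeCmd Q s := by
  obtain ⟨ρ, μ, o, τ, pk⟩ := s
  dsimp only at *
  have hcc : c * c = c ^ 2 := (pow_two c).symm
  have h1c : 1 ≤ c ^ 2 := Nat.one_le_pow _ _ hc
  obtain ⟨⟨p, hp, hp1, hp2⟩, -⟩ := exists_prime_nonresidue (s := 12 * c ^ 2) (by omega)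
  simp only [primeCmd, wp, Expr.eval, Op.eval, Expr.cost, h4, hcc]
  simp (disch := omega) only [mod_two_pow]
  set D := 40 + 150 * c with hD
  have hsqrt : ∀ q, q ≤ 24 * c ^ 2 → Nat.sqrt q ≤ 5 * c := by
    intro q hq
    have := Nat.sqrt_le_sqrt (show q ≤ (5 * c) * (5 * c) by nlinarith)
    rwa [Nat.sqrt_eq] at this
  refine wp_while (fun m s => Agree 5 ρ s.reg ∧ 12 * c ^ 2 < s.reg 5 ∧ s.reg 5 ≤ p ∧
      (s.reg 13 = 1 ∧ m = p - s.reg 5 + 1 ∨ s.reg 13 = 0 ∧ (s.reg 5).Prime ∧ m = 0) ∧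
      s.mem = μ ∧ s.out = o ∧ s.time + m * D ≤ τ + 20 + 12 * c ^ 2 * D ∧ s.peak = pk)
      (m := p - (12 * c ^ 2 + 1) + 1) ?_ ?_ ?_
  · rintro m ⟨ρ', μ', o', t', pk'⟩ ⟨hA, h1, h2, hm, rfl, rfl, ht, rfl⟩ hcond
    dsimp only at *
    simp only [Expr.eval] at hcond
    rcases hm with ⟨h13, hm⟩ | ⟨h13, -⟩
    swap
    · exact absurd h13 hcond
    generalize hq : ρ' 5 = q at *
    simp only [wp, Expr.cost]
    refine wp_trialCmd (by omega) hq (by omega) ?_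
    intro ρ₂ t₂ ht₂ hA₂ h13₂
    dsimp only at *
    have h5₂ := (hA₂ 5 (by decide)).trans hq
    have hs := hsqrt q (by omega)
    simp only [Expr.eval, Op.eval, Expr.cost, h13₂, h5₂]
    obtain ⟨m', rfl⟩ : ∃ m', m = m' + 1 := ⟨m - 1, by omega⟩
    rw [Nat.add_mul] at ht
    by_cases hpr : q.Prime
    · simp only [hpr, if_true]
      refine ⟨0, by omega, hA.trans (hA₂.mono (by omega)), by omega, by omega,
        .inr ⟨by simp [h13₂, hpr], by simp [h5₂, hpr], rfl⟩, by trivial, by trivial,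
        by omega, by trivial⟩
    · simp only [hpr, if_false, one_ne_zero]
      simp (disch := omega) only [mod_two_pow]
      have hne : q ≠ p := by rintro rfl; exact hpr hp
      refine ⟨m', by omega, Agree.update (hA.trans (hA₂.mono (by omega))) (by decide) _,
        by simp; omega, by simp; omega, .inl ⟨by simp [h13₂, hpr], by simp; omega⟩, by trivial,
        by trivial, by omega, by trivial⟩
  · rintro m ⟨ρ', μ', o', t', pk'⟩ ⟨hA, h1, h2, hm, rfl, rfl, ht, rfl⟩ hcond
    dsimp only at *
    simp only [Expr.eval] at hcond
    rcases hm with ⟨h13, hm⟩ | ⟨h13, hpr, rfl⟩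
    · omega
    · refine hQ _ _ _ ?_ hA rfl hpr h1 (by omega)
      simp only [Expr.cost]
      have e : 12 * c ^ 2 * D = 480 * c ^ 2 + 1800 * c ^ 3 := by rw [hD]; ring
      have : c ^ 2 ≤ c ^ 3 := Nat.pow_le_pow_right hc (by norm_num)
      omega
  · dsimp only
    refine ⟨?_, by simp, by simp; omega, .inl ⟨by simp, by simp⟩, rfl, rfl, ?_, rfl⟩
    · repeat' refine Agree.update ?_ (by decide) _
      exact Agree.refl _ _
    · have : (p - (12 * c ^ 2 + 1) + 1) * D ≤ 12 * c ^ 2 * D := Nat.mul_le_mul_right _ (by omega)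
      omega

/-- The power needed in Euler's criterion. -/
def powCmd : Cmd 64 :=
  .set 14 (°6) ;; .set 15 (°5 /ₑ ♯2) ;; .set 16 (♯1) ;;
  .loop (°15)
    (.ite (°15 %ₑ ♯2) (.set 16 (°16 *ₑ °14 %ₑ °5)) .skip ;;
      .set 14 (°14 *ₑ °14 %ₑ °5) ;; .set 15 (°15 /ₑ ♯2))

/-- Repeated squaring: accumulator times base to the remaining exponent is invariant modulo `p`, and
each round removes one of at most `m` binary digits. -/
theorem wp_powCmd {w p a m : ℕ} {T : List ℕ} {Q : State 64 → Prop} {s : State 64} (hp : 2 < p)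
    (h5 : s.reg 5 = p) (h6 : s.reg 6 = a) (ha : a < p) (hm : p / 2 < 2 ^ m) (hw : p * p < 2 ^ w)
    (hQ : ∀ ρ t, t ≤ s.time + 20 + 30 * m → Agree 14 s.reg ρ → ρ 16 = a ^ (p / 2) % p →
      Q ⟨ρ, s.mem, s.out, t, s.peak⟩) :
    wp w T x powCmd Q s := by
  obtain ⟨ρ, μ, o, τ, pk⟩ := s
  dsimp only at *
  have hpp : p ≤ p * p := Nat.le_mul_self p
  simp only [powCmd, wp, Expr.eval, Op.eval, Expr.cost, Function.update_apply, Fin.reduceEq,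
    if_true, if_false, h5, h6]
  simp (disch := omega) only [mod_two_pow]
  refine wp_while (fun e s => Agree 14 ρ s.reg ∧ s.reg 15 < 2 ^ e ∧ s.reg 14 < p ∧
    s.reg 16 < p ∧ s.reg 16 * s.reg 14 ^ s.reg 15 % p = a ^ (p / 2) % p ∧
    s.mem = μ ∧ s.out = o ∧ s.time + 28 * e ≤ τ + 16 + 28 * m ∧ s.peak = pk) (m := m) ?_ ?_ ?_
  · rintro m₁ ⟨ρ', μ', o', t', pk'⟩ ⟨hA, h15, h14, h16, he, rfl, rfl, ht, rfl⟩ hcond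
    dsimp only at *
    have h5' := (hA 5 (by decide)).trans h5
    simp only [Expr.eval] at hcond
    generalize hE : ρ' 15 = e at *
    generalize hB : ρ' 14 = B at *
    generalize hC : ρ' 16 = C at *
    have hBB : B * B ≤ p * p := Nat.mul_le_mul h14.le h14.le
    have hCB : C * B ≤ p * p := Nat.mul_le_mul h16.le h14.le
    obtain ⟨m', rfl⟩ : ∃ m', m₁ = m' + 1 := by
      rcases m₁ with _ | m₁
      · rw [pow_zero] at h15; omega
      · exact ⟨m₁, rfl⟩
    rw [pow_succ] at h15
    have hee := Nat.div_add_mod e 2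
    have hpow : B ^ e = (B * B) ^ (e / 2) * B ^ (e % 2) := by
      rw [← pow_two, ← pow_mul, ← pow_add, hee]
    rw [hpow] at he
    have hlt : ∀ y, y % p < p := fun y => Nat.mod_lt _ (by omega)
    simp only [wp, Expr.eval, Op.eval, Expr.cost, Function.update_apply, Fin.reduceEq,
      if_true, if_false, hE, hB, hC, h5']
    simp (disch := omega) only [mod_two_pow]
    split_ifs with hpar
    · refine ⟨m', by omega, ?_, by omega, hlt _, h16, ?_, by trivial, by trivial, by omega,
        by trivial⟩
      · repeat' refine Agree.update ?_ (by decide) _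
        exact hA
      · rw [hpar, pow_zero, mul_one] at he
        rw [← he, Nat.mul_mod, Nat.pow_mod, Nat.mod_mod, ← Nat.pow_mod, ← Nat.mul_mod]
    · refine ⟨m', by omega, ?_, by omega, hlt _, hlt _, ?_, by trivial, by trivial, by omega,
        by trivial⟩
      · repeat' refine Agree.update ?_ (by decide) _
        exact hA
      · have hpar : e % 2 = 1 := by omega
        rw [hpar, pow_one] at he
        rw [← he, Nat.mul_mod, Nat.mod_mod, Nat.pow_mod, Nat.mod_mod, ← Nat.pow_mod,
          ← Nat.mul_mod]
        congr 1
        ring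
  · rintro m₁ ⟨ρ', μ', o', t', pk'⟩ ⟨hA, h15, h14, h16, he, rfl, rfl, ht, rfl⟩ hcond
    dsimp only at *
    simp only [Expr.eval] at hcond
    rw [hcond, pow_zero, mul_one, Nat.mod_eq_of_lt h16] at he
    simp only [Expr.cost]
    exact hQ _ _ (by omega) hA he
  · dsimp only
    refine ⟨?_, by simpa using hm, by simpa using ha, by simp; omega, by simp, rfl, rfl,
      by omega, rfl⟩
    repeat' refine Agree.update ?_ (by decide) _
    exact Agree.refl _ _

/-- The least quadratic nonresidue modulo `ρ 5`. -/
def nonresidueCmd : Cmd 64 :=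
  .set 6 (♯1) ;; .set 13 (♯1) ;;
  .loop (°13) (powCmd ;; .ite (°16 =ₑ °5 -ₑ ♯1) (.set 13 (♯0)) (.set 6 (°6 +ₑ ♯1)))

/-- A crude bound of `c + 6` for the number of binary digits of `p / 2`. It suffices, since `O(c)`
operations for each of `O(c²)` candidates remain within `O(c³)`. -/
theorem sq_lt_two_pow (c : ℕ) : 12 * c ^ 2 < 2 ^ (c + 6) := by
  have : c < 2 ^ c := Nat.lt_two_pow_self
  have h : c ^ 2 ≤ 4 * 2 ^ c := by
    induction c with
    | zero => norm_num
    | succ c ih =>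
      have h' : c < 2 ^ c := Nat.lt_two_pow_self
      have ih := ih h'
      rcases Nat.lt_or_ge c 3 with hc | hc
      · interval_cases c <;> norm_num
      · rw [pow_succ 2 c]
        nlinarith
  rw [pow_add]
  omega

/-- No bound on the least nonresidue is needed: even trying all residues, at most `24c²` of them,
with one modular power each costs only `O(c³)`. -/
theorem wp_nonresidueCmd {w c p : ℕ} {T : List ℕ} {Q : State 64 → Prop} {s : State 64}
    (hc : 1 ≤ c) (hp : p.Prime) (hp1 : 12 * c ^ 2 < p) (hp2 : p ≤ 24 * c ^ 2)
    (h5 : s.reg 5 = p) (hw : p * p < 2 ^ w)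
    (hQ : ∀ ρ t ν, t ≤ s.time + 10000 * c ^ 3 → Agree 6 s.reg ρ → ρ 6 = ν → ν < p →
      ¬ IsSquare (ν : ZMod p) → Q ⟨ρ, s.mem, s.out, t, s.peak⟩) :
    wp w T x nonresidueCmd Q s := by
  obtain ⟨ρ, μ, o, τ, pk⟩ := s
  dsimp only at *
  have h1c : 1 ≤ c ^ 2 := Nat.one_le_pow _ _ hc
  have hpp : p ≤ p * p := Nat.le_mul_self p
  obtain ⟨a, ha1, hap, ha⟩ := (exists_prime_nonresidue (s := 12 * c ^ 2) (by omega)).2 p hp hp1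
  simp only [nonresidueCmd, wp, Expr.eval, Expr.cost]
  simp (disch := omega) only [mod_two_pow]
  set D := 60 + 30 * (c + 6) with hD
  refine wp_while (fun m s => Agree 6 ρ s.reg ∧ 1 ≤ s.reg 6 ∧ s.reg 6 ≤ a ∧
      (s.reg 13 = 1 ∧ m = a - s.reg 6 + 1 ∨ s.reg 13 = 0 ∧ ¬ IsSquare (s.reg 6 : ZMod p) ∧ m = 0) ∧
      s.mem = μ ∧ s.out = o ∧ s.time + m * D ≤ τ + 10 + 24 * c ^ 2 * D ∧ s.peak = pk)
      (m := a) ?_ ?_ ?_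
  · rintro m ⟨ρ', μ', o', t', pk'⟩ ⟨hA, h1, h2, hm, rfl, rfl, ht, rfl⟩ hcond
    dsimp only at *
    simp only [Expr.eval] at hcond
    rcases hm with ⟨h13, hm⟩ | ⟨h13, -⟩
    swap
    · exact absurd h13 hcond
    have h5' := (hA 5 (by decide)).trans h5
    generalize hq : ρ' 6 = q at *
    simp only [wp, Expr.cost]
    refine wp_powCmd (m := c + 6) (by omega) h5' hq (by omega)
      (lt_of_le_of_lt (by omega) (sq_lt_two_pow c)) hw ?_
    intro ρ₂ t₂ ht₂ hA₂ h16₂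
    dsimp only at *
    have a5 := (hA₂ 5 (by decide)).trans h5'
    have a6 := (hA₂ 6 (by decide)).trans hq
    have a13 := (hA₂ 13 (by decide)).trans h13
    simp only [Expr.eval, Op.eval, Expr.cost, h16₂, a5, a6]
    obtain ⟨m', rfl⟩ : ∃ m', m = m' + 1 := ⟨m - 1, by omega⟩
    rw [Nat.add_mul] at ht
    have hcase := not_isSquare_iff hp (by omega) h1 (show q < p by omega)
    simp (disch := omega) only [mod_two_pow, bit_eq_zero]
    by_cases hq' : q ^ (p / 2) % p = p - 1
    swap
    · have hne : q ≠ a := by rintro rfl; exact hq' (hcase.1 ha)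
      simp only [hq', not_false_eq_true, if_true]
      refine ⟨m', by omega, Agree.update (hA.trans (hA₂.mono (by omega))) (by decide) _,
        by simp, by simp; omega, .inl ⟨by simpa using a13, by simp; omega⟩, by trivial,
        by trivial, by omega, by trivial⟩
    · simp only [hq', not_true, if_false]
      refine ⟨0, by omega, Agree.update (hA.trans (hA₂.mono (by omega))) (by decide) _,
        by simpa [a6] using h1, by simpa [a6] using h2, .inr ⟨by simp, by simpa [a6] using hcase.2 hq', rfl⟩,
        by trivial, by trivial, by omega, by trivial⟩
  · rintro m ⟨ρ', μ', o', t', pk'⟩ ⟨hA, h1, h2, hm, rfl, rfl, ht, rfl⟩ hcond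
    dsimp only at *
    simp only [Expr.eval] at hcond
    rcases hm with ⟨h13, hm⟩ | ⟨h13, hpr, rfl⟩
    · omega
    · refine hQ _ _ _ ?_ hA rfl (by omega) hpr
      simp only [Expr.cost]
      have e : 24 * c ^ 2 * D = 5760 * c ^ 2 + 720 * c ^ 3 := by rw [hD]; ring
      have : c ^ 2 ≤ c ^ 3 := Nat.pow_le_pow_right hc (by norm_num)
      omega
  · dsimp only
    refine ⟨?_, by simp, by simp; omega, .inl ⟨by simp, by simp; omega⟩, rfl, rfl, ?_, rfl⟩
    · repeat' refine Agree.update ?_ (by decide) _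
      exact Agree.refl _ _
    · have : a * D ≤ 24 * c ^ 2 * D := Nat.mul_le_mul_right _ (by omega)
      omega

/-- The parameters that depend on the length of the text, the number of positions and `α`. -/
def paramCmd : Cmd 64 :=
  .set 7 (°1 *ₑ °5) ;; .set 8 (°0 /ₑ (°3 *ₑ °2) +ₑ ♯1) ;; .set 9 (°0 /ₑ °8 +ₑ ♯1) ;;
  .set 10 (°0 /ₑ °2 +ₑ ♯1) ;; .set 11 (°10) ;; .loop (°11 <ₑ °0 +ₑ ♯1) (.set 11 (°11 +ₑ °11))

theorem wp_paramCmd {w n σ b α p : ℕ} {T : List ℕ} {Q : State 64 → Prop} {s : State 64}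
    (hb : 1 ≤ b) (h0 : s.reg 0 = n) (h1 : s.reg 1 = σ) (h2 : s.reg 2 = b) (h3 : s.reg 3 = α)
    (h5 : s.reg 5 = p) (hw₁ : σ * p < 2 ^ w) (hw₂ : α * b < 2 ^ w) (hw₃ : 4 * n + 4 < 2 ^ w)
    (hQ : ∀ ρ t Λ, t ≤ s.time + 60 + 12 * Λ → Agree 7 s.reg ρ → ρ 7 = σ * p →
      ρ 8 = n / (α * b) + 1 → ρ 9 = n / (n / (α * b) + 1) + 1 → ρ 10 = n / b + 1 →
      ρ 11 = (n / b + 1) * 2 ^ Λ → n < (n / b + 1) * 2 ^ Λ → (n / b + 1) * 2 ^ Λ ≤ 2 * n + 1 →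
      Λ ≤ Nat.log 2 b + 1 → Q ⟨ρ, s.mem, s.out, t, s.peak⟩) :
    wp w T x paramCmd Q s := by
  obtain ⟨ρ, μ, o, τ, pk⟩ := s
  dsimp only at *
  have d₁ := Nat.div_le_self n (α * b)
  have d₂ := Nat.div_le_self n (n / (α * b) + 1)
  have d₃ := Nat.div_le_self n b
  have d₄ := Nat.lt_mul_div_succ n (show 0 < b by omega)
  simp only [paramCmd, wp, Expr.eval, Op.eval, Expr.cost, Function.update_apply, Fin.reduceEq,
    if_true, if_false, h0, h1, h2, h3, h5]
  simp (disch := omega) only [mod_two_pow]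
  generalize n / (α * b) = q₁ at *
  generalize n / (q₁ + 1) = q₂ at *
  generalize n / b = q₃ at *
  -- For the least `Λ` with `n < R 2^Λ`, the preceding power gives `R 2^(Λ-1) ≤ n < R b`. This
  -- bounds `Λ` by `log₂ b + 1`, and doubling gives `R 2^Λ ≤ 2n + 1`.
  have hdone : ∀ m, n < (q₃ + 1) * 2 ^ m → ∃ Λ, Λ ≤ m ∧ Λ ≤ Nat.log 2 b + 1 ∧
      n < (q₃ + 1) * 2 ^ Λ ∧ (q₃ + 1) * 2 ^ Λ ≤ 2 * n + 1 ∧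
      ∀ i < Λ, (q₃ + 1) * 2 ^ i ≤ n := by
    intro m hm
    have hex : ∃ Λ, n < (q₃ + 1) * 2 ^ Λ := ⟨m, hm⟩
    classical
    have hmin : ∀ i < Nat.find hex, (q₃ + 1) * 2 ^ i ≤ n := fun i hi =>
      not_lt.1 (Nat.find_min hex hi)
    refine ⟨Nat.find hex, Nat.find_min' hex hm, ?_, Nat.find_spec hex, ?_, hmin⟩
    · rcases hΛ : Nat.find hex with _ | Λ
      · omega
      · have h := hmin Λ (by omega)
        have h' : (q₃ + 1) * 2 ^ Λ < (q₃ + 1) * b := by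
          rw [mul_comm _ b]; exact lt_of_le_of_lt h d₄
        have := Nat.lt_of_mul_lt_mul_left h'
        have := Nat.le_log_of_pow_le (by norm_num) this.le
        omega
    · rcases hΛ : Nat.find hex with _ | Λ
      · rw [pow_zero]; omega
      · have h := hmin Λ (by omega)
        rw [pow_succ, ← mul_assoc]; omega
  obtain ⟨Λ, -, hΛb, hΛ, hΛ2, hΛm⟩ := hdone n (by
    have : n < 2 ^ n := Nat.lt_two_pow_self
    exact this.trans_le (Nat.le_mul_of_pos_left _ (by omega)))
  refine wp_for Λ (fun i s => Agree 7 ρ s.reg ∧ s.reg 7 = σ * p ∧ s.reg 8 = q₁ + 1 ∧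
      s.reg 9 = q₂ + 1 ∧ s.reg 10 = q₃ + 1 ∧ s.reg 11 = (q₃ + 1) * 2 ^ i ∧ s.mem = μ ∧ s.out = o ∧
      s.time ≤ τ + 40 + i * 12 ∧ s.peak = pk) ?_ ?_ ?_ ?_
  · rintro i ⟨ρ', _, _, _, _⟩ hi ⟨hA, -, -, -, -, h11, -⟩
    dsimp only at *
    have h0' := (hA 0 (by decide)).trans h0
    simp only [Expr.eval, Op.eval, h0', h11]
    simp (disch := omega) only [mod_two_pow, bit_eq_zero]
    rcases hi.eq_or_lt with rfl | hi
    · omega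
    · have := hΛm i hi
      omega
  · rintro i ⟨ρ', μ', o', t', pk'⟩ hi ⟨hA, h7, h8, h9, h10, h11, rfl, rfl, ht, rfl⟩
    dsimp only at *
    have := hΛm i hi
    have e : (q₃ + 1) * 2 ^ (i + 1) = (q₃ + 1) * 2 ^ i + (q₃ + 1) * 2 ^ i := by ring
    simp only [wp, Expr.eval, Op.eval, Expr.cost, h11]
    simp (disch := omega) only [mod_two_pow]
    refine ⟨hA.update (by decide) _, by simpa using h7, by simpa using h8, by simpa using h9,
      by simpa using h10, by simpa using e.symm, by trivial, by trivial, by omega, by trivial⟩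
  · rintro ⟨ρ', μ', o', t', pk'⟩ ⟨hA, h7, h8, h9, h10, h11, rfl, rfl, ht, rfl⟩
    dsimp only at *
    simp only [Expr.cost]
    exact hQ _ _ Λ (by omega) hA h7 h8 h9 h10 h11 hΛ hΛ2 hΛb
  · dsimp only
    refine ⟨?_, by simp, by simp, by simp, by simp, by simp, rfl, rfl, by omega, rfl⟩
    repeat' refine Agree.update ?_ (by decide) _
    exact Agree.refl _ _

/-- Conditions on the input. -/
structure Valid (κ w : ℕ) (T x : List ℕ) (σ b α : ℕ) : Prop where
  alph : OverAlphabet σ T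
  n_pos : 0 < T.length
  two_le : 2 ≤ α
  le : α ≤ b
  -- The quantities that occur are polynomials of moderate degree in these parameters; the exponent
  -- `20` leaves ample room.
  w_ge : (T.length + σ + b + κ + 64) ^ 20 ≤ 2 ^ w
  x0 : x.getD 0 0 = T.length
  x1 : x.getD 1 0 = σ
  x2 : x.getD 2 0 = b
  x3 : x.getD 3 0 = α

/-- The result of the preparations. -/
structure Setup (κ w : ℕ) (T : List ℕ) (σ b α : ℕ) (P : Par) (c : ℕ) : Prop where
  ok : P.Ok
  w_eq : P.w = w
  T_eq : P.T = T
  σ_eq : P.σ = σ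
  κ_eq : P.κ = κ
  prime : P.p.Prime
  nonsquare : ¬ IsSquare (P.ν : ZMod P.p)
  c_pos : 1 ≤ c
  cube : T.length ≤ c ^ 3
  lt_p : 12 * c ^ 2 < P.p
  g_eq : P.g = T.length / (α * b) + 1
  R_eq : P.R = T.length / b + 1
  lt : T.length < P.R * 2 ^ P.Λ
  Λ_le : P.Λ ≤ Nat.log 2 b + 1
  w_draw : P.σ * P.p * P.p * P.p < 2 ^ P.w

/-- The preparations without random choices. -/
def prepareCmd : Cmd 64 :=
  .arg 0 (♯0) ;; .arg 1 (♯1) ;; .arg 2 (♯2) ;; .arg 3 (♯3) ;; rootCmd ;; primeCmd ;;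
    nonresidueCmd ;; paramCmd

/-- All word length conditions follow by comparison with powers of one number `Z`; the largest
quantity, `σ p³`, is at most `Z^10`. The searches for the prime and the nonresidue take `13000 c³ ≤
104000 n` operations. -/
theorem wp_prepareCmd {κ w σ b α : ℕ} {T x : List ℕ} (hV : Valid κ w T x σ b α)
    {Q : State 64 → Prop} {s : State 64}
    (hQ : ∀ ρ t P c, t ≤ s.time + 110000 * T.length + 12 * b + 200 → Setup κ w T σ b α P c →
      P.Regs ρ → ρ 2 = b → Q ⟨ρ, s.mem, s.out, t, s.peak⟩) :
    wp w T x prepareCmd Q s := by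
  obtain ⟨ρ, μ, o, τ, pk⟩ := s
  dsimp only at *
  obtain ⟨alph, n_pos, two_le, hαb, w_ge, x0, x1, x2, x3⟩ := hV
  generalize hn : T.length = n at *
  have σ_pos : 0 < σ := by
    rcases T with _ | ⟨t, T⟩
    · rw [List.length_nil] at hn; omega
    · have := alph t (by simp); omega
  set Z := n + σ + b + κ + 64 with hZ
  have hZ1 : 1 ≤ Z := by omega
  have hZp : ∀ k, k ≤ 19 → 64 * Z ^ k ≤ 2 ^ w := by
    intro k hk
    calc 64 * Z ^ k ≤ Z * Z ^ k := Nat.mul_le_mul_right _ (by omega)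
      _ = Z ^ (k + 1) := by ring
      _ ≤ Z ^ 20 := Nat.pow_le_pow_right hZ1 (by omega)
      _ ≤ _ := w_ge
  have hZpos : ∀ k, 1 ≤ Z ^ k := fun k => Nat.one_le_pow _ _ hZ1
  have w1 := hZp 1 (by norm_num)
  rw [pow_one] at w1
  have mul_le : ∀ {a a' i j : ℕ}, a ≤ Z ^ i → a' ≤ Z ^ j → a * a' ≤ Z ^ (i + j) :=
    fun h h' => by rw [pow_add]; exact Nat.mul_le_mul h h'
  have le1 : ∀ {a}, a ≤ Z → a ≤ Z ^ 1 := fun h => by rwa [pow_one]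
  simp only [prepareCmd, wp, Expr.eval, Expr.cost]
  simp (disch := omega) only [mod_two_pow, x0, x1, x2, x3]
  refine wp_rootCmd (n := n) n_pos (by simp) ?_ ?_
  · have := hZp 3 (by norm_num)
    have h := Nat.pow_le_pow_left (show n ≤ Z by omega) 3
    have := hZpos 3
    omega
  intro ρ₁ t₁ c ht₁ hA₁ h4 hc1 hcn hnc hc8
  dsimp only at *
  have hcZ : c ^ 2 ≤ Z ^ 2 := Nat.pow_le_pow_left (by omega) 2
  refine wp_primeCmd hc1 h4 ?_ ?_
  · have := hZp 3 (by norm_num)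
    have h3 : Z ^ 3 = Z * Z ^ 2 := by ring
    have : 64 * Z ^ 2 ≤ Z * Z ^ 2 := Nat.mul_le_mul_right _ (by omega)
    have := hZpos 2
    omega
  intro ρ₂ t₂ p ht₂ hA₂ h5 hp hp1 hp2
  have hpZ : p ≤ Z ^ 3 := by
    have h3 : Z ^ 3 = Z * Z ^ 2 := by ring
    have : 64 * Z ^ 2 ≤ Z * Z ^ 2 := Nat.mul_le_mul_right _ (by omega)
    omega
  have hpp := mul_le hpZ hpZ
  norm_num only at hpp
  refine wp_nonresidueCmd hc1 hp hp1 hp2 h5 ?_ ?_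
  · have := hZp 6 (by norm_num)
    have := hZpos 6
    omega
  intro ρ₃ t₃ ν ht₃ hA₃ h6 hνp hν
  have hσp := mul_le (le1 (show σ ≤ Z by omega)) hpZ
  have hαb' := mul_le (le1 (show α ≤ Z by omega)) (le1 (show b ≤ Z by omega))
  have a5 := (hA₃ 5 (by decide)).trans h5
  have hrest : ∀ r : Fin 64, (r : ℕ) < 4 → ρ₃ r = ρ₁ r := fun r hr =>
    (hA₃ r (by omega)).trans (hA₂ r (by omega))
  have a0 : ρ₃ 0 = n := by simpa using (hrest 0 (by decide)).trans (hA₁ 0 (by decide))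
  have a1 : ρ₃ 1 = σ := by simpa using (hrest 1 (by decide)).trans (hA₁ 1 (by decide))
  have a2 : ρ₃ 2 = b := by simpa using (hrest 2 (by decide)).trans (hA₁ 2 (by decide))
  have a3 : ρ₃ 3 = α := by simpa using (hrest 3 (by decide)).trans (hA₁ 3 (by decide))
  have z2 := hZp 2 (by norm_num)
  have z4 := hZp 4 (by norm_num)
  have p2 := hZpos 2
  have p4 := hZpos 4
  norm_num only at hσp hαb'
  refine wp_paramCmd (by omega) a0 a1 a2 a3 a5 (by omega) (by omega) (by omega) ?_
  intro ρ₄ t₄ Λ ht₄ hA₄ h7 h8 h9 h10 h11 hlt hle hΛ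
  have hlog : Nat.log 2 b < b := Nat.log_lt_of_lt_pow (by omega) Nat.lt_two_pow_self
  dsimp only at *
  refine hQ _ _ ⟨w, T, σ, p, ν, n / (α * b) + 1, n / (n / (α * b) + 1) + 1, n / b + 1, Λ, κ⟩ c
    (by omega) ?_ ?_ ?_
  · refine ⟨⟨alph, σ_pos, hp.one_lt, hνp, Nat.succ_pos _, Nat.succ_pos _, by simp [hn], ?_, ?_, ?_,
      ?_⟩, rfl, rfl, rfl, rfl, hp, hν, hc1, by rwa [hn], hp1, by simp [hn], by simp [hn], ?_, hΛ, ?_⟩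
    · have := mul_le hσp (le1 (show σ ≤ Z by omega))
      norm_num only at this
      have := hZp 5 (by norm_num)
      have := hZpos 5
      dsimp only
      omega
    · have := mul_le hpp hpZ
      norm_num only at this
      have := hZp 9 (by norm_num)
      dsimp only
      omega
    · have d : n / (n / (α * b) + 1) + 1 ≤ Z := by
        have := Nat.div_le_self n (n / (α * b) + 1)
        omega
      have := mul_le (le1 (show κ ≤ Z by omega)) (le1 d)
      have : κ * (n / (n / (α * b) + 1) + 1) ≤ Z ^ 2 := this
      have : 64 * Z ≤ Z * Z := Nat.mul_le_mul_right _ (by omega)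
      have : Z ^ 2 = Z * Z := pow_two _
      dsimp only
      generalize κ * (n / (n / (α * b) + 1) + 1) = v at *
      omega
    · have := Nat.div_le_self n b
      dsimp only
      rw [hn]
      omega
    · rwa [hn]
    · have := mul_le (mul_le hσp hpZ) hpZ
      norm_num only at this
      have := hZp 10 (by norm_num)
      have := hZpos 10
      dsimp only
      omega
  · refine ⟨?_, ?_, ?_, ?_, h7, h8, h9, h10, h11⟩
    · rw [hn]; exact (hA₄ 0 (by decide)).trans a0
    · exact (hA₄ 1 (by decide)).trans a1
    · exact (hA₄ 5 (by decide)).trans a5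
    · exact (hA₄ 6 (by decide)).trans h6
  · exact (hA₄ 2 (by decide)).trans a2

/-! ### Drawing the seeds -/

def drawBody : Cmd 64 :=
  .rand 13 (°7 *ₑ °5 *ₑ °5) ;; .store (°12) (°13) ;; .set 12 (°12 +ₑ ♯1)

def drawLoop (κ : ℕ) : Cmd 64 := .loop (°12 <ₑ ♯κ) drawBody

/-- The step of the expectation argument: if the average of the counts is at most `F / c`, then a
bound with `d` draws to come turns into one with `d + 1` draws to come. -/
theorem average_le {c F d S M : ℕ} (hM : 0 < M) (hc : 0 < c) (h : c * S ≤ F * M) :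
    (S : ENNReal) * (c : ENNReal)⁻¹ ^ d / M ≤ F * (c : ENNReal)⁻¹ ^ (d + 1) := by
  have hc0 : (c : ENNReal) ≠ 0 := by exact_mod_cast hc.ne'
  have hM0 : (M : ENNReal) ≠ 0 := by exact_mod_cast hM.ne'
  have hcc : (c : ENNReal)⁻¹ * c = 1 := ENNReal.inv_mul_cancel hc0 (ENNReal.natCast_ne_top c)
  rw [ENNReal.div_le_iff hM0 (ENNReal.natCast_ne_top M)]
  have h' : (c : ENNReal) * S ≤ F * M := by exact_mod_cast h
  calc (S : ENNReal) * (c : ENNReal)⁻¹ ^ d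
      = ((c : ENNReal)⁻¹ * c) * (S * (c : ENNReal)⁻¹ ^ d) := by rw [hcc, one_mul]
    _ = (c * S) * (c : ENNReal)⁻¹ ^ (d + 1) := by rw [pow_succ]; ring
    _ ≤ (F * M) * (c : ENNReal)⁻¹ ^ (d + 1) := by gcongr
    _ = _ := by ring

/-- With `d` draws to come, the failure probability is at most the present number of undistinguished
triples times `c^(-d)`, by induction on `d`. After the last draw the bound is the number of
surviving triples itself, which dominates the indicator of failure, as in Markov's inequality. -/
theorem Ach.drawLoop {κ w σ b α c : ℕ} {T x : List ℕ} {P : Par} (hS : Setup κ w T σ b α P c)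
    {A B : State 64 → Prop} {rest : List (Cmd 64)} {ρ₀ : Fin 64 → ℕ} {o : List ℕ} {τ : ℕ}
    (h5 : ρ₀ 5 = P.p) (h7 : ρ₀ 7 = P.σ * P.p)
    (hfin : ∀ (s : State 64) (u : ℕ → ℕ), (∀ t < κ, u t < P.σ * P.p * P.p * P.p) →
      (∀ t < κ, s.mem t = u t) → Agree 12 ρ₀ s.reg → s.out = o → s.time ≤ τ + 10 + κ * 30 →
      s.peak ≤ κ → Ach w T x A B (fooled P.σ P.p P.ν P.T u κ).card ⟨rest, s⟩)
    (d : ℕ) {j : ℕ} (hd : j + d = κ) {s : State 64} {u : ℕ → ℕ}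
    (hu : ∀ t < j, u t < P.σ * P.p * P.p * P.p) (hmem : ∀ t < j, s.mem t = u t)
    (hA : Agree 12 ρ₀ s.reg) (h12 : s.reg 12 = j) (ho : s.out = o) (ht : s.time ≤ τ + j * 30)
    (hpk : s.peak ≤ κ) :
    Ach w T x A B ((fooled P.σ P.p P.ν P.T u j).card * (c : ENNReal)⁻¹ ^ d)
      ⟨SparseSuffix.drawLoop κ :: rest, s⟩ := by
  obtain rfl := hS.w_eq
  obtain rfl := hS.T_eq
  have w₄ := hS.ok.w₄
  have hκ : κ + 64 < 2 ^ P.w := by have := hS.κ_eq; omega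
  induction d generalizing j s u with
  | zero =>
    obtain rfl : j = κ := by omega
    rw [pow_zero, mul_one]
    refine Ach.loop_false ?_ (hfin _ u hu hmem hA ho ?_ hpk)
    · simp only [Expr.eval, Op.eval, h12]
      rw [bit_eq_zero, mod_two_pow (by omega)]
      omega
    · simp only [Expr.cost]
      omega
  | succ d ih =>
    -- The `j`-th seed is uniform below `σ p³`, independently of the seeds before it; averaging the
    -- induction hypothesis over it uses `sum_card_fooled_le`.
    set M := P.σ * P.p * P.p * P.p with hM
    have hp := hS.prime.pos
    have hM0 : 0 < M := by
      have := hS.ok.σ_pos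
      positivity
    refine Ach.loop_true ?_ (Ach.seq (Ach.mono_eps (Ach.rand (m := M) hM0 ?_
      (fun v => (fooled P.σ P.p P.ν P.T (Function.update u j v) (j + 1)).card *
        (c : ENNReal)⁻¹ ^ d) ?_) ?_))
    · simp only [Expr.eval, Op.eval, h12]
      rw [ne_eq, bit_eq_zero, mod_two_pow (by omega)]
      omega
    · have hw := hS.w_draw
      have l₁ : P.σ * P.p * P.p ≤ M := Nat.le_mul_of_pos_right _ hp
      simp only [Expr.eval, Op.eval, hA 7 (by decide), hA 5 (by decide), h5, h7]
      rw [mod_two_pow (a := P.σ * P.p * P.p) (by omega), mod_two_pow hw]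
    · intro v hv
      refine Ach.of_wp (Q := fun s' => s'.reg = Function.update (Function.update s.reg 13 v) 12
          (j + 1) ∧ s'.mem = Function.update s.mem j v ∧ s'.out = o ∧ s'.time ≤ τ + (j + 1) * 30 ∧
          s'.peak ≤ κ) ?_ ?_
      · simp only [wp, Expr.eval, Op.eval, Expr.cost, Function.update_apply, Fin.reduceEq, if_true,
          if_false, h12]
        simp (disch := omega) only [mod_two_pow]
        refine ⟨by trivial, by trivial, ho, by omega, by omega⟩
      · rintro s' ⟨hr, hm, ho', ht', hpk'⟩
        refine ih (j := j + 1) (by omega) ?_ ?_ ?_ ?_ ho' ht' hpk'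
        · intro t ht
          rw [Function.update_apply]
          split_ifs with h
          · exact hv
          · exact hu t (by omega)
        · intro t ht
          rw [hm, Function.update_apply, Function.update_apply]
          split_ifs with h
          · rfl
          · exact hmem t (by omega)
        · rw [hr]
          repeat' refine Agree.update ?_ (by decide) _
          exact hA
        · rw [hr, Function.update_self]
    · rw [← Finset.sum_mul, ← Nat.cast_sum]
      exact average_le hM0 hS.c_pos (sum_card_fooled_le hS.prime hS.nonsquare
        (hS.ok.alph) hS.cube hS.lt_p j)

/-! ### The fingerprints of the sampled prefixes -/

def gridBody (κ : ℕ) : Cmd 64 :=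
  .ite (°52 %ₑ °8) .skip
    (.set 61 (♯κ +ₑ ♯4 *ₑ (°40 *ₑ °9 +ₑ °52 /ₑ °8)) ;; .store (°61) (°53) ;;
      .store (°61 +ₑ ♯1) (°54) ;; .store (°61 +ₑ ♯2) (°55) ;; .store (°61 +ₑ ♯3) (°56)) ;;
  stepCmd ;; .set 52 (°52 +ₑ ♯1)

def gridSeed : Cmd 64 :=
  .load 61 (°40) ;; .set 57 (°61 /ₑ (°5 *ₑ °5)) ;; .set 58 (°61 /ₑ °5 %ₑ °5) ;;
  .set 59 (°61 %ₑ °5) ;; .set 53 (♯0) ;; .set 54 (♯0) ;; .set 55 (♯1) ;; .set 56 (♯0) ;;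
  .set 52 (♯0)

/-- Compute the table of fingerprints. -/
def gridCmd (κ : ℕ) : Cmd 64 :=
  .set 40 (♯0) ;; .loop (°40 <ₑ ♯κ)
    (gridSeed ;; .loop (°52 <ₑ °0 +ₑ ♯1) (gridBody κ) ;; .set 40 (°40 +ₑ ♯1))

/-- The seeds are in the memory, and the table is complete up to the entries for prefixes shorter
than `y` with seed number `t`. -/
structure Par.Filled (P : Par) (u : ℕ → ℕ) (t y : ℕ) (μ : ℕ → ℕ) : Prop where
  seed : ∀ t < P.κ, μ t = u t
  entry : ∀ t' q, t' < P.κ → q < P.G → (t' < t ∨ t' = t ∧ q * P.g < y) →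
    μ (P.κ + 4 * (t' * P.G + q)) = (pref P.σ P.p P.ν P.T (u t') (q * P.g)).f0 ∧
    μ (P.κ + 4 * (t' * P.G + q) + 1) = (pref P.σ P.p P.ν P.T (u t') (q * P.g)).f1 ∧
    μ (P.κ + 4 * (t' * P.G + q) + 2) = (pref P.σ P.p P.ν P.T (u t') (q * P.g)).p0 ∧
    μ (P.κ + 4 * (t' * P.G + q) + 3) = (pref P.σ P.p P.ν P.T (u t') (q * P.g)).p1

theorem Par.Filled.tables {u μ : ℕ → ℕ} (h : P.Filled u P.κ 0 μ) : P.Tables u μ :=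
  ⟨h.seed, fun t ht q hq => (h.entry t q ht hq (.inl ht)).1,
    fun t ht q hq => (h.entry t q ht hq (.inl ht)).2.1,
    fun t ht q hq => (h.entry t q ht hq (.inl ht)).2.2.1,
    fun t ht q hq => (h.entry t q ht hq (.inl ht)).2.2.2⟩

theorem Par.Filled.next {u μ : ℕ → ℕ} {t : ℕ} (hP : P.Ok)
    (h : P.Filled u t (P.T.length + 1) μ) : P.Filled u (t + 1) 0 μ := by
  refine ⟨h.seed, fun t' q ht' hq hlt => h.entry t' q ht' hq ?_⟩
  rw [hP.G_eq, Nat.lt_succ_iff, Nat.le_div_iff_mul_le hP.g_pos] at hq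
  omega

theorem Par.Filled.skip {u μ : ℕ → ℕ} {t y : ℕ} (hy : y % P.g ≠ 0)
    (h : P.Filled u t y μ) : P.Filled u t (y + 1) μ := by
  refine ⟨h.seed, fun t' q ht' hq hlt => h.entry t' q ht' hq ?_⟩
  have : q * P.g ≠ y := by
    rintro rfl
    simp at hy
  omega

theorem Par.Filled.store {u μ : ℕ → ℕ} {t q : ℕ} (hP : P.Ok) (hq : q < P.G)
    (h : P.Filled u t (q * P.g) μ) {a : ℕ} (ha : a = P.κ + 4 * (t * P.G + q)) {z : Pt}
    (hz : z = pref P.σ P.p P.ν P.T (u t) (q * P.g)) :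
    P.Filled u t (q * P.g + 1) (Function.update (Function.update (Function.update
      (Function.update μ a z.f0) (a + 1) z.f1) (a + 2) z.p0) (a + 3) z.p1) := by
  refine ⟨fun t' ht' => ?_, fun t' q' ht' hq' hlt => ?_⟩
  · simp only [Function.update_apply]
    rw [if_neg (by omega), if_neg (by omega), if_neg (by omega), if_neg (by omega), h.seed _ ht']
  · simp only [Function.update_apply]
    by_cases he : t' = t ∧ q' = q
    · obtain ⟨rfl, rfl⟩ := he
      subst ha hz
      simp
    · have hne : t' * P.G + q' ≠ t * P.G + q := by
        -- Quotient and remainder by `G` recover the seed number and the sample number from the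
        -- table index, so different entries do not overlap.
        intro heq
        have h₁ := congrArg (· / P.G) heq
        have h₂ := congrArg (· % P.G) heq
        have hG : 0 < P.G := by omega
        simp only [Nat.add_comm _ q, Nat.add_comm _ q', Nat.add_mul_div_right _ _ hG,
          Nat.div_eq_of_lt hq, Nat.div_eq_of_lt hq', Nat.add_mul_mod_self_right,
          Nat.mod_eq_of_lt hq, Nat.mod_eq_of_lt hq'] at h₁ h₂
        omega
      have := h.entry t' q' ht' hq' (by
        rcases hlt with hlt | ⟨rfl, hlt⟩
        · exact .inl hlt
        · refine .inr ⟨rfl, ?_⟩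
          have : q' * P.g ≠ q * P.g := fun hh =>
            he ⟨rfl, Nat.eq_of_mul_eq_mul_right hP.g_pos hh⟩
          omega)
      generalize t' * P.G + q' = c at *
      generalize t * P.G + q = d at *
      repeat rw [if_neg (by omega)]
      exact this

set_option maxHeartbeats 1000000 in
theorem wp_gridBody (hP : P.Ok) {Q : State 64 → Prop} {s : State 64} {u : ℕ → ℕ} {t y B : ℕ}
    (hR : P.Regs s.reg) (hu : u t < P.σ * P.p * P.p * P.p) (ht : t < P.κ)
    (hs : HoldsSeed P.p (u t) s.reg) (hM : P.Filled u t y s.mem)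
    (hz : HoldsPt s.reg (pref P.σ P.p P.ν P.T (u t) y))
    (h40 : s.reg 40 = t) (h52 : s.reg 52 = y) (hy : y ≤ P.T.length)
    (hpk : s.peak ≤ B) (hB : P.κ + 4 * (P.κ * P.G) ≤ B)
    (hQ : ∀ ρ μ t' pk, t' ≤ s.time + 130 → pk ≤ B → Agree 52 s.reg ρ →
      HoldsSeed P.p (u t) ρ → HoldsPt ρ (pref P.σ P.p P.ν P.T (u t) (y + 1)) →
      ρ 52 = y + 1 → P.Filled u t (y + 1) μ → Q ⟨ρ, μ, s.out, t', pk⟩) :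
    wp P.w P.T x (gridBody P.κ) Q s := by
  obtain ⟨ρ, μ, o, τ, pk⟩ := s
  dsimp only at *
  have w₃ := hP.w₃
  have w₄ := hP.w₄
  have hR' := hR
  obtain ⟨h0, h1, h5, h6, h7, h8, h9, -⟩ := hR
  have main : ∀ ρ' μ' τ' pk', Agree 53 ρ ρ' → P.Filled u t (y + 1) μ' → HoldsSeed P.p (u t) ρ' →
      HoldsPt ρ' (pref P.σ P.p P.ν P.T (u t) y) → τ' ≤ τ + 60 → pk' ≤ B →
      wp P.w P.T x (stepCmd ;; .set 52 (°52 +ₑ ♯1)) Q ⟨ρ', μ', o, τ', pk'⟩ := by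
    intro ρ' μ' τ' pk' hA hF hS hZ hτ' hpk'
    simp only [wp]
    refine wp_stepCmd hP (u := u t) (y := y) (hR'.agree (hA.mono (by omega))) hu hS hZ
      ((hA 52 (by decide)).trans h52) ?_
    intro ρ₂ t₂ ht₂ hA₂ hS₂ hZ₂
    dsimp only at *
    have a52 := (hA₂ 52 (by decide)).trans ((hA 52 (by decide)).trans h52)
    simp only [Expr.eval, Op.eval, Expr.cost, a52]
    simp (disch := omega) only [mod_two_pow]
    refine hQ _ _ _ _ (by omega) hpk' ?_ ?_ ?_ (by simp) hF
    · exact ((hA.trans hA₂).mono (by omega)).update (by decide) _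
    · simpa [HoldsSeed] using hS₂
    · simpa [HoldsPt] using hZ₂
  obtain ⟨hs1, hs2, hs3⟩ := id hs
  obtain ⟨hz1, hz2, hz3, hz4⟩ := id hz
  simp only [gridBody]
  rw [wp]
  simp only [wp.eq_10, Expr.eval, Op.eval, Expr.cost, h52, h8]
  split_ifs with hmod
  · have hq : y / P.g < P.G := by
      rw [hP.G_eq, Nat.lt_succ_iff]; exact Nat.div_le_div_right hy
    have hyq : y / P.g * P.g = y := Nat.div_mul_cancel (Nat.dvd_of_mod_eq_zero hmod)
    have htq : t * P.G + y / P.g + 1 ≤ P.κ * P.G := by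
      have : (t + 1) * P.G ≤ P.κ * P.G := Nat.mul_le_mul_right _ ht
      rw [Nat.add_mul] at this
      omega
    simp only [wp.eq_9, wp.eq_2, wp.eq_4, Expr.eval, Op.eval, Expr.cost, Function.update_apply,
      Fin.reduceEq, if_true, if_false, h52, h8, h9, h40, hz1, hz2, hz3, hz4]
    generalize y / P.g = q at *
    simp (disch := omega) only [mod_two_pow]
    refine main _ _ _ _ ?_ ?_ ?_ ?_ (by omega) (by omega)
    · exact (Agree.refl _ _).update (by decide) _
    · subst hyq
      exact hM.store hP hq rfl rfl
    · exact ⟨hs1, hs2, hs3⟩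
    · exact ⟨hz1, hz2, hz3, hz4⟩
  · rw [wp]
    exact main _ _ _ _ (Agree.refl _ _) (hM.skip hmod) hs hz (by dsimp only; omega) hpk

theorem wp_gridCmd (hP : P.Ok) {Q : State 64 → Prop} {s : State 64} {u : ℕ → ℕ} {B : ℕ}
    (hR : P.Regs s.reg) (hu : ∀ t < P.κ, u t < P.σ * P.p * P.p * P.p)
    (hM : ∀ t < P.κ, s.mem t = u t)
    (hpk : s.peak ≤ B) (hB : P.κ + 4 * (P.κ * P.G) ≤ B)
    (hQ : ∀ ρ μ t' pk, t' ≤ s.time + 20 + P.κ * (140 * (P.T.length + 1) + 80) → pk ≤ B →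
      Agree 40 s.reg ρ → P.Tables u μ → Q ⟨ρ, μ, s.out, t', pk⟩) :
    wp P.w P.T x (gridCmd P.κ) Q s := by
  obtain ⟨ρ, μ, o, τ, pk⟩ := s
  dsimp only at *
  have w₂ := hP.w₂
  have w₄ := hP.w₄
  simp only [gridCmd, wp, Expr.eval, Expr.cost]
  simp (disch := omega) only [mod_two_pow]
  have hc : Expr.cost (k := 64) (°40 <ₑ ♯P.κ) = 3 := rfl
  have hc' : Expr.cost (k := 64) (°52 <ₑ °0 +ₑ ♯1) = 5 := rfl
  refine wp_for P.κ (fun i s => Agree 40 ρ s.reg ∧ s.reg 40 = i ∧ P.Filled u i 0 s.mem ∧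
      s.out = o ∧ s.time ≤ τ + 10 + i * (140 * (P.T.length + 1) + 80) ∧ s.peak ≤ B) ?_ ?_ ?_ ?_
  · rintro i ⟨ρ', _, _, _, _⟩ hi ⟨hA, h40, -⟩
    dsimp only at *
    simp only [Expr.eval, Op.eval, h40]
    rw [bit_eq_zero, mod_two_pow (by omega)]
    omega
  · rintro i ⟨ρ', μ', o', t', pk'⟩ hi ⟨hA, h40, hF, rfl, htm, hpk'⟩
    dsimp only at *
    have hR₁ := hR.agree (hA.mono (by omega))
    have h0 := hR₁.1
    have h5 := hR₁.2.2.1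
    have hpp : P.p * P.p < 2 ^ P.w := by
      have : P.p * P.p ≤ P.p * P.p * P.p :=
        Nat.le_mul_of_pos_right _ (by have := hP.p_gt; omega)
      have : 0 < P.p * P.p := by have := hP.p_gt; positivity
      omega
    simp only [gridSeed, wp.eq_9, wp.eq_2, wp.eq_3, Expr.eval, Op.eval, Expr.cost,
      Function.update_apply, Fin.reduceEq, if_true, if_false, h5, h40, hF.seed i hi]
    simp (disch := omega) only [mod_two_pow]
    -- All prefix lengths `0, …, n` are visited, since `n` itself may be sampled. The last step
    -- reads beyond the text, but its result is never stored.
    refine wp_for (P.T.length + 1) (fun y s => Agree 40 ρ s.reg ∧ s.reg 40 = i ∧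
      HoldsSeed P.p (u i) s.reg ∧ HoldsPt s.reg (pref P.σ P.p P.ν P.T (u i) y) ∧
      s.reg 52 = y ∧ P.Filled u i y s.mem ∧ s.out = o' ∧ s.time ≤ t' + 60 + y * 140 ∧
      s.peak ≤ B) ?_ ?_ ?_ ?_
    · rintro y ⟨ρ₁, _, _, _, _⟩ hi ⟨hA, h40, -, -, h52, -⟩
      dsimp only at *
      have h0 := (hR.agree (hA.mono (by omega))).1
      simp only [Expr.eval, Op.eval, h52, h0]
      simp (disch := omega) only [mod_two_pow]
      rw [bit_eq_zero]
      omega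
    · rintro y ⟨ρ₁, μ₁, o₁, t₁, pk₁⟩ hy ⟨hA₁, h40, hS, hZ, h52, hF, rfl, ht₁, hpk₁⟩
      dsimp only at *
      refine wp_gridBody hP (u := u) (t := i) (y := y) (hR.agree (hA₁.mono (by omega))) (hu i hi) hi
        hS hF hZ h40 h52 (by omega) hpk₁ hB ?_
      intro ρ₂ μ₂ t₂ pk₂ ht₂ hpk₂ hA₂ hS₂ hZ₂ h52₂ hF₂
      exact ⟨hA₁.trans (hA₂.mono (by omega)), (hA₂ 40 (by decide)).trans h40, hS₂, hZ₂, h52₂, hF₂,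
        rfl, by dsimp only at *; omega, hpk₂⟩
    · rintro ⟨ρ₁, μ₁, o₁, t₁, pk₁⟩ ⟨hA₁, h40, hS, hZ, h52, hF, rfl, ht₁, hpk₁⟩
      dsimp only at *
      simp only [wp, Expr.eval, Op.eval, Expr.cost, h40]
      simp (disch := omega) only [mod_two_pow]
      refine ⟨hA₁.update (by decide) _, by simp, hF.next hP, by trivial, ?_, hpk₁⟩
      rw [Nat.add_mul]
      omega
    · refine ⟨?_, ?_, ?_, ?_, ?_, hF, rfl, ?_, ?_⟩
      · repeat' refine Agree.update ?_ (by decide) _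
        exact hA
      · simpa using h40
      · simp [HoldsSeed]
      · simp [HoldsPt, pref]
      · simp
      · dsimp only
        omega
      · dsimp only
        have : i < P.κ + 4 * (P.κ * P.G) := by omega
        omega
  · rintro ⟨ρ', μ', o', t', pk'⟩ ⟨hA, h40, hF, rfl, htm, hpk'⟩
    dsimp only at *
    exact hQ _ _ _ _ (by omega) hpk' hA hF.tables
  · refine ⟨(Agree.refl _ _).update (by decide) _, by simp, ⟨hM, ?_⟩, rfl, by dsimp only; omega,
      hpk⟩
    intro t' q _ _ h
    omega

/-! ### Programs that use fingerprints -/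

/-- Prepare everything for queries of longest common prefixes, then run `tail`. -/
def hashedCmd (κ : ℕ) (tail : Cmd 64) : Cmd 64 :=
  (prepareCmd ;; .set 12 (♯0)) ;; (drawLoop κ ;; (gridCmd κ ;; tail))

/-- From `n ≤ c³` one gets `c^(-3(e+3)) ≤ n^(-(e+3))`; three of these factors compensate for the
`n³` triples. -/
theorem pow_bound {n c e : ℕ} (hn : 0 < n) (hc : n ≤ c ^ 3) {F : ℕ} (hF : F ≤ n ^ 3) :
    (F : ENNReal) * (c : ENNReal)⁻¹ ^ (3 * (e + 3)) ≤ ENNReal.ofReal (1 / (n : ℝ) ^ e) := by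
  have hc0 : 0 < c := by
    rcases Nat.eq_zero_or_pos c with rfl | h
    · simp at hc; omega
    · exact h
  have hn' : (0 : ℝ) < n := by exact_mod_cast hn
  have hc' : (0 : ℝ) < c := by exact_mod_cast hc0
  have hnc : (n : ℝ) ≤ (c : ℝ) ^ 3 := by exact_mod_cast hc
  have e₁ : (F : ENNReal) * (c : ENNReal)⁻¹ ^ (3 * (e + 3)) =
      ENNReal.ofReal (F * (c : ℝ)⁻¹ ^ (3 * (e + 3))) := by
    rw [ENNReal.ofReal_mul (by positivity), ENNReal.ofReal_natCast,
      ENNReal.ofReal_pow (by positivity), ENNReal.ofReal_inv_of_pos hc', ENNReal.ofReal_natCast]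
  rw [e₁]
  refine ENNReal.ofReal_le_ofReal ?_
  have hF' : (F : ℝ) ≤ (n : ℝ) ^ 3 := by exact_mod_cast hF
  have hp : (n : ℝ) ^ (e + 3) ≤ (c : ℝ) ^ (3 * (e + 3)) := by
    rw [pow_mul]; exact pow_le_pow_left₀ hn'.le hnc _
  rw [inv_pow, ← div_eq_mul_inv, div_le_div_iff₀ (by positivity) (by positivity), one_mul]
  calc (F : ℝ) * (n : ℝ) ^ e ≤ (n : ℝ) ^ 3 * (n : ℝ) ^ e := by gcongr
    _ = (n : ℝ) ^ (e + 3) := by ring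
    _ ≤ _ := hp

/-- The state in which the preparations end. -/
structure Ready (κ w : ℕ) (T : List ℕ) (σ b α : ℕ) (P : Par) (c : ℕ) (u : ℕ → ℕ)
    (s : State 64) : Prop extends Setup κ w T σ b α P c where
  seeds : ∀ t < κ, u t < P.σ * P.p * P.p * P.p
  tables : P.Tables u s.mem
  regs : P.Regs s.reg
  reg2 : s.reg 2 = b
  out : s.out = []
  time_le : s.time ≤ 110000 * T.length + 12 * b + 300 + κ * (140 * (T.length + 1) + 120)
  peak_le : s.peak ≤ κ + 4 * (κ * P.G)

/-- Separates probability from algorithms: a deterministic `tail` must meet its time and space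
bounds for all seeds, and be correct for good ones only. -/
theorem achieves_hashedCmd {e κ w σ b α : ℕ} {T x : List ℕ} (hκ : κ = 3 * (e + 3))
    (hV : Valid κ w T x σ b α) {Good : List ℕ → Prop} {τ S : ℝ} {tail : Cmd 64}
    (h : ∀ P c u s, Ready κ w T σ b α P c u s → wp w T x tail (fun s' => (s'.time : ℝ) ≤ τ ∧
      ((64 + s'.peak : ℕ) : ℝ) ≤ S ∧ (GoodSeeds P.σ P.p P.ν P.T P.κ u → Good s'.out)) s) :
    Achieves (hashedCmd κ tail) w T x Good τ S (1 / (T.length : ℝ) ^ e) := by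
  refine Ach.seq (A := fun s' => (s'.time : ℝ) ≤ τ ∧ ((64 + s'.peak : ℕ) : ℝ) ≤ S)
    (B := fun s' => ¬ Good s'.out) ?_
  refine Ach.of_wp (Q := fun s' => ∃ P c, Setup κ w T σ b α P c ∧ P.Regs s'.reg ∧ s'.reg 2 = b ∧
    s'.reg 12 = 0 ∧ s'.out = [] ∧ s'.time ≤ 110000 * T.length + 12 * b + 220 ∧ s'.peak = 0) ?_ ?_
  · rw [wp]
    refine wp_prepareCmd hV ?_
    intro ρ t P c ht hS hR h2
    dsimp only at *
    simp only [wp, Expr.eval, Expr.cost]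
    refine ⟨P, c, hS, hR.agree ((Agree.refl _ _).update (by decide) _), by simpa using h2, by simp,
      by trivial, by omega, by trivial⟩
  rintro s₁ ⟨P, c, hS, hR, h2, h12, ho, ht, hpk⟩
  obtain rfl := hS.κ_eq
  obtain rfl := hS.w_eq
  obtain rfl := hS.T_eq
  have hB : ∀ u, ((fooled P.σ P.p P.ν P.T u 0).card : ENNReal) * (c : ENNReal)⁻¹ ^ P.κ ≤
      ENNReal.ofReal (1 / (P.T.length : ℝ) ^ e) := fun u => by
    rw [hκ]; exact pow_bound hV.n_pos hS.cube (card_fooled_le _)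
  refine Ach.seq (Ach.mono_eps (Ach.drawLoop hS (ρ₀ := s₁.reg) (o := []) (j := 0) (u := fun _ => 0)
    (τ := 110000 * P.T.length + 12 * b + 221) hR.2.2.1 hR.2.2.2.2.1 ?_ P.κ (by omega) (by omega)
    (by omega) (Agree.refl _ _) h12 ho (by dsimp only; omega) (by dsimp only; omega)) (hB _))
  intro s₂ u hu hm hA ho₂ ht₂ hpk₂
  refine Ach.seq (Ach.of_wp (Q := fun s' => Ready P.κ P.w P.T σ b α P c u s') ?_ ?_)
  · refine wp_gridCmd hS.ok (u := u) (B := P.κ + 4 * (P.κ * P.G)) (hR.agree hA) hu hm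
      (by dsimp only; omega) le_rfl ?_
    intro ρ μ t' pk ht' hpk' hA' hM
    dsimp only at *
    refine ⟨hS, hu, hM, (hR.agree hA).agree (hA'.mono (by omega)), ?_, ho₂, ?_, hpk'⟩
    · rw [← h2, ← hA 2 (by decide)]
      exact hA' 2 (by decide)
    · simp only [Nat.mul_add] at *
      omega
  · intro s₃ hs₃
    refine Ach.of_wp (h P c u s₃ hs₃) ?_
    rintro s' ⟨h₁, h₂, h₃⟩
    -- Either no triple is left, so the seeds are good and failure is impossible, or the claimed
    -- bound is at least `1` and nothing has to be shown.
    rcases Nat.eq_zero_or_pos (fooled P.σ P.p P.ν P.T u P.κ).card with h0 | h0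
    · rw [h0, Nat.cast_zero]
      exact Ach.halt_good ⟨h₁, h₂⟩ fun hb =>
        hb (h₃ (goodSeeds_of_fooled_eq_empty (Finset.card_eq_zero.1 h0)))
    · exact (Ach.halt ⟨h₁, h₂⟩).mono_eps (by exact_mod_cast h0)

theorem Achieves.mono {k : ℕ} {C : Cmd k} {w : ℕ} {T x : List ℕ} {Good : List ℕ → Prop}
    {τ τ' s s' δ : ℝ} (h : Achieves C w T x Good τ s δ) (hτ : τ ≤ τ') (hs : s ≤ s') :
    Achieves C w T x Good τ' s' δ := by
  obtain ⟨N, h₁, h₂⟩ := h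
  exact ⟨N, fun g hg => ⟨(h₁ g hg).1, (h₁ g hg).2.1.trans hτ, (h₁ g hg).2.2.trans hs⟩, h₂⟩

/-! ### Batched queries -/

/-- Answer all queries. -/
def queriesCmd (κ : ℕ) : Cmd 64 :=
  .set 12 (♯0) ;; .loop (°12 <ₑ °2)
    (.arg 30 (♯4 +ₑ (°12 +ₑ °12)) ;; .arg 31 (♯5 +ₑ (°12 +ₑ °12)) ;; lcpCmd κ ;; .emit (°32) ;;
      .set 12 (°12 +ₑ ♯1))

theorem lcpInput_getD (T : List ℕ) (σ : ℕ) (Q : List (ℕ × ℕ)) (α : ℕ) {i : ℕ}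
    (hi : i < Q.length) :
    (lcpInput T σ Q α).getD (4 + (i + i)) 0 = Q[i].1 ∧
      (lcpInput T σ Q α).getD (5 + (i + i)) 0 = Q[i].2 := by
  have key : ∀ (Q : List (ℕ × ℕ)) (i : ℕ) (hi : i < Q.length),
      (Q.flatMap fun q => [q.1, q.2]).getD (i + i) 0 = Q[i].1 ∧
      (Q.flatMap fun q => [q.1, q.2]).getD (i + i + 1) 0 = Q[i].2 := by
    intro Q
    induction Q with
    | nil => intro i hi; simp at hi
    | cons q Q ih =>
      rintro (_ | i) hi
      · simp
      · have := ih i (by simpa using hi)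
        have e : i + 1 + (i + 1) = i + i + 1 + 1 := by omega
        simpa [e] using this
  have := key Q i hi
  have e₁ : 4 + (i + i) = i + i + 1 + 1 + 1 + 1 := by omega
  have e₂ : 5 + (i + i) = i + i + 1 + 1 + 1 + 1 + 1 := by omega
  simpa [lcpInput, e₁, e₂] using this

theorem wp_queriesCmd {κ w σ α c : ℕ} {T : List ℕ} {Q : List (ℕ × ℕ)} {u : ℕ → ℕ}
    {s : State 64} (hs : Ready κ w T σ Q.length α P c u s)
    (hQ : ∀ q ∈ Q, q.1 < T.length ∧ q.2 < T.length) (hw : 4 * Q.length + 8 < 2 ^ w) :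
    wp w T (lcpInput T σ Q α) (queriesCmd κ) (fun s' =>
      s'.time ≤ s.time + 20 + Q.length * (P.lcpTime + 60) ∧ s'.peak ≤ κ + 4 * (κ * P.G) ∧
      s'.out = Q.map fun q => P.lcp u q.1 q.2) s := by
  obtain ⟨hS, hu, hM, hR, h2, ho, -, hpk⟩ := hs
  obtain rfl := hS.κ_eq
  obtain rfl := hS.w_eq
  obtain rfl := hS.T_eq
  obtain ⟨ρ, μ, o, τ, pk⟩ := s
  dsimp only at *
  have w₄ := hS.ok.w₄
  have hc : Expr.cost (k := 64) (°12 <ₑ °2) = 3 := rfl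
  simp only [queriesCmd, wp, Expr.eval, Expr.cost]
  simp (disch := omega) only [mod_two_pow]
  refine wp_for Q.length (fun i s => Agree 12 ρ s.reg ∧ s.reg 12 = i ∧ s.mem = μ ∧
      s.out = (Q.take i).map (fun q => P.lcp u q.1 q.2) ∧
      s.time ≤ τ + 10 + i * (P.lcpTime + 60) ∧ s.peak ≤ P.κ + 4 * (P.κ * P.G)) ?_ ?_ ?_ ?_
  · rintro i ⟨ρ', _, _, _, _⟩ hi ⟨hA, h12, -⟩
    dsimp only at *
    simp only [Expr.eval, Op.eval, h12, hA 2 (by decide), h2]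
    rw [bit_eq_zero]
    omega
  · rintro i ⟨ρ', μ', o', t', pk'⟩ hi ⟨hA, h12, rfl, hout, htm, hpk'⟩
    dsimp only at *
    obtain ⟨q₁, q₂⟩ := lcpInput_getD P.T σ Q α hi
    obtain ⟨b₁, b₂⟩ := hQ _ (List.getElem_mem hi)
    simp only [wp, Expr.eval, Op.eval, Expr.cost, Function.update_apply, Fin.reduceEq, if_true,
      if_false, h12]
    simp (disch := omega) only [mod_two_pow, q₁, q₂]
    refine wp_lcpCmd hS.ok (u := u) (I := Q[i].1) (J := Q[i].2) (B := P.κ + 4 * (P.κ * P.G))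
      (hR.agree ?_) hu hM ?_ ?_ b₁ b₂ hpk' le_rfl ?_
    · repeat' refine Agree.update ?_ (by decide) _
      exact hA
    · simp
    · simp
    intro ρ₂ t₂ pk₂ ht₂ hpk₂ hA₂ h32
    dsimp only at *
    have a12 : ρ₂ 12 = i := by simpa [h12] using hA₂ 12 (by decide)
    simp only [h32, a12]
    simp (disch := omega) only [mod_two_pow]
    refine ⟨?_, by simp, by trivial, ?_, ?_, hpk₂⟩
    · refine Agree.update ?_ (by decide) _
      refine Agree.trans ?_ (hA₂.mono (by omega))
      repeat' refine Agree.update ?_ (by decide) _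
      exact hA
    · rw [List.take_succ_eq_append_getElem hi, List.map_append, hout]
      rfl
    · rw [Nat.add_mul i 1]
      omega
  · rintro ⟨ρ', μ', o', t', pk'⟩ ⟨hA, h12, rfl, hout, htm, hpk'⟩
    dsimp only at *
    refine ⟨by omega, hpk', ?_⟩
    rw [hout, List.take_length]
  · dsimp only
    exact ⟨(Agree.refl _ _).update (by decide) _, by simp, rfl, by simp [ho], by omega, hpk⟩

theorem Setup.lcp_eq {κ w σ b α c : ℕ} {T : List ℕ} (hS : Setup κ w T σ b α P c) {u : ℕ → ℕ}
    (hu : GoodSeeds P.σ P.p P.ν P.T P.κ u) {i j : ℕ} (hi : i < T.length) (hj : j < T.length) :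
    P.lcp u i j = lcp (T.drop i) (T.drop j) := by
  have hlt := hS.lt
  obtain rfl := hS.T_eq
  refine hashLcp_eq hu (lt_of_lt_of_le hlt ?_) hi.le hj.le
  exact Nat.mul_le_mul_left _ (Nat.pow_le_pow_right (by norm_num) (by omega))

theorem queries_eq_lcpAnswers {κ w σ b α c : ℕ} {T : List ℕ} (hS : Setup κ w T σ b α P c)
    {u : ℕ → ℕ} (hu : GoodSeeds P.σ P.p P.ν P.T P.κ u) {Q : List (ℕ × ℕ)}
    (hQ : ∀ q ∈ Q, q.1 < T.length ∧ q.2 < T.length) :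
    (Q.map fun q => P.lcp u q.1 q.2) = lcpAnswers T Q :=
  List.map_congr_left fun q hq => hS.lcp_eq hu (hQ q hq).1 (hQ q hq).2

/-! ### Bounds -/

/-- With `l = log₂ m + 1` one has `m + κ + 64 ≤ 2^l 2^(κ+65)`, and `20 (l + κ + 65) ≤ 20 (κ + 66) l`
because `l ≥ 1`. -/
theorem pow_le_two_pow {m κ w : ℕ} (h : 20 * (κ + 66) * (Nat.log 2 m + 1) ≤ w) :
    (m + κ + 64) ^ 20 ≤ 2 ^ w := by
  have h₁ : m < 2 ^ (Nat.log 2 m + 1) := Nat.lt_pow_succ_log_self (by norm_num) m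
  have h₂ : κ + 65 < 2 ^ (κ + 65) := Nat.lt_two_pow_self
  set l := Nat.log 2 m + 1
  have hl : 1 ≤ l := Nat.succ_pos _
  have h₃ : m + κ + 64 ≤ 2 ^ l * 2 ^ (κ + 65) := by
    have := Nat.one_le_two_pow (n := l)
    calc m + κ + 64 ≤ 2 ^ l * 1 + 1 * (κ + 64) := by omega
      _ ≤ 2 ^ l * 1 + 2 ^ l * (κ + 64) := by gcongr
      _ = 2 ^ l * (κ + 65) := by ring
      _ ≤ _ := by gcongr
  calc (m + κ + 64) ^ 20 ≤ (2 ^ l * 2 ^ (κ + 65)) ^ 20 := by gcongr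
    _ = 2 ^ ((l + (κ + 65)) * 20) := by rw [← pow_add, ← pow_mul]
    _ ≤ 2 ^ w := by
      refine Nat.pow_le_pow_right (by norm_num) (le_trans ?_ h)
      nlinarith

/-- `n log b / log α + α b log b / log α`. -/
noncomputable def queryCost (n b α : ℕ) : ℝ :=
  (n : ℝ) * Real.log b / Real.log α + (α : ℝ) * b * Real.log b / Real.log α

theorem half_le_log {m : ℕ} (h : 2 ≤ m) : 1 / 2 ≤ Real.log m := by
  have h2 : (2 : ℝ) ≤ m := by exact_mod_cast h
  have := Real.log_le_log (by norm_num) h2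
  have := Real.log_two_gt_d9
  linarith

theorem natLog_le_log {b : ℕ} (hb : 1 ≤ b) : (Nat.log 2 b : ℝ) ≤ 2 * Real.log b := by
  have h : ((2 ^ Nat.log 2 b : ℕ) : ℝ) ≤ b := by exact_mod_cast Nat.pow_log_le_self 2 (by omega)
  have h' := Real.log_le_log (by positivity) h
  rw [Nat.cast_pow, Real.log_pow, Nat.cast_ofNat] at h'
  have := Real.log_two_gt_d9
  have h0 : (0 : ℝ) ≤ Nat.log 2 b := by positivity
  nlinarith

/-- As `log b / log α ≥ 1`, the cost function absorbs all terms linear in `n` and `b`. -/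
theorem cast_add_cast_le_queryCost {n b α : ℕ} (hα : 2 ≤ α) (hαb : α ≤ b) :
    (n : ℝ) + b ≤ queryCost n b α := by
  have la := half_le_log hα
  have hlog : Real.log α ≤ Real.log b :=
    Real.log_le_log (by positivity) (by exact_mod_cast hαb)
  have hα' : (2 : ℝ) ≤ α := by exact_mod_cast hα
  unfold queryCost
  rw [← add_div, le_div_iff₀ (by linarith)]
  have h1 : (n : ℝ) * Real.log α ≤ n * Real.log b := by gcongr
  have h2 : (b : ℝ) * Real.log α ≤ α * b * Real.log b := by
    calc (b : ℝ) * Real.log α ≤ b * Real.log b := by gcongr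
      _ ≤ α * (b * Real.log b) := by
        have : 0 ≤ (b : ℝ) * Real.log b := by
          have := half_le_log (hα.trans hαb)
          positivity
        nlinarith
      _ = _ := by ring
  linarith

/-- The fingerprint tests cost `(n/α + b) log b`, which is within the stated bound because `log α ≤
α`. -/
theorem log_mul_le_queryCost {n b α : ℕ} (hα : 2 ≤ α) (hαb : α ≤ b) :
    Real.log b * ((n : ℝ) / α + b) ≤ queryCost n b α := by
  have la := half_le_log hα
  have lb := half_le_log (hα.trans hαb)
  have hα' : (2 : ℝ) ≤ α := by exact_mod_cast hα
  have hle : Real.log α ≤ α := (Real.log_le_sub_one_of_pos (by linarith)).trans (by linarith)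
  have hn : (0 : ℝ) ≤ n := by positivity
  have hb : (0 : ℝ) ≤ b := by positivity
  unfold queryCost
  have h1 : Real.log b * ((n : ℝ) / α) ≤ n * Real.log b / Real.log α := by
    rw [← mul_div_assoc, mul_comm]
    gcongr
  have h2 : Real.log b * b ≤ α * b * Real.log b / Real.log α := by
    rw [le_div_iff₀ (by linarith)]
    calc Real.log b * b * Real.log α ≤ Real.log b * b * α := by gcongr
      _ = _ := by ring
  linarith

/-- The time for all queries. -/
theorem mul_lcpTime_le {b α κ w σ c : ℕ} {T : List ℕ} (hα : 2 ≤ α) (hαb : α ≤ b)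
    (hS : Setup κ w T σ b α P c) :
    (b : ℝ) * P.lcpTime ≤ (600 + 5000 * κ) * queryCost T.length b α := by
  have lb := half_le_log (hα.trans hαb)
  have hΛ : (P.Λ : ℝ) + 1 ≤ 6 * Real.log b := by
    have h₁ : (P.Λ : ℝ) ≤ Nat.log 2 b + 1 := by exact_mod_cast hS.Λ_le
    have := natLog_le_log (b := b) (by omega)
    linarith
  have hb : (0 : ℝ) < b := by
    have : 0 < b := by omega
    exact_mod_cast this
  have hα0 : (0 : ℝ) < α := by
    have : 0 < α := by omega
    exact_mod_cast this
  set n := T.length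
  -- The spacing `g` was chosen so that `b` walks from sampled prefixes cost `n/α + b` in total;
  -- similarly `R` below, so that all letter comparisons cost `n + b`.
  have hg : (b : ℝ) * P.g ≤ n / α + b := by
    have : (P.g : ℝ) ≤ n / (α * b) + 1 := by
      rw [hS.g_eq, Nat.cast_add, Nat.cast_one]
      gcongr
      exact_mod_cast Nat.cast_div_le (α := ℝ) (m := n) (n := α * b)
    calc (b : ℝ) * P.g ≤ b * (n / (α * b) + 1) := by gcongr
      _ = _ := by field_simp
  have hR : (b : ℝ) * P.R ≤ n + b := by
    have : (P.R : ℝ) ≤ n / b + 1 := by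
      rw [hS.R_eq, Nat.cast_add, Nat.cast_one]
      gcongr
      exact Nat.cast_div_le
    calc (b : ℝ) * P.R ≤ b * (n / b + 1) := by gcongr
      _ = _ := by field_simp
  have q₁ := cast_add_cast_le_queryCost (n := n) hα hαb
  have q₂ := log_mul_le_queryCost (n := n) hα hαb
  have hn : (0 : ℝ) ≤ n := by positivity
  have hnα : (0 : ℝ) ≤ n / α := by positivity
  unfold Par.lcpTime
  rw [hS.κ_eq]
  push_cast
  have hκ : (0 : ℝ) ≤ κ := by positivity
  calc (b : ℝ) * (100 + ((P.Λ : ℝ) + 1) * (60 + κ * (510 + 320 * P.g)) + P.R * 60)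
      = 100 * b + ((P.Λ : ℝ) + 1) * (60 * b + κ * (510 * b + 320 * (b * P.g))) +
        60 * (b * P.R) := by ring
    _ ≤ 100 * b + (6 * Real.log b) * (60 * b + κ * (510 * b + 320 * (n / α + b))) +
        60 * (n + b) := by gcongr
    _ ≤ 100 * b + (6 * Real.log b) * (60 * (n / α + b) + κ * (830 * (n / α + b))) +
        60 * (n + b) := by
      gcongr <;> linarith
    _ = 100 * b + (360 + 4980 * κ) * (Real.log b * (n / α + b)) + 60 * (n + b) := by ring
    _ ≤ 100 * queryCost n b α + (360 + 4980 * κ) * queryCost n b α + 60 * queryCost n b α := by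
      gcongr
      linarith
    _ ≤ (600 + 5000 * κ) * queryCost n b α := by
      have : 0 ≤ queryCost n b α := by linarith
      nlinarith [mul_nonneg hκ this]

/-- The number of samples per seed fits the space bound: `⌊n/g⌋ < αb` for `g = ⌊n/(αb)⌋ + 1`. -/
theorem Setup.G_le {κ w σ b α c : ℕ} {T : List ℕ} (hS : Setup κ w T σ b α P c) (h2 : 2 ≤ α)
    (hb : 0 < b) : P.G ≤ α * b := by
  rw [hS.ok.G_eq, hS.T_eq, hS.g_eq, Nat.succ_le_iff, Nat.div_lt_iff_lt_mul (Nat.succ_pos _)]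
  exact Nat.lt_mul_div_succ _ (by positivity)

theorem Ready.space_le {κ w σ b α c : ℕ} {T : List ℕ} {u : ℕ → ℕ} {s : State 64}
    (hS : Ready κ w T σ b α P c u s) (h2 : 2 ≤ α) (hb : 0 < b) {p d : ℕ}
    (hp : p ≤ κ + 4 * (κ * P.G) + d * b) :
    ((64 + p : ℕ) : ℝ) ≤ (64 + 5 * κ + d : ℕ) * ((α : ℝ) * b) := by
  have h₁ : κ * P.G ≤ κ * (α * b) := Nat.mul_le_mul_left _ (hS.G_le h2 hb)
  have h₂ : 1 * b ≤ α * b := Nat.mul_le_mul_right _ (by omega)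
  have h₃ : d * (1 * b) ≤ d * (α * b) := Nat.mul_le_mul_left _ h₂
  have h₄ : (64 + κ) * 1 ≤ (64 + κ) * (α * b) := Nat.mul_le_mul_left _ (by omega)
  have : 64 + p ≤ (64 + 5 * κ + d) * (α * b) := by
    simp only [Nat.add_mul, Nat.mul_assoc, Nat.one_mul] at *
    omega
  exact_mod_cast this

theorem Valid.lcpInput {T : List ℕ} {σ α κ w : ℕ} {Q : List (ℕ × ℕ)} (hT : OverAlphabet σ T)
    (hn : 0 < T.length) (h2 : 2 ≤ α) (hb : α ≤ Q.length)
    (hw : 20 * (κ + 66) * (Nat.log 2 (T.length + σ + Q.length) + 1) ≤ w) :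
    Valid κ w T (lcpInput T σ Q α) σ Q.length α :=
  ⟨hT, hn, h2, hb, pow_le_two_pow hw, rfl, rfl, rfl, rfl⟩

theorem Valid.small {κ w σ b α : ℕ} {T x : List ℕ} (hV : Valid κ w T x σ b α) :
    64 * (T.length + σ + b + κ + 64) < 2 ^ w := by
  refine lt_of_lt_of_le ?_ hV.w_ge
  generalize T.length + σ + b + κ = m
  calc 64 * (m + 64) ≤ (m + 64) * (m + 64) := Nat.mul_le_mul_right _ (by omega)
    _ = (m + 64) ^ 2 := by ring
    _ < (m + 64) ^ 20 := Nat.pow_lt_pow_right (by omega) (by norm_num)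

theorem achieves_queries (e : ℕ) : ∃ C : ℝ, ∀ (T : List ℕ) (σ : ℕ) (Q : List (ℕ × ℕ)) (α w : ℕ),
    OverAlphabet σ T → (∀ q ∈ Q, q.1 < T.length ∧ q.2 < T.length) → 2 ≤ α → α ≤ Q.length →
    20 * (3 * (e + 3) + 66) * (Nat.log 2 (T.length + σ + Q.length) + 1) ≤ w →
    Achieves (hashedCmd (3 * (e + 3)) (queriesCmd (3 * (e + 3)))) w T (lcpInput T σ Q α)
      (fun out => out = lcpAnswers T Q) (C * queryCost T.length Q.length α)
      (C * ((α : ℝ) * Q.length)) (1 / (T.length : ℝ) ^ e) := by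
  generalize hκ : 3 * (e + 3) = κ
  refine ⟨111000 + 5300 * κ, fun T σ Q α w hT hQ h2 hb hw => ?_⟩
  have hn : 0 < T.length := by
    rcases Q with _ | ⟨q, Q⟩
    · simp at hb; omega
    · have := hQ q (by simp); omega
  have hV := Valid.lcpInput hT hn h2 hb hw
  refine achieves_hashedCmd hκ.symm hV fun P c u s hs => ?_
  have hw' := hV.small
  refine wp_mono _ ?_ (wp_queriesCmd hs hQ (by omega))
  rintro s' ⟨ht, hpk, ho⟩
  have hαb : (0 : ℝ) ≤ (α : ℝ) * Q.length := by positivity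
  have hκ0 : (0 : ℝ) ≤ κ := by positivity
  refine ⟨?_, (hs.space_le h2 (by omega) (d := 0) (by omega)).trans ?_, fun hu => ?_⟩
  · have ht' : s'.time ≤ 110000 * T.length + 12 * Q.length + 320 +
        κ * (140 * (T.length + 1) + 120) + Q.length * (P.lcpTime + 60) := by
      have := hs.time_le
      omega
    have ht'' : (s'.time : ℝ) ≤ 110000 * T.length + 12 * Q.length + 320 +
        κ * (140 * (T.length + 1) + 120) + Q.length * (P.lcpTime + 60) := by exact_mod_cast ht'
    have q₁ := cast_add_cast_le_queryCost (n := T.length) h2 hb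
    have q₂ := mul_lcpTime_le h2 hb hs.toSetup
    have hn' : (1 : ℝ) ≤ T.length := by exact_mod_cast hn
    have hb' : (0 : ℝ) ≤ Q.length := by positivity
    set X := queryCost T.length Q.length α
    have hX : 0 ≤ X := by linarith
    have e₁ : (κ : ℝ) * (140 * (T.length + 1) + 120) ≤ κ * (300 * X) := by
      have h2' : (2 : ℝ) ≤ Q.length := by exact_mod_cast h2.trans hb
      gcongr
      linarith
    have e₂ : (Q.length : ℝ) * (P.lcpTime + 60) = Q.length * P.lcpTime + 60 * Q.length := by ring
    rw [e₂] at ht''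
    nlinarith
  · gcongr
    push_cast
    linarith
  · rw [ho, queries_eq_lcpAnswers hs.toSetup hu hQ]

/-! ### Tournaments -/

/-- The winner of a match between two players, `0` standing for no player. -/
def best (less : ℕ → ℕ → Prop) [DecidableRel less] (a c : ℕ) : ℕ :=
  if a ≠ 0 ∧ (c = 0 ∨ less a c) then a else c

section Tournament

variable {less : ℕ → ℕ → Prop} [DecidableRel less] {b : ℕ} {W : ℕ → ℕ} {D : ℕ → Prop}

/-- Every match except the one at `v` has been decided. -/
def ConsistentExcept (less : ℕ → ℕ → Prop) [DecidableRel less] (b : ℕ) (W : ℕ → ℕ) (v : ℕ) :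
    Prop :=
  ∀ v', 1 ≤ v' → v' < b → v' ≠ v → W v' = best less (W (2 * v')) (W (2 * v' + 1))

/-- The players in `D` are at the leaves. -/
def Leaves (b : ℕ) (W : ℕ → ℕ) (D : ℕ → Prop) : Prop :=
  ∀ i < b, (D i → W (b + i) = i + 1) ∧ (¬ D i → W (b + i) = 0)

/-- Deciding the match at `v` again repairs it and can disturb only its parent, so the defect moves
up. At `0`, which is not a match, it has disappeared. -/
theorem ConsistentExcept.update {v : ℕ} (h : ConsistentExcept less b W v) :
    ConsistentExcept less b (Function.update W v (best less (W (2 * v)) (W (2 * v + 1))))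
      (v / 2) := by
  intro v' h1 h2 h3
  simp only [Function.update_apply]
  rw [if_neg (show 2 * v' ≠ v by omega), if_neg (show 2 * v' + 1 ≠ v by omega)]
  split_ifs with h'
  · rw [h']
  · exact h v' h1 h2 h'

theorem Leaves.update {v a : ℕ} (h : Leaves b W D) (hv : v < b) :
    Leaves b (Function.update W v a) D := by
  intro i hi
  rw [Function.update_of_ne (by omega)]
  exact h i hi

theorem Leaves.eq_zero_or (hW : Leaves b W D) (hc : ConsistentExcept less b W 0) {u : ℕ}
    (h1 : 1 ≤ u) (h2 : u < 2 * b) : W u = 0 ∨ ∃ i < b, D i ∧ W u = i + 1 := by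
  obtain ⟨m, hm⟩ : ∃ m, m + u = 2 * b := ⟨2 * b - u, by omega⟩
  induction m using Nat.strong_induction_on generalizing u with
  | _ m ih =>
    rcases lt_or_ge u b with hu | hu
    · rw [hc u h1 hu (by omega), best]
      split_ifs
      · exact ih (2 * b - 2 * u) (by omega) (by omega) (by omega) (by omega)
      · exact ih (2 * b - (2 * u + 1)) (by omega) (by omega) (by omega) (by omega)
    · obtain ⟨i, rfl⟩ := Nat.exists_eq_add_of_le hu
      by_cases hD : D i
      · exact .inr ⟨i, by omega, hD, (hW i (by omega)).1 hD⟩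
      · exact .inl ((hW i (by omega)).2 hD)

/-- A match with a player never has the absent player `0` as its winner, so presence propagates to
the root. -/
theorem ConsistentExcept.root_ne_zero (hc : ConsistentExcept less b W 0) {u : ℕ}
    (h1 : 1 ≤ u) (h2 : u < 2 * b) (h0 : W u ≠ 0) : W 1 ≠ 0 := by
  induction u using Nat.strong_induction_on with
  | _ u ih =>
    rcases Nat.eq_or_lt_of_le h1 with rfl | h1
    · exact h0
    · refine ih (u / 2) (by omega) (by omega) (by omega) ?_
      rw [hc (u / 2) (by omega) (by omega) (by omega), best]
      rcases Nat.mod_two_eq_zero_or_one u with h | h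
      · have : 2 * (u / 2) = u := by omega
        rw [this]
        split_ifs with hif
        · exact h0
        · intro h
          exact hif ⟨h0, .inl h⟩
      · have : 2 * (u / 2) + 1 = u := by omega
        rw [this]
        split_ifs with hif
        · exact hif.1
        · exact h0

theorem Leaves.root (hW : Leaves b W D) (hc : ConsistentExcept less b W 0) {i : ℕ} (hi : i < b)
    (hD : D i) : ∃ j < b, D j ∧ W 1 = j + 1 := by
  refine (hW.eq_zero_or hc le_rfl (by omega)).resolve_left ?_
  refine hc.root_ne_zero (u := b + i) (by omega) (by omega) ?_
  rw [(hW i hi).1 hD]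
  omega

/-- Going from `u` up to the root, the winner can only become smaller. Totality handles the single
match at the parent, transitivity the rest of the path. -/
theorem Leaves.root_min (hW : Leaves b W D) (hc : ConsistentExcept less b W 0)
    (htot : ∀ i j, i < b → j < b → i ≠ j → ¬ less (i + 1) (j + 1) → less (j + 1) (i + 1))
    (htr : ∀ i j k, i < b → j < b → k < b → less (i + 1) (j + 1) → less (j + 1) (k + 1) →
      less (i + 1) (k + 1)) {u : ℕ} (h1 : 1 ≤ u) (h2 : u < 2 * b) (h0 : W u ≠ 0) :
    W 1 = W u ∨ less (W 1) (W u) := by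
  induction u using Nat.strong_induction_on with
  | _ u ih =>
    rcases Nat.eq_or_lt_of_le h1 with rfl | h1
    · exact .inl rfl
    · have hle : W (u / 2) ≠ 0 ∧ (W (u / 2) = W u ∨ less (W (u / 2)) (W u)) := by
        rw [hc (u / 2) (by omega) (by omega) (by omega), best]
        have a₁ := hW.eq_zero_or hc (u := 2 * (u / 2)) (by omega) (by omega)
        have a₂ := hW.eq_zero_or hc (u := 2 * (u / 2) + 1) (by omega) (by omega)
        rcases Nat.mod_two_eq_zero_or_one u with h | h
        · have e : 2 * (u / 2) = u := by omega
          rw [e] at a₁ a₂ ⊢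
          split_ifs with hif
          · exact ⟨h0, .inl rfl⟩
          · push Not at hif
            obtain ⟨i₂, hi₂, -, e₂⟩ := a₂.resolve_left (hif h0).1
            obtain ⟨i₁, hi₁, -, e₁⟩ := a₁.resolve_left h0
            have := (hif h0).2
            rw [e₁, e₂] at this ⊢
            refine ⟨by omega, ?_⟩
            by_cases hij : i₁ = i₂
            · exact .inl (by rw [hij])
            · exact .inr (htot _ _ hi₁ hi₂ hij this)
        · have e : 2 * (u / 2) + 1 = u := by omega
          rw [e] at a₂ ⊢
          split_ifs with hif
          · exact ⟨hif.1, .inr (hif.2.resolve_left h0)⟩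
          · exact ⟨h0, .inl rfl⟩
      rcases ih (u / 2) (by omega) (by omega) (by omega) hle.1 with h | h
      · rw [h]; exact hle.2
      · rcases hle.2 with h' | h'
        · rw [← h']; exact .inr h
        · obtain ⟨i, hi, -, ei⟩ := (hW.eq_zero_or hc (u := 1) le_rfl (by omega)).resolve_left
            (hc.root_ne_zero (by omega) h2 h0)
          obtain ⟨j, hj, -, ej⟩ := (hW.eq_zero_or hc (u := u / 2) (by omega)
            (by omega)).resolve_left hle.1
          obtain ⟨k, hk, -, ek⟩ := (hW.eq_zero_or hc (u := u) (by omega) h2).resolve_left h0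
          rw [ei, ej] at h
          rw [ej, ek] at h'
          rw [ei, ek]
          exact .inr (htr _ _ _ hi hj hk h h')

end Tournament

/-! ### The order of the suffixes -/

section Order

variable {T : List ℕ} {σ : ℕ}

/-- The order of two suffixes if `l` is the length of their longest common prefix; the end of the
text is smaller than all letters. -/
def LessAt (T : List ℕ) (l i j : ℕ) : Prop := T.getD (i + l) 0 < T.getD (j + l) 0

instance (T : List ℕ) (l i j : ℕ) : Decidable (LessAt T l i j) := by
  unfold LessAt; infer_instance

theorem OverAlphabet.getD_pos (hT : OverAlphabet σ T) {i : ℕ} (hi : i < T.length) :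
    0 < T.getD i 0 := by
  rw [List.getD_eq_getElem _ _ hi]
  exact (hT _ (List.getElem_mem hi)).1

/-- Letters are positive, so the default value `0` acts as a terminator: the first disagreement of
the padded suffixes is at their longest common prefix, even if one suffix ends there. -/
theorem suffixLcp_eq {i j l : ℕ} (hi : i < T.length) (hj : j < T.length)
    (h : ∀ m < l, T.getD (i + m) 0 = T.getD (j + m) 0) (hT : OverAlphabet σ T)
    (hl : T.getD (i + l) 0 ≠ T.getD (j + l) 0) : suffixLcp T i j = l := by
  have hle : l ≤ shorter T i j := by
    rw [shorter_eq]
    by_contra hc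
    have hm : min (T.length - i) (T.length - j) < l := by omega
    rcases Nat.lt_trichotomy i j with hij | rfl | hij
    · have e := h (T.length - j) (by omega)
      rw [List.getD_eq_default (n := j + (T.length - j)) _ _ (by omega)] at e
      have := hT.getD_pos (i := i + (T.length - j)) (by omega)
      omega
    · exact hl rfl
    · have e := h (T.length - i) (by omega)
      rw [List.getD_eq_default (n := i + (T.length - i)) _ _ (by omega)] at e
      have := hT.getD_pos (i := j + (T.length - i)) (by omega)
      omega
  refine le_antisymm ?_ (le_suffixLcp hle h)
  by_contra hc
  exact hl (getD_eq_of_lt_suffixLcp (by omega))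

/-- The longest common prefix of the outer suffixes is the minimum of the other two, and the strict
inequality of letters survives there in each case. -/
theorem LessAt.trans (hT : OverAlphabet σ T) {i j k : ℕ} (hi : i < T.length)
    (hk : k < T.length) (h₁ : LessAt T (suffixLcp T i j) i j)
    (h₂ : LessAt T (suffixLcp T j k) j k) : LessAt T (suffixLcp T i k) i k := by
  have e₁ := fun m => getD_eq_of_lt_suffixLcp (T := T) (i := i) (j := j) (m := m)
  have e₂ := fun m => getD_eq_of_lt_suffixLcp (T := T) (i := j) (j := k) (m := m)
  unfold LessAt at h₁ h₂
  generalize suffixLcp T i j = a at *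
  generalize suffixLcp T j k = c at *
  have key : suffixLcp T i k = min a c ∧ T.getD (i + min a c) 0 < T.getD (k + min a c) 0 := by
    have hlt : T.getD (i + min a c) 0 < T.getD (k + min a c) 0 := by
      rcases Nat.lt_trichotomy a c with h | rfl | h
      · rw [min_eq_left h.le, ← e₂ a h]; exact h₁
      · rw [min_self]; exact h₁.trans h₂
      · rw [min_eq_right h.le, e₁ c h]; exact h₂
    refine ⟨suffixLcp_eq hi hk (fun m hm => ?_) hT hlt.ne, hlt⟩
    rw [e₁ m (by omega), e₂ m (by omega)]
  rw [LessAt, key.1]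
  exact key.2

/-- Suffixes at different positions have different lengths, so the padded suffixes do disagree at
the end of their common prefix. -/
theorem LessAt.total (hT : OverAlphabet σ T) {i j : ℕ} (hi : i < T.length) (hj : j < T.length)
    (hij : i ≠ j) (h : ¬ LessAt T (suffixLcp T i j) i j) : LessAt T (suffixLcp T j i) j i := by
  have hle := suffixLcp_le T i j
  have hne : T.getD (i + suffixLcp T i j) 0 ≠ T.getD (j + suffixLcp T i j) 0 := by
    rcases Nat.lt_or_eq_of_le hle with hlt | he
    · exact getD_suffixLcp_ne hlt
    · rw [he, shorter_eq]
      rcases Nat.lt_or_gt_of_ne hij with hlt | hlt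
      · rw [min_eq_right (by omega), List.getD_eq_default (n := j + (T.length - j)) _ _ (by omega)]
        exact (hT.getD_pos (by omega)).ne'
      · rw [min_eq_left (by omega), List.getD_eq_default (n := i + (T.length - i)) _ _ (by omega)]
        exact (hT.getD_pos (by omega)).ne
  have e : suffixLcp T j i = suffixLcp T i j :=
    suffixLcp_eq hj hi (fun m hm => (getD_eq_of_lt_suffixLcp hm).symm) hT hne.symm
  unfold LessAt at *
  rw [e]
  omega

theorem LessAt.lt_length {l i j : ℕ} (h : LessAt T l i j) : j + l < T.length := by
  by_contra hc
  unfold LessAt at h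
  rw [List.getD_eq_default (n := j + l) _ _ (by omega)] at h
  omega

end Order

/-! ### Insertion of suffixes into a compacted trie -/

/-- An array of `count` nodes; the path from the root to the node of the suffix `prev` that has
been inserted last, given by its nodes `stk i` and their depths `dep i`, where `i ≤ sp`. -/
structure Trie where
  node : ℕ → TreeNode
  count : ℕ
  stk : ℕ → ℕ
  dep : ℕ → ℕ
  sp : ℕ
  prev : ℕ

/-- The last of the depths `dep 0, …, dep i` which is at most `l`. -/
def pop (dep : ℕ → ℕ) (l : ℕ) : ℕ → ℕ
  | 0 => 0
  | i + 1 => if l < dep (i + 1) then pop dep l i else i + 1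

theorem pop_le (dep : ℕ → ℕ) (l i : ℕ) : pop dep l i ≤ i := by
  induction i with
  | zero => exact le_rfl
  | succ i ih => rw [pop]; split_ifs <;> omega

theorem dep_pop_le {dep : ℕ → ℕ} {l : ℕ} (h0 : dep 0 = 0) (i : ℕ) : dep (pop dep l i) ≤ l := by
  induction i with
  | zero => simp [pop, h0]
  | succ i ih => rw [pop]; split_ifs <;> omega

theorem lt_dep_of_pop_lt {dep : ℕ → ℕ} {l i : ℕ} (h : pop dep l i < i) :
    l < dep (pop dep l i + 1) := by
  induction i with
  | zero => omega
  | succ i ih =>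
    rw [pop] at h ⊢
    split_ifs at h ⊢ with hl
    · rcases Nat.lt_or_eq_of_le (pop_le dep l i) with h' | h'
      · exact ih h'
      · rwa [h']
    · omega

namespace Trie

/-- The trie of no suffix. -/
def empty : Trie := ⟨fun _ => ⟨0, 0, 0, 0⟩, 1, fun _ => 0, fun _ => 0, 0, 0⟩

/-- Attach a leaf to the node `stk j`. -/
def addLeaf (n s l j : ℕ) (S : Trie) : Trie where
  node := Function.update S.node S.count ⟨S.stk j, s + l, n - (s + l), s + 1⟩
  count := S.count + 1
  stk := Function.update S.stk (j + 1) S.count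
  dep := Function.update S.dep (j + 1) (n - s)
  sp := j + 1
  prev := s

/-- Split the edge from `stk j` to `stk (j + 1)` at depth `l`. -/
def split (s l j : ℕ) (S : Trie) : Trie where
  node := Function.update
    (Function.update S.node S.count ⟨S.stk j, s + S.dep j, l - S.dep j, 0⟩) (S.stk (j + 1))
    ⟨S.count, S.prev + l, S.dep (j + 1) - l, (S.node (S.stk (j + 1))).mark⟩
  count := S.count + 1
  stk := Function.update S.stk (j + 1) S.count
  dep := Function.update S.dep (j + 1) l
  sp := j + 1
  prev := S.prev

/-- Insert the suffix at `s` whose longest common prefix with the suffix at `prev` has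
length `l`. -/
def insertAt (n s l : ℕ) (S : Trie) : Trie :=
  if S.dep (pop S.dep l S.sp) < l then
    addLeaf n s l (pop S.dep l S.sp + 1) (split s l (pop S.dep l S.sp) S)
  else addLeaf n s l (pop S.dep l S.sp) S

/-- Properties that hold even if the suffixes are in a wrong order; `r` suffixes have been
inserted into `S`. -/
structure Bounded (n r : ℕ) (S : Trie) : Prop where
  dep_zero : S.dep 0 = 0
  sp_le : S.sp + 1 ≤ S.count
  count_le : S.count ≤ 2 * r + 1
  stk_lt : ∀ i ≤ S.sp, S.stk i < S.count
  dep_le : ∀ i ≤ S.sp, S.dep i ≤ n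
  prev_le : S.prev ≤ n
  -- A count of `1` characterizes the empty trie, the only one whose path does not end with the leaf
  -- of the suffix `prev`.
  top : S.count ≠ 1 → S.dep S.sp = n - S.prev
  parent_lt : ∀ k < S.count, (S.node k).parent < S.count
  start_le : ∀ k < S.count, (S.node k).start ≤ n
  len_le : ∀ k < S.count, (S.node k).len ≤ n
  mark_le : ∀ k < S.count, (S.node k).mark ≤ n
  count_ne : r ≠ 0 → S.count ≠ 1

theorem bounded_empty (n : ℕ) : Bounded n 0 empty := by
  constructor <;> simp [empty]

/-- The top of the stack has depth `n - prev ≥ l`, so an edge is split only where `stk (j + 1)`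
exists. -/
theorem Bounded.pop_lt {n r : ℕ} {S : Trie} (h : Bounded n r S) {l : ℕ} (hl0 : S.count = 1 → l = 0)
    (hl : l ≤ n - S.prev) (hd : S.dep (pop S.dep l S.sp) < l) : pop S.dep l S.sp < S.sp := by
  rcases Nat.lt_or_eq_of_le (pop_le S.dep l S.sp) with hp | hp
  · exact hp
  · rw [hp] at hd
    have : S.count ≠ 1 := fun hc => by have := hl0 hc; omega
    have := h.top this
    omega

/-- An insertion adds at most two nodes. No order of the suffixes is assumed, so memory safety and
time bounds persist with bad seeds. -/
theorem Bounded.insertAt {n r s l : ℕ} {S : Trie} (h : Bounded n r S) (hs : s < n)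
    (hl0 : S.count = 1 → l = 0) (hl : l ≤ n - S.prev) (hl' : l ≤ n - s) :
    Bounded n (r + 1) (S.insertAt n s l) := by
  have hple := pop_le S.dep l S.sp
  have hlt := h.pop_lt hl0 hl
  unfold Trie.insertAt
  generalize pop S.dep l S.sp = j at *
  obtain ⟨h1, h2, h3, h4, h5, h6, h7, h8, h9, h10, h11, h12⟩ := h
  split_ifs with hd
  · have hj := hlt hd
    have := h4 (j + 1) (by omega)
    have := h4 j (by omega)
    have := h5 (j + 1) (by omega)
    have := h11 (S.stk (j + 1)) (by omega)
    constructor <;> simp only [addLeaf, split, Function.update_apply]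
    · rw [if_neg (by omega), if_neg (by omega), h1]
    · omega
    · omega
    · intro i hi
      have := h4 i
      split_ifs <;> omega
    · intro i hi
      have := h5 i
      split_ifs <;> omega
    · omega
    · simp
    all_goals
      first
      | omega
      | intro k hk
        have := h8 k
        have := h9 k
        have := h10 k
        have := h11 k
        split_ifs <;> simp <;> omega
  · have := h4 j (by omega)
    constructor <;> simp only [addLeaf, split, Function.update_apply]
    · rw [if_neg (by omega), h1]
    · omega
    · omega
    · intro i hi
      have := h4 i
      split_ifs <;> omega
    · intro i hi
      have := h5 i
      split_ifs <;> omega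
    · omega
    · simp
    all_goals
      first
      | omega
      | intro k hk
        have := h8 k
        have := h9 k
        have := h10 k
        have := h11 k
        split_ifs <;> simp <;> omega

end Trie

/-- The factor of `T` at position `a` of length `l`. -/
def seg (T : List ℕ) (a l : ℕ) : List ℕ := (T.drop a).take l

theorem seg_add (T : List ℕ) (a l m : ℕ) : seg T a (l + m) = seg T a l ++ seg T (a + l) m := by
  simp only [seg, List.take_add, List.drop_drop]

theorem seg_length {T : List ℕ} {a l : ℕ} (h : a + l ≤ T.length) : (seg T a l).length = l := by
  simp only [seg, List.length_take, List.length_drop]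
  omega

theorem seg_all (T : List ℕ) (a : ℕ) : seg T a (T.length - a) = T.drop a := by
  simp [seg, List.take_of_length_le]

theorem seg_congr {T : List ℕ} {i j l : ℕ} (hi : i + l ≤ T.length) (hj : j + l ≤ T.length)
    (h : ∀ m < l, T.getD (i + m) 0 = T.getD (j + m) 0) : seg T i l = seg T j l := by
  refine List.ext_getElem (by rw [seg_length hi, seg_length hj]) fun m h₁ h₂ => ?_
  rw [seg_length hi] at h₁
  have := h m h₁
  rw [List.getD_eq_getElem _ _ (by omega), List.getD_eq_getElem _ _ (by omega)] at this
  simpa [seg] using this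

theorem getD_eq_of_seg_eq {T : List ℕ} {i j l m : ℕ} (hl : 0 < l) (hm : 0 < m)
    (hi : i + l ≤ T.length) (hj : j + m ≤ T.length) (h : seg T i l = seg T j m) :
    T.getD i 0 = T.getD j 0 := by
  have := congrArg (fun s => s.getD 0 0) h
  simp only [seg] at this
  rw [List.getD_eq_getElem _ _ (by omega), List.getD_eq_getElem _ _ (by omega)]
  rw [List.getD_eq_getElem _ _ (by simp; omega), List.getD_eq_getElem _ _ (by simp; omega)] at this
  simpa using this

/-! ### Correctness of the insertion of suffixes in increasing order. -/

namespace Trie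

/-- `S` is the compacted trie of the suffixes in `L`, and `str k` is the path label of node `k`;
`A` is the set of nodes without a mark which still need another child. -/
structure Correct (T L : List ℕ) (S : Trie) (str : ℕ → List ℕ) (A : ℕ → Prop) : Prop where
  root : S.node 0 = ⟨0, 0, 0, 0⟩
  str_root : str 0 = []
  count_pos : 0 < S.count
  edge : ∀ k < S.count, 0 < k → (S.node k).parent < S.count ∧ 0 < (S.node k).len ∧
    (S.node k).start + (S.node k).len ≤ T.length ∧
    str k = str (S.node k).parent ++ seg T (S.node k).start (S.node k).len
  siblings : ∀ j k, 0 < j → j < k → k < S.count → (S.node j).parent = (S.node k).parent →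
    T.getD (S.node j).start 0 < T.getD (S.node k).start 0
  mark_sound : ∀ k < S.count, (S.node k).mark ≠ 0 →
    ∃ i ∈ L, (S.node k).mark = i + 1 ∧ str k = T.drop i
  mark_complete : ∀ i ∈ L, ∃ k < S.count, (S.node k).mark = i + 1
  branching : ∀ k < S.count, 0 < k → (S.node k).mark = 0 → ¬ A k →
    ∃ i j, 0 < i ∧ i < j ∧ j < S.count ∧ (S.node i).parent = k ∧ (S.node j).parent = k
  stk_zero : S.stk 0 = 0
  dep_zero : S.dep 0 = 0
  stk_lt : ∀ i ≤ S.sp, S.stk i < S.count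
  stk_mono : ∀ i < S.sp, S.stk i < S.stk (i + 1)
  dep_mono : ∀ i < S.sp, S.dep i < S.dep (i + 1)
  dep_le : ∀ i ≤ S.sp, S.prev + S.dep i ≤ T.length
  str_stk : ∀ i ≤ S.sp, str (S.stk i) = seg T S.prev (S.dep i)
  parent_stk : ∀ i < S.sp, (S.node (S.stk (i + 1))).parent = S.stk i
  -- The stack follows, at each of its nodes, the child with the largest index. As siblings are to
  -- appear in the array in the order of their letters, this is the last child.
  rightmost : ∀ k < S.count, 0 < k → ∀ i < S.sp, (S.node k).parent = S.stk i →
    k ≤ S.stk (i + 1)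
  -- Vacuous if the top is the leaf of `prev`, whose depth reaches the end of the text; it matters
  -- between `split` and `addLeaf`, when the top is the new inner node.
  child_top : ∀ k < S.count, 0 < k → (S.node k).parent = S.stk S.sp →
    T.getD (S.node k).start 0 ≤ T.getD (S.prev + S.dep S.sp) 0 ∧ S.prev + S.dep S.sp < T.length

variable {T L : List ℕ} {S : Trie} {str : ℕ → List ℕ} {A : ℕ → Prop}

theorem correct_empty (T : List ℕ) : Correct T [] empty (fun _ => []) (fun _ => False) := by
  constructor <;> simp [empty, seg] <;> omega

/-- The label of an edge on the path spells the letters of the suffix `prev` between two depths;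
cancelling the common part of the path labels shows it. -/
theorem Correct.getD_start (h : Correct T L S str A) {i : ℕ} (hi : i < S.sp) :
    T.getD (S.node (S.stk (i + 1))).start 0 = T.getD (S.prev + S.dep i) 0 := by
  have hm := h.stk_mono i hi
  obtain ⟨-, e₂, e₃, e₄⟩ := h.edge _ (h.stk_lt (i + 1) (by omega)) (by omega)
  have hd := h.dep_mono i hi
  have hle := h.dep_le (i + 1) (by omega)
  rw [h.parent_stk i hi, h.str_stk i (by omega), h.str_stk (i + 1) (by omega),
    show S.dep (i + 1) = S.dep i + (S.dep (i + 1) - S.dep i) by omega, seg_add] at e₄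
  exact getD_eq_of_seg_eq e₂ (by omega) e₃ (by omega) (List.append_cancel_left e₄).symm

theorem Correct.stk_mono' (h : Correct T L S str A) {i j : ℕ} (hij : i < j) (hj : j ≤ S.sp) :
    S.stk i < S.stk j := by
  induction j with
  | zero => omega
  | succ j ih =>
    have := h.stk_mono j (by omega)
    rcases Nat.lt_succ_iff_lt_or_eq.1 hij with h' | rfl
    · exact (ih h' (by omega)).trans this
    · exact this

theorem Correct.dep_mono' (h : Correct T L S str A) {i j : ℕ} (hij : i < j) (hj : j ≤ S.sp) :
    S.dep i < S.dep j := by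
  induction j with
  | zero => omega
  | succ j ih =>
    have := h.dep_mono j (by omega)
    rcases Nat.lt_succ_iff_lt_or_eq.1 hij with h' | rfl
    · exact (ih h' (by omega)).trans this
    · exact this

theorem Correct.stk_inj (h : Correct T L S str A) {i j : ℕ} (hi : i ≤ S.sp) (hj : j ≤ S.sp)
    (hij : S.stk i = S.stk j) : i = j := by
  rcases Nat.lt_trichotomy i j with h' | h' | h'
  · have := h.stk_mono' h' hj; omega
  · exact h'
  · have := h.stk_mono' h' hi; omega

/-- The children of the nodes `stk j` start with smaller letters than those to come. -/
theorem Correct.getD_le (h : Correct T L S str A) {j k : ℕ} (hj : j ≤ S.sp) (hk : k < S.count)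
    (hk0 : 0 < k) (hp : (S.node k).parent = S.stk j) :
    T.getD (S.node k).start 0 ≤ T.getD (S.prev + S.dep j) 0 ∧ (j < S.sp → k ≠ S.stk (j + 1) →
      T.getD (S.node k).start 0 < T.getD (S.prev + S.dep j) 0) := by
  rcases Nat.lt_or_eq_of_le hj with hlt | rfl
  · have hle := h.rightmost k hk hk0 j hlt hp
    have e := h.getD_start hlt
    rcases Nat.lt_or_eq_of_le hle with h' | rfl
    · have := h.siblings k _ hk0 h' (h.stk_lt _ (by omega)) (by rw [hp, h.parent_stk j hlt])
      omega
    · exact ⟨by omega, fun _ h => absurd rfl h⟩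
  · exact ⟨(h.child_top k hk hk0 hp).1, fun hlt => absurd hlt (lt_irrefl _)⟩

/-- The new node takes the place of `stk (j + 1)` below `stk j`. It has the largest index, and being
on the rightmost path it begins with the largest letter among its siblings, so the order is kept. It
still lacks a second child, hence the exception set. -/
theorem Correct.split (h : Correct T L S str fun _ => False) {s l j : ℕ} (hj : j < S.sp)
    (hd : S.dep j < l) (hd' : l < S.dep (j + 1)) (hs : s + l ≤ T.length)
    (hl : ∀ m < l, T.getD (S.prev + m) 0 = T.getD (s + m) 0) :
    Correct T L (S.split s l j) (Function.update str S.count (seg T S.prev l))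
      (· = S.count) := by
  have hu := h.stk_lt j (by omega)
  have hx := h.stk_lt (j + 1) (by omega)
  have hux := h.stk_mono j hj
  have hdx := h.dep_le (j + 1) (by omega)
  have hpx := h.parent_stk j hj
  have hxc := hx.ne
  have hseg : seg T S.prev l = seg T s l := seg_congr (by omega) hs hl
  have hseg' : seg T S.prev (S.dep j) = seg T s (S.dep j) :=
    seg_congr (by omega) (by omega) fun m hm => hl m (by omega)
  have nodex : (S.split s l j).node (S.stk (j + 1)) = ⟨S.count, S.prev + l, S.dep (j + 1) - l,
      (S.node (S.stk (j + 1))).mark⟩ := by simp [Trie.split]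
  have nodec : (S.split s l j).node S.count = ⟨S.stk j, s + S.dep j, l - S.dep j, 0⟩ := by
    simp [Trie.split, Function.update_apply, hxc.symm]
  have node : ∀ k, k ≠ S.stk (j + 1) → k ≠ S.count → (S.split s l j).node k = S.node k := by
    intro k h₁ h₂
    simp [Trie.split, Function.update_apply, h₁, h₂]
  have par : ∀ k < S.count, (S.node k).parent < S.count := by
    intro k hk
    rcases Nat.eq_zero_or_pos k with rfl | h0
    · rw [h.root]; exact h.count_pos
    · exact (h.edge k hk h0).1
  have strc : ∀ k < S.count, Function.update str S.count (seg T S.prev l) k = str k :=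
    fun k hk => Function.update_of_ne hk.ne _ _
  have stk : ∀ i ≤ j, (S.split s l j).stk i = S.stk i := fun i hi =>
    Function.update_of_ne (by omega) _ _
  have stkj : (S.split s l j).stk (j + 1) = S.count := Function.update_self _ _ _
  have dep : ∀ i ≤ j, (S.split s l j).dep i = S.dep i := fun i hi =>
    Function.update_of_ne (by omega) _ _
  have depj : (S.split s l j).dep (j + 1) = l := Function.update_self _ _ _
  have count : (S.split s l j).count = S.count + 1 := rfl
  have sp : (S.split s l j).sp = j + 1 := rfl
  have prev : (S.split s l j).prev = S.prev := rfl
  generalize S.split s l j = S' at *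
  refine ⟨?_, ?_, by omega, ?_, ?_, ?_, ?_, ?_, ?_, ?_, ?_, ?_, ?_, ?_, ?_, ?_, ?_, ?_⟩
  · rw [node 0 (by omega) (by have := h.count_pos; omega), h.root]
  · rw [strc 0 h.count_pos, h.str_root]
  · intro k hk h0
    by_cases hkx : k = S.stk (j + 1)
    · subst hkx
      rw [nodex, strc _ hx, h.str_stk _ (by omega), Function.update_self, count,
        show S.dep (j + 1) = l + (S.dep (j + 1) - l) by omega, seg_add, Nat.add_sub_cancel_left]
      exact ⟨Nat.lt_succ_self _, by dsimp only; omega, by dsimp only; omega, rfl⟩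
    by_cases hkc : k = S.count
    · subst hkc
      rw [nodec, Function.update_self, strc _ hu, h.str_stk _ (by omega), hseg, hseg', count]
      refine ⟨by dsimp only; omega, by dsimp only; omega, by dsimp only; omega, ?_⟩
      rw [← seg_add]
      congr 1
      dsimp only
      omega
    · have hkc : k < S.count := by omega
      rw [node k hkx hkc.ne, strc k hkc, strc _ (par k hkc), count]
      obtain ⟨e₁, e₂⟩ := h.edge k hkc h0
      exact ⟨by omega, e₂⟩
  · intro p q hp hpq hq hpar
    have hpc : p < S.count := by omega
    by_cases hpx' : p = S.stk (j + 1)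
    · rw [hpx', nodex] at hpar
      by_cases hqc : q = S.count
      · rw [hqc, nodec] at hpar
        dsimp only at hpar
        omega
      · rw [node q (by omega) hqc] at hpar
        have := par q (by omega)
        dsimp only at hpar
        omega
    rw [node p hpx' hpc.ne] at hpar ⊢
    by_cases hqx : q = S.stk (j + 1)
    · rw [hqx, nodex] at hpar
      have := par p hpc
      dsimp only at hpar
      omega
    by_cases hqc : q = S.count
    · rw [hqc, nodec] at hpar ⊢
      rw [← hl _ hd]
      exact (h.getD_le (by omega) hpc hp hpar).2 hj hpx'
    · rw [node q hqx hqc] at hpar ⊢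
      exact h.siblings p q hp hpq (by omega) hpar
  · intro k hk h0
    by_cases hkc : k = S.count
    · rw [hkc, nodec] at h0
      exact absurd rfl h0
    have hkc : k < S.count := by omega
    have e : (S'.node k).mark = (S.node k).mark := by
      by_cases hkx : k = S.stk (j + 1)
      · rw [hkx, nodex]
      · rw [node k hkx hkc.ne]
    rw [e] at h0 ⊢
    rw [strc k hkc]
    exact h.mark_sound k hkc h0
  · intro i hi
    obtain ⟨k, hk, hm⟩ := h.mark_complete i hi
    refine ⟨k, by omega, ?_⟩
    by_cases hkx : k = S.stk (j + 1)
    · rw [hkx, nodex]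
      rw [hkx] at hm
      exact hm
    · rwa [node k hkx hk.ne]
  · intro k hk h0 hm hkc
    have hkc : k < S.count := by omega
    have e : (S'.node k).mark = (S.node k).mark := by
      by_cases hkx : k = S.stk (j + 1)
      · rw [hkx, nodex]
      · rw [node k hkx hkc.ne]
    -- If one of the two children moves below the new node, it is the later one, by `rightmost`; the
    -- new node then replaces it as a child of `k`.
    obtain ⟨i, i', hi, hii, hi', hpi, hpi'⟩ := h.branching k hkc h0 (by rw [← e]; exact hm) id
    have hne : i ≠ S.stk (j + 1) := by
      rintro rfl
      have := h.rightmost i' hi' (by omega) j hj (by rw [hpi', ← hpi, hpx])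
      omega
    by_cases hix : i' = S.stk (j + 1)
    · refine ⟨i, S.count, hi, by omega, by omega, ?_, ?_⟩
      · rw [node i hne (by omega), hpi]
      · rw [nodec, ← hpi', hix, hpx]
    · refine ⟨i, i', hi, hii, by omega, ?_, ?_⟩
      · rw [node i hne (by omega), hpi]
      · rw [node i' hix (by omega), hpi']
  · rw [stk 0 (by omega), h.stk_zero]
  · rw [dep 0 (by omega), h.dep_zero]
  · intro i hi
    rcases Nat.lt_or_eq_of_le hi with hi | rfl
    · rw [stk i (by omega)]
      have := h.stk_lt i (by omega)
      omega
    · rw [sp, stkj]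
      omega
  · intro i hi
    rw [stk i (by omega)]
    by_cases hij : i = j
    · rw [hij, stkj]
      exact hu
    · rw [stk (i + 1) (by omega)]
      exact h.stk_mono i (by omega)
  · intro i hi
    rw [dep i (by omega)]
    by_cases hij : i = j
    · rw [hij, depj]
      exact hd
    · rw [dep (i + 1) (by omega)]
      exact h.dep_mono i (by omega)
  · intro i hi
    rw [prev]
    rcases Nat.lt_or_eq_of_le hi with hi | rfl
    · rw [dep i (by omega)]
      exact h.dep_le i (by omega)
    · rw [sp, depj]
      omega
  · intro i hi
    rw [prev]
    rcases Nat.lt_or_eq_of_le hi with hi | rfl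
    · rw [dep i (by omega), stk i (by omega), strc _ (h.stk_lt i (by omega))]
      exact h.str_stk i (by omega)
    · rw [sp, depj, stkj, Function.update_self]
  · intro i hi
    rw [stk i (by omega)]
    by_cases hij : i = j
    · rw [hij, stkj, nodec]
    · have := h.stk_mono' (i := i + 1) (j := j + 1) (by omega) (by omega)
      rw [stk (i + 1) (by omega), node _ (by omega) (by omega)]
      exact h.parent_stk i (by omega)
  · intro k hk h0 i hi hpar
    rw [stk i (by omega)] at hpar
    have hic := h.stk_lt i (by omega)
    by_cases hij : i = j
    · rw [hij, stkj]
      omega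
    rw [stk (i + 1) (by omega)]
    by_cases hkx : k = S.stk (j + 1)
    · rw [hkx, nodex] at hpar
      dsimp only at hpar
      omega
    by_cases hkc : k = S.count
    · rw [hkc, nodec] at hpar
      exact absurd (h.stk_inj (by omega) (by omega) hpar.symm) hij
    · rw [node k hkx hkc] at hpar
      exact h.rightmost k (by omega) h0 i (by omega) hpar
  · intro k hk h0 hpar
    rw [sp, stkj] at hpar
    rw [prev, sp, depj]
    by_cases hkx : k = S.stk (j + 1)
    · rw [hkx, nodex]
      exact ⟨le_rfl, by omega⟩
    by_cases hkc : k = S.count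
    · rw [hkc, nodec] at hpar
      dsimp only at hpar
      omega
    · rw [node k hkx hkc] at hpar
      have := par k (by omega)
      omega

/-- The leaf has the largest index and a letter larger than `T[prev + l]`, which bounds the letters
of all its siblings; so the order of siblings persists. By `hA` it also supplies the second child
that an unfinished node lacks. -/
theorem Correct.addLeaf (h : Correct T L S str A) {s l j : ℕ} (hj : j ≤ S.sp)
    (hd : S.dep j = l)
    (hA : ∀ k, A k → k = S.stk j ∧ ∃ i, 0 < i ∧ i < S.count ∧ (S.node i).parent = k)
    (hs : s + l < T.length) (hl : ∀ m < l, T.getD (S.prev + m) 0 = T.getD (s + m) 0)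
    (hlt : ∀ k < S.count, 0 < k → (S.node k).parent = S.stk j →
      T.getD (S.prev + l) 0 < T.getD (s + l) 0) :
    Correct T (s :: L) (S.addLeaf T.length s l j)
      (Function.update str S.count (T.drop s)) (fun _ => False) := by
  have hu := h.stk_lt j hj
  have hdl := h.dep_le j hj
  have nodec : (S.addLeaf T.length s l j).node S.count =
      ⟨S.stk j, s + l, T.length - (s + l), s + 1⟩ := Function.update_self _ _ _
  have node : ∀ k, k ≠ S.count → (S.addLeaf T.length s l j).node k = S.node k := fun k hk =>
    Function.update_of_ne hk _ _
  have par : ∀ k < S.count, (S.node k).parent < S.count := by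
    intro k hk
    rcases Nat.eq_zero_or_pos k with rfl | h0
    · rw [h.root]; exact h.count_pos
    · exact (h.edge k hk h0).1
  have strc : ∀ k < S.count, Function.update str S.count (T.drop s) k = str k :=
    fun k hk => Function.update_of_ne hk.ne _ _
  have stk : ∀ i ≤ j, (S.addLeaf T.length s l j).stk i = S.stk i := fun i hi =>
    Function.update_of_ne (by omega) _ _
  have stkj : (S.addLeaf T.length s l j).stk (j + 1) = S.count := Function.update_self _ _ _
  have dep : ∀ i ≤ j, (S.addLeaf T.length s l j).dep i = S.dep i := fun i hi =>
    Function.update_of_ne (by omega) _ _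
  have depj : (S.addLeaf T.length s l j).dep (j + 1) = T.length - s := Function.update_self _ _ _
  have depl : ∀ i ≤ j, S.dep i ≤ l := by
    intro i hi
    rcases Nat.lt_or_eq_of_le hi with hi | rfl
    · exact (h.dep_mono' hi hj).le.trans hd.le
    · exact hd.le
  have hseg : ∀ m ≤ l, seg T S.prev m = seg T s m := fun m hm =>
    seg_congr (by omega) (by omega) fun m' hm' => hl m' (by omega)
  have count : (S.addLeaf T.length s l j).count = S.count + 1 := rfl
  have sp : (S.addLeaf T.length s l j).sp = j + 1 := rfl
  have prev : (S.addLeaf T.length s l j).prev = s := rfl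
  generalize S.addLeaf T.length s l j = S' at *
  refine ⟨?_, ?_, by omega, ?_, ?_, ?_, ?_, ?_, ?_, ?_, ?_, ?_, ?_, ?_, ?_, ?_, ?_, ?_⟩
  · rw [node 0 (by have := h.count_pos; omega), h.root]
  · rw [strc 0 h.count_pos, h.str_root]
  · intro k hk h0
    by_cases hkc : k = S.count
    · subst hkc
      rw [nodec, Function.update_self, strc _ hu, h.str_stk j hj, hd, hseg l le_rfl, ← seg_add,
        count]
      refine ⟨by dsimp only; omega, by dsimp only; omega, by dsimp only; omega, ?_⟩
      rw [← seg_all]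
      congr 1
      dsimp only
      omega
    · have hkc : k < S.count := by omega
      rw [node k hkc.ne, strc k hkc, strc _ (par k hkc), count]
      obtain ⟨e₁, e₂⟩ := h.edge k hkc h0
      exact ⟨by omega, e₂⟩
  · intro p q hp hpq hq hpar
    have hpc : p < S.count := by omega
    rw [node p hpc.ne] at hpar ⊢
    by_cases hqc : q = S.count
    · rw [hqc, nodec] at hpar ⊢
      have h₁ := (h.getD_le hj hpc hp hpar).1
      have h₂ := hlt p hpc hp hpar
      rw [hd] at h₁
      exact lt_of_le_of_lt h₁ h₂
    · rw [node q hqc] at hpar ⊢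
      exact h.siblings p q hp hpq (by omega) hpar
  · intro k hk h0
    by_cases hkc : k = S.count
    · rw [hkc, nodec, Function.update_self]
      exact ⟨s, by simp, rfl, rfl⟩
    have hkc : k < S.count := by omega
    rw [node k hkc.ne] at h0 ⊢
    rw [strc k hkc]
    obtain ⟨i, hi, h'⟩ := h.mark_sound k hkc h0
    exact ⟨i, List.mem_cons_of_mem _ hi, h'⟩
  · intro i hi
    rcases List.mem_cons.1 hi with rfl | hi
    · exact ⟨S.count, by omega, by rw [nodec]⟩
    · obtain ⟨k, hk, hm⟩ := h.mark_complete i hi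
      exact ⟨k, by omega, by rwa [node k hk.ne]⟩
  · intro k hk h0 hm _
    by_cases hkc : k = S.count
    · rw [hkc, nodec] at hm
      simp at hm
    have hkc : k < S.count := by omega
    rw [node k hkc.ne] at hm
    by_cases hAk : A k
    · obtain ⟨rfl, i, hi, hi', hpi⟩ := hA k hAk
      exact ⟨i, S.count, hi, hi', by omega, by rw [node i hi'.ne, hpi], by rw [nodec]⟩
    · obtain ⟨i, i', hi, hii, hi', hpi, hpi'⟩ := h.branching k hkc h0 hm hAk
      exact ⟨i, i', hi, hii, by omega, by rw [node i (by omega), hpi],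
        by rw [node i' (by omega), hpi']⟩
  · rw [stk 0 (by omega), h.stk_zero]
  · rw [dep 0 (by omega), h.dep_zero]
  · intro i hi
    rcases Nat.lt_or_eq_of_le hi with hi | rfl
    · rw [stk i (by omega)]
      have := h.stk_lt i (by omega)
      omega
    · rw [sp, stkj]
      omega
  · intro i hi
    rw [stk i (by omega)]
    by_cases hij : i = j
    · rw [hij, stkj]
      exact hu
    · rw [stk (i + 1) (by omega)]
      exact h.stk_mono i (by omega)
  · intro i hi
    rw [dep i (by omega)]
    by_cases hij : i = j
    · rw [hij, depj]
      omega
    · rw [dep (i + 1) (by omega)]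
      exact h.dep_mono i (by omega)
  · intro i hi
    rw [prev]
    rcases Nat.lt_or_eq_of_le hi with hi | rfl
    · rw [dep i (by omega)]
      have := depl i (by omega)
      omega
    · rw [sp, depj]
      omega
  · intro i hi
    rw [prev]
    rcases Nat.lt_or_eq_of_le hi with hi | rfl
    · rw [dep i (by omega), stk i (by omega), strc _ (h.stk_lt i (by omega)),
        ← hseg _ (depl i (by omega))]
      exact h.str_stk i (by omega)
    · rw [sp, depj, stkj, Function.update_self, seg_all]
  · intro i hi
    rw [stk i (by omega)]
    by_cases hij : i = j
    · rw [hij, stkj, nodec]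
    · have := h.stk_lt (i + 1) (by omega)
      rw [stk (i + 1) (by omega), node _ (by omega)]
      exact h.parent_stk i (by omega)
  · intro k hk h0 i hi hpar
    rw [stk i (by omega)] at hpar
    by_cases hij : i = j
    · rw [hij, stkj]
      omega
    rw [stk (i + 1) (by omega)]
    by_cases hkc : k = S.count
    · rw [hkc, nodec] at hpar
      exact absurd (h.stk_inj (by omega) hj hpar.symm) hij
    · rw [node k hkc] at hpar
      exact h.rightmost k (by omega) h0 i (by omega) hpar
  · intro k hk h0 hpar
    rw [sp, stkj] at hpar
    by_cases hkc : k = S.count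
    · rw [hkc, nodec] at hpar
      dsimp only at hpar
      omega
    · rw [node k hkc] at hpar
      have := par k (by omega)
      omega

/-- Insertion of a suffix which is greater than all suffixes in the trie. -/
theorem Correct.insertAt (h : Correct T L S str fun _ => False)
    {s : ℕ} (htop : S.dep S.sp = T.length - S.prev)
    (hlt : LessAt T (suffixLcp T S.prev s) S.prev s) :
    ∃ str, Correct T (s :: L) (S.insertAt T.length s (suffixLcp T S.prev s)) str
      fun _ => False := by
  have hsl := hlt.lt_length
  have hl : ∀ m < suffixLcp T S.prev s, T.getD (S.prev + m) 0 = T.getD (s + m) 0 := fun m hm =>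
    getD_eq_of_lt_suffixLcp hm
  have hle := suffixLcp_le T S.prev s
  rw [shorter_eq] at hle
  unfold LessAt at hlt
  generalize suffixLcp T S.prev s = l at *
  -- After popping, `dep j ≤ l`, with `l < dep (j + 1)` if that entry exists. So the new suffix
  -- leaves the path at `stk j` itself or inside the edge below it, and these are the two cases.
  have hple := pop_le S.dep l S.sp
  have hdle := dep_pop_le (l := l) h.dep_zero S.sp
  have hpop := lt_dep_of_pop_lt (dep := S.dep) (l := l) (i := S.sp)
  unfold Trie.insertAt
  generalize pop S.dep l S.sp = j at *
  split_ifs with hd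
  · have hj : j < S.sp := by
      rcases Nat.lt_or_eq_of_le hple with hj | rfl
      · exact hj
      · omega
    have h' := h.split hj hd (hpop hj) (s := s) (by omega) hl
    refine ⟨_, h'.addLeaf le_rfl (by simp [Trie.split]) ?_ (by omega) hl fun _ _ _ _ => hlt⟩
    rintro k rfl
    have := h.stk_mono j hj
    have := h.stk_lt (j + 1) (by omega)
    refine ⟨by simp [Trie.split], S.stk (j + 1), by omega, ?_, ?_⟩
    · simp only [Trie.split]; omega
    · simp [Trie.split]
  · exact ⟨_, h.addLeaf hple (by omega) (fun k hk => hk.elim) (by omega) hl fun _ _ _ _ => hlt⟩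

/-- Insertion of the first suffix. -/
theorem correct_first {s : ℕ} (hs : s < T.length) :
    ∃ str, Correct T [s] (empty.insertAt T.length s 0) str fun _ => False := by
  have e : empty.insertAt T.length s 0 = empty.addLeaf T.length s 0 0 := by
    simp [Trie.insertAt, empty, pop]
  rw [e]
  refine ⟨_, (correct_empty T).addLeaf le_rfl rfl (fun k hk => hk.elim) (by omega) (by simp) ?_⟩
  intro k hk hk0
  simp [empty] at hk
  omega

/-- The nodes as a list. -/
def toList (S : Trie) : List TreeNode := (List.range S.count).map S.node

theorem Correct.isSparseSuffixTree (h : Correct T L S str fun _ => False) {I : List ℕ}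
    (hI : ∀ i, i ∈ I ↔ i ∈ L) : IsSparseSuffixTree T I S.toList := by
  have get : ∀ (k : ℕ) (v : TreeNode), S.toList[k]? = some v ↔ k < S.count ∧ S.node k = v := by
    intro k v
    rw [toList, List.getElem?_map, Option.map_eq_some_iff]
    constructor
    · rintro ⟨a, ha, rfl⟩
      rw [List.getElem?_eq_some_iff] at ha
      obtain ⟨hk, rfl⟩ := ha
      simpa using hk
    · rintro ⟨hk, rfl⟩
      exact ⟨k, by simp [hk], rfl⟩
  have len : S.toList.length = S.count := by simp [toList]
  refine ⟨str, ?_, h.str_root, ?_, ?_, ?_, ?_, ?_⟩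
  · exact (get _ _).2 ⟨h.count_pos, h.root⟩
  · intro k v h0 hv
    obtain ⟨hk, rfl⟩ := (get _ _).1 hv
    rw [len]
    exact h.edge k hk h0
  · intro j k u v h0 hjk hu hv hp
    obtain ⟨hj, rfl⟩ := (get _ _).1 hu
    obtain ⟨hk, rfl⟩ := (get _ _).1 hv
    exact h.siblings j k h0 hjk hk hp
  · intro k v hv h0
    obtain ⟨hk, rfl⟩ := (get _ _).1 hv
    obtain ⟨i, hi, h'⟩ := h.mark_sound k hk h0
    exact ⟨i, (hI i).2 hi, h'⟩
  · intro i hi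
    obtain ⟨k, hk, h'⟩ := h.mark_complete i ((hI i).1 hi)
    exact ⟨S.node k, List.mem_of_getElem? ((get _ _).2 ⟨hk, rfl⟩), h'⟩
  · intro k v h0 hv hm
    obtain ⟨hk, rfl⟩ := (get _ _).1 hv
    obtain ⟨i, j, hi, hij, hj, hpi, hpj⟩ := h.branching k hk h0 hm id
    exact ⟨i, j, _, _, hi, hij, (get _ _).2 ⟨by omega, rfl⟩, (get _ _).2 ⟨hj, rfl⟩, hpi, hpj⟩

end Trie

/-! ### The tournament on the machine -/

/-- The tables occupy only the addresses below `P.base`, so tournament and trie can be placed above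
them. -/
theorem Par.Tables.congr {u μ μ' : ℕ → ℕ} (h : P.Tables u μ)
    (hμ : ∀ a < P.κ + 4 * (P.κ * P.G), μ' a = μ a) : P.Tables u μ' := by
  have hlt : ∀ t < P.κ, ∀ q < P.G, t * P.G + q + 1 ≤ P.κ * P.G := by
    intro t ht q hq
    have : (t + 1) * P.G ≤ P.κ * P.G := Nat.mul_le_mul_right _ ht
    rw [Nat.add_mul] at this
    omega
  refine ⟨fun t ht => ?_, fun t ht q hq => ?_, fun t ht q hq => ?_, fun t ht q hq => ?_,
    fun t ht q hq => ?_⟩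
  · rw [hμ _ (by omega), h.seed t ht]
  all_goals
    have := hlt t ht q hq
    rw [hμ _ (by omega)]
  · exact h.f0 t ht q hq
  · exact h.f1 t ht q hq
  · exact h.p0 t ht q hq
  · exact h.p1 t ht q hq

/-- The number of words used by the tables of fingerprints. -/
def Par.base (P : Par) : ℕ := P.κ + 4 * (P.κ * P.G)

/-- The order of the suffixes number `a` and `c` of the input list, numbered from `1`, according to
the fingerprints. -/
def Par.Less (P : Par) (u : ℕ → ℕ) (x : List ℕ) (a c : ℕ) : Prop :=
  LessAt P.T (P.lcp u (x.getD (3 + a) 0) (x.getD (3 + c) 0)) (x.getD (3 + a) 0) (x.getD (3 + c) 0)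

instance (u : ℕ → ℕ) : DecidableRel (P.Less u x) := fun _ _ => by
  unfold Par.Less; infer_instance

/-- The general assumptions for the construction of the tree. -/
structure TreeSetup (P : Par) (x : List ℕ) (u : ℕ → ℕ) (b : ℕ) : Prop where
  ok : P.Ok
  seeds : ∀ t < P.κ, u t < P.σ * P.p * P.p * P.p
  two_le : 2 ≤ b
  pos_lt : ∀ i < b, x.getD (4 + i) 0 < P.T.length
  small : P.base + 20 * b + 64 < 2 ^ P.w

/-- What is kept by all parts of the construction of the tree. -/
structure TreeState (P : Par) (u : ℕ → ℕ) (b : ℕ) (s : State 64) : Prop where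
  regs : P.Regs s.reg
  reg2 : s.reg 2 = b
  reg14 : s.reg 14 = P.base
  tables : P.Tables u s.mem
  -- Beyond the tables: `2b` words for the tournament, `8b + 4` for at most `2b + 1` nodes, then two
  -- words per stack entry. For `b ≥ 2` all this fits in `17b`.
  peak_le : s.peak ≤ P.base + 17 * b

theorem TreeState.agree {u : ℕ → ℕ} {b m : ℕ} {s s' : State 64} (h : TreeState P u b s)
    (hA : Agree m s.reg s'.reg) (hm : 15 ≤ m) (hmem : ∀ a < P.base, s'.mem a = s.mem a)
    (hpk : s'.peak ≤ P.base + 17 * b) : TreeState P u b s' :=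
  ⟨h.regs.agree (hA.mono (by omega)), (hA 2 (by simp; omega)).trans h.reg2,
    (hA 14 (by simp; omega)).trans h.reg14, h.tables.congr hmem, hpk⟩

/-- Decide the match at the node in register `20`. -/
def fixCmd (κ : ℕ) : Cmd 64 :=
  (.load 26 (°14 +ₑ (°20 +ₑ °20)) ;; .load 27 (°14 +ₑ (°20 +ₑ °20) +ₑ ♯1)) ;;
  .ite (°26)
    (.ite (°27)
      (.arg 30 (♯3 +ₑ °26) ;; .arg 31 (♯3 +ₑ °27) ;; lcpCmd κ ;; .text 28 (°30 +ₑ °32) ;;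
        .text 29 (°31 +ₑ °32) ;; .set 28 (°28 <ₑ °29))
      (.set 28 (♯1)))
    (.set 28 (♯0)) ;;
  .ite (°28) (.store (°14 +ₑ °20) (°26)) (.store (°14 +ₑ °20) (°27))

theorem TreeSetup.text_mod {u : ℕ → ℕ} {b : ℕ} (hS : TreeSetup P x u b) (i : ℕ) :
    P.T.getD i 0 % 2 ^ P.w = P.T.getD i 0 := by
  refine mod_two_pow (lt_of_le_of_lt (hS.ok.getD_le i) (lt_of_le_of_lt ?_ hS.ok.w₁))
  have := hS.ok.σ_pos
  have := hS.ok.p_gt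
  exact Nat.le_mul_of_pos_left _ (by positivity)

set_option maxHeartbeats 1000000 in
theorem wp_fixCmd {u : ℕ → ℕ} {b v : ℕ} (hS : TreeSetup P x u b) {Q : State 64 → Prop}
    {s : State 64} (hs : TreeState P u b s) (h20 : s.reg 20 = v) (hv : 1 ≤ v) (hvb : v < b)
    (hl : s.mem (P.base + 2 * v) ≤ b) (hr : s.mem (P.base + (2 * v + 1)) ≤ b)
    (hQ : ∀ s', TreeState P u b s' → Agree 26 s.reg s'.reg →
      s'.mem = Function.update s.mem (P.base + v) (best (P.Less u x) (s.mem (P.base + 2 * v))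
        (s.mem (P.base + (2 * v + 1)))) → s'.out = s.out →
      s'.time ≤ s.time + P.lcpTime + 120 → Q s') :
    wp P.w P.T x (fixCmd P.κ) Q s := by
  -- The common end of all cases: `a` is the outcome of the comparison, `c` the winner to be stored.
  have fin : ∀ ρ μ o t pk a c, P.Regs ρ → μ = s.mem → o = s.out → Agree 26 s.reg ρ →
      ρ 26 = s.mem (P.base + 2 * v) → ρ 27 = s.mem (P.base + (2 * v + 1)) → (ρ 28 = a) →
      (best (P.Less u x) (s.mem (P.base + 2 * v)) (s.mem (P.base + (2 * v + 1))) = c) →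
      (c = if a = 0 then ρ 27 else ρ 26) → t ≤ s.time + P.lcpTime + 100 →
      pk ≤ P.base + 17 * b →
      wp P.w P.T x (.ite (°28) (.store (°14 +ₑ °20) (°26)) (.store (°14 +ₑ °20) (°27))) Q
        ⟨ρ, μ, o, t, pk⟩ := by
    rintro ρ μ o t pk a c hR rfl rfl hA e₁ e₂ h28 hc hca ht hpk
    have h14 := (hA 14 (by decide)).trans hs.reg14
    have h20' := (hA 20 (by decide)).trans h20
    have hsm := hS.small
    simp only [wp, Expr.eval, Op.eval, Expr.cost, h28, h14, h20']
    simp (disch := omega) only [mod_two_pow]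
    have upd : ∀ y, ∀ a < P.base, Function.update s.mem (P.base + v) y a = s.mem a := fun y a ha =>
      Function.update_of_ne (by omega) _ _
    split_ifs with h0
    · rw [if_pos h0] at hca
      refine hQ _ (hs.agree hA (by norm_num) (upd _) (by dsimp only; omega)) hA ?_ rfl
        (by dsimp only; omega)
      rw [← hca, hc]
    · rw [if_neg h0] at hca
      refine hQ _ (hs.agree hA (by norm_num) (upd _) (by dsimp only; omega)) hA ?_ rfl
        (by dsimp only; omega)
      rw [← hca, hc]
  obtain ⟨ρ, μ, o, τ, pk⟩ := s
  obtain ⟨hR, h2, h14, hM, hpk⟩ := hs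
  dsimp only at *
  have hsm := hS.small
  have w₄ := hS.ok.w₄
  have hA₂ : ∀ a c, Agree 26 ρ (Function.update (Function.update ρ 26 a) 27 c) := by
    intro a c
    repeat' refine Agree.update ?_ (by decide) _
    exact Agree.refl _ _
  rw [fixCmd, wp]
  simp only [wp.eq_9, wp.eq_3, Expr.eval, Op.eval, Expr.cost, Function.update_apply, Fin.reduceEq,
    if_true, if_false, h14, h20]
  rw [show v + v = 2 * v by omega]
  simp (disch := omega) only [mod_two_pow, Nat.add_assoc]
  generalize hm₁ : μ (P.base + 2 * v) = m₁ at *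
  generalize hm₂ : μ (P.base + (2 * v + 1)) = m₂ at *
  rw [wp.eq_10]
  simp only [Expr.eval, Expr.cost, Function.update_apply, Fin.reduceEq, if_true, if_false]
  by_cases h₁ : m₁ = 0
  · rw [if_pos h₁, wp]
    simp only [Expr.eval, Expr.cost]
    refine fin _ _ _ _ _ 0 m₂ (hR.agree ?_) rfl rfl ((hA₂ _ _).update (by decide) _)
      (by simp) (by simp) (by simp) (by simp [best, h₁]) (by simp) (by omega) (by omega)
    exact ((hA₂ _ _).update (by decide) _).mono (by norm_num)
  rw [if_neg h₁, wp.eq_10]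
  simp only [Expr.eval, Expr.cost, Function.update_apply, Fin.reduceEq, if_true, if_false]
  by_cases h₂ : m₂ = 0
  · rw [if_pos h₂, wp]
    simp only [Expr.eval, Expr.cost]
    refine fin _ _ _ _ _ 1 m₁ (hR.agree ?_) rfl rfl ((hA₂ _ _).update (by decide) _)
      (by simp) (by simp) ?_ (by simp [best, h₁, h₂]) (by simp) (by omega) (by omega)
    · exact ((hA₂ _ _).update (by decide) _).mono (by norm_num)
    · simp (disch := omega) only [mod_two_pow, Function.update_self]
  rw [if_neg h₂]
  have p₁ := hS.pos_lt (m₁ - 1) (by omega)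
  have p₂ := hS.pos_lt (m₂ - 1) (by omega)
  rw [show 4 + (m₁ - 1) = 3 + m₁ by omega] at p₁
  rw [show 4 + (m₂ - 1) = 3 + m₂ by omega] at p₂
  simp only [wp.eq_9, wp.eq_6, wp.eq_5, wp.eq_2, Expr.eval, Op.eval, Expr.cost,
    Function.update_apply, Fin.reduceEq, if_true, if_false]
  have hbw : 3 + m₁ < 2 ^ P.w := by omega
  have hbw' : 3 + m₂ < 2 ^ P.w := by omega
  rw [mod_two_pow (a := 3) (by omega), mod_two_pow hbw, mod_two_pow hbw']
  have hless : P.Less u x m₁ m₂ ↔ LessAt P.T (P.lcp u (x.getD (3 + m₁) 0) (x.getD (3 + m₂) 0))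
    (x.getD (3 + m₁) 0) (x.getD (3 + m₂) 0) := Iff.rfl
  have hll := P.lcp_le u (x.getD (3 + m₁) 0) (x.getD (3 + m₂) 0)
  generalize x.getD (3 + m₁) 0 = I at *
  generalize x.getD (3 + m₂) 0 = J at *
  rw [mod_two_pow (a := I) (by omega), mod_two_pow (a := J) (by omega)]
  have hA₃ : Agree 26 ρ (Function.update (Function.update (Function.update (Function.update ρ 26 m₁)
      27 m₂) 30 I) 31 J) := by
    repeat' refine Agree.update ?_ (by decide) _
    exact Agree.refl _ _
  refine wp_lcpCmd hS.ok (u := u) (I := I) (J := J) (B := P.base + 17 * b)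
    (hR.agree (hA₃.mono (by norm_num))) hS.seeds hM (by simp) (by simp) p₁ p₂ (by dsimp only; omega)
    (by unfold Par.base; omega) ?_
  intro ρ₂ t₂ pk₂ ht₂ hpk₂ hA₄ h32
  dsimp only at *
  have a30 : ρ₂ 30 = I := by simpa using hA₄ 30 (by decide)
  have a31 : ρ₂ 31 = J := by simpa using hA₄ 31 (by decide)
  have a26 : ρ₂ 26 = m₁ := by simpa using hA₄ 26 (by decide)
  have a27 : ρ₂ 27 = m₂ := by simpa using hA₄ 27 (by decide)
  simp only [wp.eq_9, wp.eq_5, wp.eq_2, Expr.eval, Op.eval, Expr.cost, Function.update_apply,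
    Fin.reduceEq, if_true, if_false, a30, a31, h32]
  simp (disch := omega) only [mod_two_pow, hS.text_mod]
  have hA₅ := hA₃.trans (hA₄.mono (by norm_num : 26 ≤ 32))
  refine fin _ _ _ _ _ _ (if P.Less u x m₁ m₂ then m₁ else m₂) (hR.agree ?_) rfl rfl ?_
    (by simp [a26]) (by simp [a27]) (Function.update_self _ _ _) ?_ ?_ (by omega) hpk₂
  · repeat' refine Agree.update ?_ (by decide) _
    exact hA₅.mono (by norm_num)
  · repeat' refine Agree.update ?_ (by decide) _
    exact hA₅
  · simp [best, h₁, h₂]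
  · simp only [Function.update_apply, Fin.reduceEq, if_false, bit_eq_zero, a26, a27, hless, LessAt,
      ite_not]

/-- The tournament in the memory `μ`. -/
def Par.players (P : Par) (μ : ℕ → ℕ) (v : ℕ) : ℕ := μ (P.base + v)

theorem Par.players_update (P : Par) (μ : ℕ → ℕ) (v y : ℕ) :
    P.players (Function.update μ (P.base + v) y) = Function.update (P.players μ) v y := by
  funext v'
  simp [Par.players, Function.update_apply]

theorem best_le {less : ℕ → ℕ → Prop} [DecidableRel less] {a c b : ℕ} (ha : a ≤ b) (hc : c ≤ b) :
    best less a c ≤ b := by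
  unfold best; split_ifs <;> assumption

/-- The tournament among the players in `D` takes place in memory, and all matches except the one
at `v` have been decided. -/
structure Tour (P : Par) (u : ℕ → ℕ) (x : List ℕ) (b : ℕ) (D : ℕ → Prop) (v : ℕ) (μ : ℕ → ℕ) :
    Prop where
  cons : ConsistentExcept (P.Less u x) b (P.players μ) v
  leaves : Leaves b (P.players μ) D
  le : ∀ v, 1 ≤ v → v < 2 * b → P.players μ v ≤ b

theorem Tour.congr {u : ℕ → ℕ} {b v : ℕ} {D : ℕ → Prop} {μ μ' : ℕ → ℕ} (h : Tour P u x b D v μ)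
    (hμ : ∀ v, 1 ≤ v → v < 2 * b → μ' (P.base + v) = μ (P.base + v)) : Tour P u x b D v μ' := by
  refine ⟨fun v' h1 h2 h3 => ?_, fun i hi => ?_, fun v' h1 h2 => ?_⟩
  · have := h.cons v' h1 h2 h3
    simp only [Par.players] at this ⊢
    rw [hμ _ (by omega) (by omega), hμ _ (by omega) (by omega), hμ _ (by omega) (by omega), this]
  · have := h.leaves i hi
    simp only [Par.players] at this ⊢
    rw [hμ _ (by omega) (by omega)]
    exact this
  · have := h.le v' h1 h2
    simp only [Par.players] at this ⊢
    rw [hμ _ (by omega) (by omega)]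
    exact this

/-- Bring all players into their initial positions and decide all matches. -/
def initCmd (κ : ℕ) : Cmd 64 :=
  (.set 20 (♯0) ;; .loop (°20 <ₑ °2) (.store (°14 +ₑ (°2 +ₑ °20)) (°20 +ₑ ♯1) ;;
    .set 20 (°20 +ₑ ♯1))) ;;
  .set 20 (°2 -ₑ ♯1) ;; .loop (°20) (fixCmd κ ;; .set 20 (°20 -ₑ ♯1))

theorem wp_initCmd {u : ℕ → ℕ} {b : ℕ} (hS : TreeSetup P x u b) {Q : State 64 → Prop}
    {s : State 64} (hs : TreeState P u b s)
    (hQ : ∀ s', TreeState P u b s' → Agree 20 s.reg s'.reg →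
      Tour P u x b (fun _ => True) 0 s'.mem → s'.out = s.out →
      s'.time ≤ s.time + 30 + b * (P.lcpTime + 170) → Q s') :
    wp P.w P.T x (initCmd P.κ) Q s := by
  have hsm := hS.small
  have hb := hS.two_le
  have hc : Expr.cost (k := 64) (°20 <ₑ °2) = 3 := rfl
  have hc' : Expr.cost (k := 64) (°20) = 1 := rfl
  rw [initCmd, wp]
  simp only [wp.eq_9, wp.eq_2, Expr.eval, Expr.cost]
  simp (disch := omega) only [mod_two_pow]
  refine wp_for b (fun i s' => TreeState P u b s' ∧ Agree 20 s.reg s'.reg ∧ s'.reg 20 = i ∧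
    (∀ i' < i, s'.mem (P.base + (b + i')) = i' + 1) ∧ s'.out = s.out ∧
    s'.time ≤ s.time + 10 + i * 20) ?_ ?_ ?_ ?_
  · rintro i s' hi ⟨hs', hA, h20, -⟩
    simp only [Expr.eval, Op.eval, h20, hs'.reg2]
    rw [bit_eq_zero]
    omega
  · rintro i s' hi ⟨hs', hA, h20, hm, ho, ht⟩
    simp only [wp, Expr.eval, Op.eval, Expr.cost, h20, hs'.reg2, hs'.reg14]
    simp (disch := omega) only [mod_two_pow]
    have hpk := hs'.peak_le
    refine ⟨⟨?_, ?_, ?_, ?_, ?_⟩, hA.update (by decide) _, by simp, ?_, ho, ?_⟩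
    · exact hs'.regs.agree ((Agree.refl _ _).update (by decide) _)
    · simpa using hs'.reg2
    · simpa using hs'.reg14
    · exact hs'.tables.congr fun a ha => Function.update_of_ne (by
        unfold Par.base; omega) _ _
    · dsimp only
      omega
    · intro i' hi'
      rw [Function.update_apply]
      split_ifs with h
      · omega
      · exact hm i' (by omega)
    · omega
  · rintro s₁ ⟨hs₁, hA₁, -, hm₁, ho₁, ht₁⟩
    have hle : 1 ≤ b := by omega
    simp only [wp.eq_9, wp.eq_2, Expr.eval, Op.eval, Expr.cost, hs₁.reg2]
    simp (disch := omega) only [mod_two_pow]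
    -- Matches are decided from `b - 1` down to `1`, so both children of the current one have their
    -- final values. That these are at most `b` keeps the reading of positions within the input
    -- list.
    refine wp_for (b - 1) (fun i s' => TreeState P u b s' ∧ Agree 20 s.reg s'.reg ∧
      s'.reg 20 = b - 1 - i ∧ Leaves b (P.players s'.mem) (fun _ => True) ∧
      (∀ v, b - 1 - i < v → v < b → P.players s'.mem v = best (P.Less u x)
        (P.players s'.mem (2 * v)) (P.players s'.mem (2 * v + 1))) ∧
      (∀ v, b - 1 - i < v → v < 2 * b → P.players s'.mem v ≤ b) ∧
      s'.out = s.out ∧ s'.time ≤ s.time + 25 + b * 20 + i * (P.lcpTime + 150)) ?_ ?_ ?_ ?_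
    · rintro i s' hi ⟨hs', hA, h20, -⟩
      simp only [Expr.eval, h20]
      omega
    · rintro i s' hi ⟨hs', hA, h20, hL, hcons, hle', ho, ht⟩
      rw [wp]
      refine wp_fixCmd hS (v := b - 1 - i) ⟨hs'.regs, hs'.reg2, hs'.reg14, hs'.tables, hs'.peak_le⟩
        h20 (by omega) (by omega) (hle' _ (by omega) (by omega)) (hle' _ (by omega) (by omega)) ?_
      intro s₂ hs₂ hA₂ hm₂ ho₂ ht₂
      dsimp only at *
      have a20 := (hA₂ 20 (by decide)).trans h20
      have hpl : P.players s₂.mem = Function.update (P.players s'.mem) (b - 1 - i) (best (P.Less u x)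
          (P.players s'.mem (2 * (b - 1 - i))) (P.players s'.mem (2 * (b - 1 - i) + 1))) := by
        rw [hm₂, Par.players_update]; rfl
      simp only [wp, Expr.eval, Op.eval, Expr.cost, a20]
      simp (disch := omega) only [mod_two_pow]
      have h₁ := hle' (2 * (b - 1 - i)) (by omega) (by omega)
      have h₂ := hle' (2 * (b - 1 - i) + 1) (by omega) (by omega)
      refine ⟨⟨?_, ?_, ?_, hs₂.tables, hs₂.peak_le⟩, ?_, ?_, ?_, ?_, ?_, ho₂.trans ho, ?_⟩
      · exact hs₂.regs.agree ((Agree.refl _ _).update (by decide) _)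
      · simpa using hs₂.reg2
      · simpa using hs₂.reg14
      · exact (hA.trans (hA₂.mono (by norm_num))).update (by decide) _
      · rw [Function.update_self]
        omega
      · rw [hpl]
        exact hL.update (by omega)
      · intro v hv hvb
        rw [hpl]
        rw [Function.update_of_ne (show 2 * v ≠ b - 1 - i by omega),
          Function.update_of_ne (show 2 * v + 1 ≠ b - 1 - i by omega), Function.update_apply]
        split_ifs with h
        · rw [h]
        · exact hcons v (by omega) hvb
      · intro v hv hvb
        rw [hpl, Function.update_apply]
        split_ifs with h
        · exact best_le h₁ h₂
        · exact hle' v (by omega) hvb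
      · rw [Nat.add_mul i 1]
        omega
    · rintro s' ⟨hs', hA, h20, hL, hcons, hle', ho, ht⟩
      refine hQ _ ⟨hs'.regs, hs'.reg2, hs'.reg14, hs'.tables, hs'.peak_le⟩ hA
        ⟨fun v h1 h2 _ => hcons v (by omega) h2, hL, fun v h1 h2 => hle' v (by omega) h2⟩ ho ?_
      have : (b - 1) * (P.lcpTime + 150) ≤ b * (P.lcpTime + 150) :=
        Nat.mul_le_mul_right _ (by omega)
      simp only [Nat.mul_add] at *
      omega
    · have hL : Leaves b (P.players s₁.mem) (fun _ => True) :=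
        fun i hi => ⟨fun _ => hm₁ i hi, fun h => absurd trivial h⟩
      refine ⟨⟨?_, ?_, ?_, hs₁.tables, hs₁.peak_le⟩, ?_, by simp, hL, by omega, ?_, ho₁, ?_⟩
      · exact hs₁.regs.agree ((Agree.refl _ _).update (by decide) _)
      · simpa using hs₁.reg2
      · simpa using hs₁.reg14
      · exact hA₁.update (by decide) _
      · intro v hv hvb
        obtain ⟨i, rfl⟩ := Nat.exists_eq_add_of_le (show b ≤ v by omega)
        rw [(hL i (by omega)).1 trivial]
        omega
      · dsimp only
        omega
  · refine ⟨⟨?_, ?_, ?_, hs.tables, hs.peak_le⟩, ?_, by simp, by omega, rfl, ?_⟩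
    · exact hs.regs.agree ((Agree.refl _ _).update (by decide) _)
    · simpa using hs.reg2
    · simpa using hs.reg14
    · exact (Agree.refl _ _).update (by decide) _
    · dsimp only
      omega

/-- Remove the player in register `21`. -/
def removeCmd (κ : ℕ) : Cmd 64 :=
  .store (°14 +ₑ (°2 +ₑ °21 -ₑ ♯1)) (♯0) ;; .set 20 ((°2 +ₑ °21 -ₑ ♯1) /ₑ ♯2) ;;
  .loop (°20) (fixCmd κ ;; .set 20 (°20 /ₑ ♯2))

/-- Only the matches between the removed leaf and the root are affected, at most `log₂ b + 1` of
them. Register `25`, not covered by `Agree 20`, is mentioned because it contains the position of the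
extracted suffix. -/
theorem wp_removeCmd {u : ℕ → ℕ} {b i : ℕ} {D : ℕ → Prop} (hS : TreeSetup P x u b)
    {Q : State 64 → Prop} {s : State 64} (hs : TreeState P u b s) (hT : Tour P u x b D 0 s.mem)
    (hi : i < b) (h21 : s.reg 21 = i + 1)
    (hQ : ∀ s', TreeState P u b s' → Agree 20 s.reg s'.reg → s'.reg 25 = s.reg 25 →
      Tour P u x b (fun k => D k ∧ k ≠ i) 0 s'.mem →
      (∀ a, P.base + 2 * b ≤ a → s'.mem a = s.mem a) → s'.out = s.out →
      s'.time ≤ s.time + 40 + (Nat.log 2 b + 1) * (P.lcpTime + 150) → Q s') :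
    wp P.w P.T x (removeCmd P.κ) Q s := by
  have hsm := hS.small
  have hb := hS.two_le
  have hpk := hs.peak_le
  have hc' : Expr.cost (k := 64) (°20) = 1 := rfl
  rw [removeCmd]
  simp only [wp.eq_9, wp.eq_2, wp.eq_4, Expr.eval, Op.eval, Expr.cost, hs.reg2, hs.reg14, h21]
  simp (disch := omega) only [mod_two_pow]
  rw [show b + (i + 1) - 1 = b + i by omega]
  -- The one undecided match is at the node in register `20`, which moves to its parent in each
  -- round; at `0` the tournament is consistent again.
  refine wp_while (fun m s' => TreeState P u b s' ∧ Agree 20 s.reg s'.reg ∧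
    s'.reg 25 = s.reg 25 ∧ s'.reg 20 < 2 ^ m ∧ s'.reg 20 < b ∧
    Tour P u x b (fun k => D k ∧ k ≠ i) (s'.reg 20) s'.mem ∧
    (∀ a, P.base + 2 * b ≤ a → s'.mem a = s.mem a) ∧ s'.out = s.out ∧
    s'.time + m * (P.lcpTime + 150) ≤ s.time + 35 + (Nat.log 2 b + 1) * (P.lcpTime + 150))
    (m := Nat.log 2 b + 1) ?_ ?_ ?_
  · rintro m s' ⟨hs', hA, h25, hm, hvb, hT', hmem, ho, ht⟩ h0
    simp only [Expr.eval] at h0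
    have hm0 : m ≠ 0 := by
      rintro rfl
      simp at hm
      exact h0 hm
    obtain ⟨m, rfl⟩ := Nat.exists_eq_succ_of_ne_zero hm0
    generalize hv : s'.reg 20 = v at *
    rw [wp]
    have h₁ := hT'.le (2 * v) (by omega) (by omega)
    have h₂ := hT'.le (2 * v + 1) (by omega) (by omega)
    refine wp_fixCmd hS (v := v) ⟨hs'.regs, hs'.reg2, hs'.reg14, hs'.tables, hs'.peak_le⟩
      hv (by omega) (by omega) h₁ h₂ ?_
    intro s₂ hs₂ hA₂ hm₂ ho₂ ht₂
    dsimp only at *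
    have a20 := (hA₂ 20 (by decide)).trans hv
    have hpl : P.players s₂.mem = Function.update (P.players s'.mem) v (best (P.Less u x)
          (P.players s'.mem (2 * v)) (P.players s'.mem (2 * v + 1))) := by
      rw [hm₂, Par.players_update]; rfl
    simp only [wp, Expr.eval, Op.eval, Expr.cost, a20]
    simp (disch := omega) only [mod_two_pow]
    refine ⟨m, by omega, ⟨?_, ?_, ?_, hs₂.tables, hs₂.peak_le⟩, ?_, ?_, ?_, ?_, ?_, ?_,
      ho₂.trans ho, ?_⟩
    · exact hs₂.regs.agree ((Agree.refl _ _).update (by decide) _)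
    · simpa using hs₂.reg2
    · simpa using hs₂.reg14
    · exact (hA.trans (hA₂.mono (by norm_num))).update (by decide) _
    · simpa using (hA₂ 25 (by decide)).trans h25
    · rw [Function.update_self]
      rw [pow_succ] at hm
      omega
    · rw [Function.update_self]
      omega
    · rw [Function.update_self]
      refine ⟨?_, ?_, ?_⟩
      · rw [hpl]
        exact hT'.cons.update
      · rw [hpl]
        exact hT'.leaves.update (by omega)
      · intro v' h1 h2
        rw [hpl, Function.update_apply]
        split_ifs with h
        · exact best_le h₁ h₂
        · exact hT'.le v' h1 h2
    · intro a ha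
      rw [hm₂, Function.update_of_ne (by omega)]
      exact hmem a ha
    · rw [Nat.succ_mul] at ht
      omega
  · rintro m s' ⟨hs', hA, h25, hm, hvb, hT', hmem, ho, ht⟩ h0
    simp only [Expr.eval] at h0
    rw [h0] at hT'
    exact hQ _ ⟨hs'.regs, hs'.reg2, hs'.reg14, hs'.tables, hs'.peak_le⟩ hA h25 hT' hmem ho
      (by dsimp only; omega)
  · have hlog : b < 2 ^ (Nat.log 2 b + 1) := Nat.lt_pow_succ_log_self (by norm_num) b
    refine ⟨⟨?_, ?_, ?_, ?_, ?_⟩, ?_, by simp, ?_, ?_, ?_, ?_, rfl, ?_⟩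
    · exact hs.regs.agree ((Agree.refl _ _).update (by decide) _)
    · simpa using hs.reg2
    · simpa using hs.reg14
    · exact hs.tables.congr fun a ha => Function.update_of_ne (by
        unfold Par.base; omega) _ _
    · dsimp only
      omega
    · exact (Agree.refl _ _).update (by decide) _
    · dsimp only
      rw [Function.update_self]
      omega
    · dsimp only
      rw [Function.update_self]
      omega
    · dsimp only
      rw [Function.update_self]
      refine ⟨?_, ?_, ?_⟩
      · intro v' h1 h2 h3
        rw [Par.players_update, Function.update_of_ne (by omega), Function.update_of_ne (by omega),
          Function.update_of_ne (by omega)]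
        exact hT.cons v' h1 h2 (by omega)
      · intro k hk
        rw [Par.players_update, Function.update_apply]
        split_ifs with h
        · obtain rfl : k = i := by omega
          exact ⟨fun h => absurd rfl h.2, fun _ => rfl⟩
        · have := hT.leaves k hk
          have hki : k ≠ i := fun h' => h (by rw [h'])
          simpa [hki] using this
      · intro v' h1 h2
        rw [Par.players_update, Function.update_apply]
        split_ifs with h
        · omega
        · exact hT.le v' h1 h2
    · intro a ha
      exact Function.update_of_ne (by omega) _ _
    · dsimp only
      omega

/-! ### The trie on the machine -/

/-- The trie `S` is stored in the memory `μ`, its nodes from the address `N` on and its stack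
from the address `M` on. -/
structure HoldsTrie (N M : ℕ) (S : Trie) (μ : ℕ → ℕ) : Prop where
  parent : ∀ k < S.count, μ (N + 4 * k) = (S.node k).parent
  start : ∀ k < S.count, μ (N + 4 * k + 1) = (S.node k).start
  len : ∀ k < S.count, μ (N + 4 * k + 2) = (S.node k).len
  mark : ∀ k < S.count, μ (N + 4 * k + 3) = (S.node k).mark
  stk : ∀ i ≤ S.sp, μ (M + 2 * i) = S.stk i
  dep : ∀ i ≤ S.sp, μ (M + 2 * i + 1) = S.dep i

theorem HoldsTrie.congr {N M : ℕ} {S : Trie} {μ μ' : ℕ → ℕ} (h : HoldsTrie N M S μ)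
    (hNM : N ≤ M) (hμ : ∀ a, N ≤ a → μ' a = μ a) : HoldsTrie N M S μ' := by
  obtain ⟨h1, h2, h3, h4, h5, h6⟩ := h
  constructor
  · intro k hk; rw [hμ _ (by omega), h1 k hk]
  · intro k hk; rw [hμ _ (by omega), h2 k hk]
  · intro k hk; rw [hμ _ (by omega), h3 k hk]
  · intro k hk; rw [hμ _ (by omega), h4 k hk]
  · intro k hk; rw [hμ _ (by omega), h5 k hk]
  · intro k hk; rw [hμ _ (by omega), h6 k hk]

set_option maxHeartbeats 1000000 in
theorem HoldsTrie.addLeaf {N M n s l j : ℕ} {S : Trie} {μ : ℕ → ℕ} (h : HoldsTrie N M S μ)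
    (hj : j ≤ S.sp) (hNM : N + 4 * S.count + 4 ≤ M) :
    HoldsTrie N M (S.addLeaf n s l j) (Function.update (Function.update (Function.update
      (Function.update (Function.update (Function.update μ (N + 4 * S.count) (S.stk j))
        (N + 4 * S.count + 1) (s + l)) (N + 4 * S.count + 2) (n - (s + l)))
        (N + 4 * S.count + 3) (s + 1)) (M + 2 * (j + 1)) S.count)
        (M + 2 * (j + 1) + 1) (n - s)) := by
  obtain ⟨h1, h2, h3, h4, h5, h6⟩ := h
  constructor
  case stk =>
    intro i hi
    simp only [Trie.addLeaf] at hi ⊢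
    by_cases hij : i = j + 1
    · subst hij
      simp (disch := omega) only [Function.update_apply, if_neg, if_pos, if_true]
    · simp (disch := omega) only [Function.update_apply, if_neg, if_pos, if_true]
      exact h5 i (by omega)
  case dep =>
    intro i hi
    simp only [Trie.addLeaf] at hi ⊢
    by_cases hij : i = j + 1
    · subst hij
      simp (disch := omega) only [Function.update_apply, if_neg, if_pos, if_true]
    · simp (disch := omega) only [Function.update_apply, if_neg, if_pos, if_true]
      exact h6 i (by omega)
  all_goals
    intro k hk
    simp only [Trie.addLeaf] at hk ⊢
    by_cases hkc : k = S.count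
    · subst hkc
      simp (disch := omega) only [Function.update_apply, if_neg, if_pos, if_true]
    · have hk' : k < S.count := by omega
      simp (disch := omega) only [Function.update_apply, if_neg, if_pos, if_true, h1 k hk', h2 k hk',
        h3 k hk', h4 k hk']

set_option maxHeartbeats 1000000 in
theorem HoldsTrie.split {N M s l j c : ℕ} {S : Trie} {μ : ℕ → ℕ} (h : HoldsTrie N M S μ)
    (hj : j < S.sp) (hNM : N + 4 * S.count + 4 ≤ M) (hc : S.stk (j + 1) = c) (hx : c < S.count) :
    HoldsTrie N M (S.split s l j) (Function.update (Function.update (Function.update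
      (Function.update (Function.update (Function.update (Function.update (Function.update
        (Function.update μ (N + 4 * S.count) (S.stk j))
        (N + 4 * S.count + 1) (s + S.dep j)) (N + 4 * S.count + 2) (l - S.dep j))
        (N + 4 * S.count + 3) 0) (N + 4 * c) S.count) (N + 4 * c + 1) (S.prev + l))
        (N + 4 * c + 2) (S.dep (j + 1) - l))
        (M + 2 * (j + 1)) S.count) (M + 2 * (j + 1) + 1) l) := by
  obtain ⟨h1, h2, h3, h4, h5, h6⟩ := h
  constructor
  case stk =>
    intro i hi
    simp only [Trie.split] at hi ⊢
    by_cases hij : i = j + 1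
    · subst hij
      simp (disch := omega) only [Function.update_apply, if_neg, if_pos, if_true]
    · simp (disch := omega) only [Function.update_apply, if_neg, if_pos, if_true]
      exact h5 i (by omega)
  case dep =>
    intro i hi
    simp only [Trie.split] at hi ⊢
    by_cases hij : i = j + 1
    · subst hij
      simp (disch := omega) only [Function.update_apply, if_neg, if_pos, if_true]
    · simp (disch := omega) only [Function.update_apply, if_neg, if_pos, if_true]
      exact h6 i (by omega)
  all_goals
    intro k hk
    simp only [Trie.split, hc] at hk ⊢
    by_cases hkc : k = S.count
    · subst hkc
      simp (disch := omega) only [Function.update_apply, if_neg, if_pos, if_true]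
    · have hk' : k < S.count := by omega
      by_cases hkx : k = c
      · subst hkx
        simp (disch := omega) only [Function.update_apply, if_neg, if_pos, if_true, h4 k hk']
      · simp (disch := omega) only [Function.update_apply, if_neg, if_pos, if_true, h1 k hk', h2 k hk',
          h3 k hk', h4 k hk']

/-- The trie `S` is stored in the memory. -/
structure TrieState (P : Par) (b : ℕ) (S : Trie) (j : ℕ) (s : State 64) : Prop where
  reg15 : s.reg 15 = P.base + 2 * b
  reg16 : s.reg 16 = P.base + (10 * b + 4)
  reg17 : s.reg 17 = j
  reg18 : s.reg 18 = S.count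
  reg19 : s.reg 19 = S.prev
  holds : HoldsTrie (P.base + 2 * b) (P.base + (10 * b + 4)) S s.mem

def popCmd : Cmd 64 :=
  .load 26 (°16 +ₑ ♯2 *ₑ °17 +ₑ ♯1) ;; .loop (°24 <ₑ °26)
    (.set 17 (°17 -ₑ ♯1) ;; .load 26 (°16 +ₑ ♯2 *ₑ °17 +ₑ ♯1))

def splitCmd : Cmd 64 :=
  .load 28 (°16 +ₑ ♯2 *ₑ (°17 +ₑ ♯1)) ;; .load 29 (°16 +ₑ ♯2 *ₑ (°17 +ₑ ♯1) +ₑ ♯1) ;;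
  .store (°15 +ₑ ♯4 *ₑ °18) (°27) ;; .store (°15 +ₑ ♯4 *ₑ °18 +ₑ ♯1) (°25 +ₑ °26) ;;
  .store (°15 +ₑ ♯4 *ₑ °18 +ₑ ♯2) (°24 -ₑ °26) ;; .store (°15 +ₑ ♯4 *ₑ °18 +ₑ ♯3) (♯0) ;;
  .store (°15 +ₑ ♯4 *ₑ °28) (°18) ;; .store (°15 +ₑ ♯4 *ₑ °28 +ₑ ♯1) (°19 +ₑ °24) ;;
  .store (°15 +ₑ ♯4 *ₑ °28 +ₑ ♯2) (°29 -ₑ °24) ;;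
  .store (°16 +ₑ ♯2 *ₑ (°17 +ₑ ♯1)) (°18) ;; .store (°16 +ₑ ♯2 *ₑ (°17 +ₑ ♯1) +ₑ ♯1) (°24) ;;
  .set 17 (°17 +ₑ ♯1) ;; .set 27 (°18) ;; .set 18 (°18 +ₑ ♯1)

def leafCmd : Cmd 64 :=
  .store (°15 +ₑ ♯4 *ₑ °18) (°27) ;; .store (°15 +ₑ ♯4 *ₑ °18 +ₑ ♯1) (°25 +ₑ °24) ;;
  .store (°15 +ₑ ♯4 *ₑ °18 +ₑ ♯2) (°0 -ₑ (°25 +ₑ °24)) ;;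
  .store (°15 +ₑ ♯4 *ₑ °18 +ₑ ♯3) (°25 +ₑ ♯1) ;;
  .store (°16 +ₑ ♯2 *ₑ (°17 +ₑ ♯1)) (°18) ;;
  .store (°16 +ₑ ♯2 *ₑ (°17 +ₑ ♯1) +ₑ ♯1) (°0 -ₑ °25) ;;
  .set 17 (°17 +ₑ ♯1) ;; .set 18 (°18 +ₑ ♯1) ;; .set 19 (°25)

/-- Insert the suffix at `ρ 25` whose longest common prefix with the previous suffix has
length `ρ 24`. -/
def insertCmd : Cmd 64 :=
  popCmd ;; .load 27 (°16 +ₑ ♯2 *ₑ °17) ;; (.ite (°26 <ₑ °24) splitCmd .skip ;; leafCmd)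

/-- The time bound is amortized, with the potential `20` per stack entry: each popped entry pays for
its own round. -/
theorem wp_popCmd {u : ℕ → ℕ} {b l : ℕ} {S : Trie} (hS : TreeSetup P x u b) {Q : State 64 → Prop}
    {s : State 64} (hs : TreeState P u b s) (ht : TrieState P b S S.sp s) (hsp : S.sp ≤ 2 * b)
    (h0 : S.dep 0 = 0) (h24 : s.reg 24 = l)
    (hQ : ∀ ρ t pk, Agree 17 s.reg ρ → ρ 17 = pop S.dep l S.sp →
      (∀ r : Fin 64, 18 ≤ r → r < 26 → ρ r = s.reg r) → ρ 26 = S.dep (pop S.dep l S.sp) →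
      t + 20 * pop S.dep l S.sp ≤ s.time + 20 * S.sp + 20 → pk ≤ P.base + 17 * b →
      Q ⟨ρ, s.mem, s.out, t, pk⟩) :
    wp P.w P.T x popCmd Q s := by
  obtain ⟨ρ, μ, o, τ, pk⟩ := s
  obtain ⟨h15, h16, h17, h18, h19, hh⟩ := ht
  have hpk := hs.peak_le
  have hsm := hS.small
  have hb := hS.two_le
  dsimp only at *
  have hc : Expr.cost (k := 64) (°24 <ₑ °26) = 3 := rfl
  have hdep : ∀ i ≤ S.sp, μ (P.base + (10 * b + 4) + (2 * i + 1)) = S.dep i := fun i hi => by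
    rw [← hh.dep i hi]; congr 1
  simp only [popCmd, wp.eq_9, wp.eq_3, Expr.eval, Op.eval, Expr.cost, h16, h17]
  simp (disch := omega) only [mod_two_pow, Nat.add_assoc _ (2 * _) 1, hdep]
  refine wp_while (fun m s' => m ≤ S.sp ∧ Agree 17 ρ s'.reg ∧ s'.reg 17 = m ∧
    (∀ r : Fin 64, 18 ≤ r → r < 26 → s'.reg r = ρ r) ∧ s'.reg 26 = S.dep m ∧
    pop S.dep l m = pop S.dep l S.sp ∧ s'.mem = μ ∧ s'.out = o ∧
    s'.time + 20 * m ≤ τ + 20 * S.sp + 12 ∧ s'.peak ≤ P.base + 17 * b) (m := S.sp) ?_ ?_ ?_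
  · rintro m ⟨ρ', μ', o', t', pk'⟩ ⟨hm, hA, e17, hfr, e26, hp, rfl, rfl, ht, hpk'⟩ hne
    dsimp only at *
    have e24 := (hfr 24 (by decide) (by decide)).trans h24
    have e16 := (hA 16 (by decide)).trans h16
    simp only [Expr.eval, Op.eval, e24, e26] at hne
    rw [ne_eq, bit_eq_zero, not_not] at hne
    have hm0 : m ≠ 0 := by
      rintro rfl
      omega
    obtain ⟨m, rfl⟩ := Nat.exists_eq_succ_of_ne_zero hm0
    rw [Nat.succ_eq_add_one] at *
    rw [pop, if_pos hne] at hp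
    simp only [wp, Expr.eval, Op.eval, Expr.cost, Function.update_apply, Fin.reduceEq, if_true,
      if_false, e16, e17]
    simp (disch := omega) only [mod_two_pow, Nat.add_assoc _ (2 * _) 1, Nat.add_sub_cancel, hdep]
    refine ⟨m, by omega, by omega, ?_, by simp, ?_, by simp, hp, by trivial, by trivial, by omega,
      by omega⟩
    · repeat' refine Agree.update ?_ (by decide) _
      exact hA
    · intro r h₁ h₂
      rw [← hfr r h₁ h₂, if_neg (by rintro rfl; exact absurd h₂ (by decide)),
        if_neg (by rintro rfl; exact absurd h₁ (by decide))]
  · rintro m ⟨ρ', μ', o', t', pk'⟩ ⟨hm, hA, e17, hfr, e26, hp, rfl, rfl, ht, hpk'⟩ he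
    dsimp only at *
    have e24 := (hfr 24 (by decide) (by decide)).trans h24
    simp only [Expr.eval, Op.eval, e24, e26] at he
    rw [bit_eq_zero] at he
    have hpm : pop S.dep l m = m := by
      cases m with
      | zero => rfl
      | succ m => rw [pop, if_neg he]
    rw [hpm] at hp
    refine hQ _ _ _ hA (e17.trans hp) hfr (by rw [e26, hp]) (by rw [← hp]; omega) hpk'
  · dsimp only
    refine ⟨le_rfl, (Agree.refl _ _).update (by decide) _, by simpa using h17, ?_, by simp, rfl,
      rfl, rfl, by omega, by omega⟩
    intro r h₁ h₂
    rw [Function.update_of_ne (by rintro rfl; exact absurd h₂ (by decide))]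

set_option maxHeartbeats 1000000 in
theorem wp_splitCmd {u : ℕ → ℕ} {b l p j : ℕ} {S : Trie} (hS : TreeSetup P x u b)
    {Q : State 64 → Prop} {s : State 64} (hs : TreeState P u b s) (ht : TrieState P b S j s)
    (hj : j < S.sp) (hsp : S.sp < S.count) (hcount : S.count ≤ 2 * b)
    (hstk : S.stk (j + 1) < S.count) (hd : S.dep j ≤ P.T.length) (hprev : S.prev ≤ P.T.length)
    (hl : l ≤ P.T.length) (hp : p ≤ P.T.length)
    (h24 : s.reg 24 = l) (h25 : s.reg 25 = p) (h26 : s.reg 26 = S.dep j) (h27 : s.reg 27 = S.stk j)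
    (hQ : ∀ s', TreeState P u b s' → TrieState P b (S.split p l j) (j + 1) s' →
      Agree 17 s.reg s'.reg → s'.reg 24 = l → s'.reg 25 = p → s'.reg 27 = S.count →
      (∀ a < P.base + 2 * b, s'.mem a = s.mem a) → s'.out = s.out → s'.time ≤ s.time + 180 → Q s') :
    wp P.w P.T x splitCmd Q s := by
  obtain ⟨ρ, μ, o, τ, pk⟩ := s
  obtain ⟨h15, h16, h17, h18, h19, hh⟩ := ht
  have hpk := hs.peak_le
  have hsm := hS.small
  have hb := hS.two_le
  have w₄ := hS.ok.w₄
  have e₁ := hh.stk (j + 1) (by omega)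
  have e₂ := hh.dep (j + 1) (by omega)
  have hh' := hh.split (s := p) (l := l) hj (by omega) rfl hstk
  dsimp only at *
  simp only [splitCmd, wp, Expr.eval, Op.eval, Expr.cost, Function.update_apply, Fin.reduceEq,
    if_true, if_false, h15, h16, h17, h18, h19, h24, h25, h26, h27]
  simp (disch := omega) only [mod_two_pow, e₁, e₂]
  refine hQ _ ?_ ⟨?_, ?_, ?_, ?_, ?_, ?_⟩ ?_ ?_ ?_ ?_ ?_ rfl ?_
  · refine hs.agree (m := 17) ?_ (by norm_num) ?_ ?_
    · repeat' refine Agree.update ?_ (by decide) _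
      exact Agree.refl _ _
    · intro a ha
      dsimp only
      simp (disch := omega) only [Function.update_of_ne]
    · dsimp only
      omega
  · simpa using h15
  · simpa using h16
  · simp
  · simp [Trie.split]
  · simpa [Trie.split] using h19
  · exact hh'
  · repeat' refine Agree.update ?_ (by decide) _
    exact Agree.refl _ _
  · simpa using h24
  · simpa using h25
  · simp
  · intro a ha
    dsimp only
    simp (disch := omega) only [Function.update_of_ne]
  · dsimp only
    omega

set_option maxHeartbeats 1000000 in
theorem wp_leafCmd {u : ℕ → ℕ} {b l p j : ℕ} {S : Trie} (hS : TreeSetup P x u b)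
    {Q : State 64 → Prop} {s : State 64} (hs : TreeState P u b s) (ht : TrieState P b S j s)
    (hj : j ≤ S.sp) (hsp : S.sp < S.count) (hcount : S.count ≤ 2 * b)
    (hl : l ≤ P.T.length) (hp : p ≤ P.T.length)
    (h24 : s.reg 24 = l) (h25 : s.reg 25 = p) (h27 : s.reg 27 = S.stk j)
    (hQ : ∀ s', TreeState P u b s' →
      TrieState P b (S.addLeaf P.T.length p l j) (j + 1) s' → Agree 17 s.reg s'.reg →
      (∀ a < P.base + 2 * b, s'.mem a = s.mem a) → s'.out = s.out → s'.time ≤ s.time + 120 → Q s') :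
    wp P.w P.T x leafCmd Q s := by
  obtain ⟨ρ, μ, o, τ, pk⟩ := s
  obtain ⟨h15, h16, h17, h18, h19, hh⟩ := ht
  have hpk := hs.peak_le
  have hsm := hS.small
  have hb := hS.two_le
  have w₄ := hS.ok.w₄
  have h0 := hs.regs.1
  have hh' := hh.addLeaf (n := P.T.length) (s := p) (l := l) hj (by omega)
  dsimp only at *
  simp only [leafCmd, wp, Expr.eval, Op.eval, Expr.cost, Function.update_apply, Fin.reduceEq,
    if_true, if_false, h0, h15, h16, h17, h18, h19, h24, h25, h27]
  simp (disch := omega) only [mod_two_pow]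
  refine hQ _ ?_ ⟨?_, ?_, ?_, ?_, ?_, ?_⟩ ?_ ?_ rfl ?_
  · refine hs.agree (m := 17) ?_ (by norm_num) ?_ ?_
    · repeat' refine Agree.update ?_ (by decide) _
      exact Agree.refl _ _
    · intro a ha
      dsimp only
      simp (disch := omega) only [Function.update_of_ne]
    · dsimp only
      omega
  · simpa using h15
  · simpa using h16
  · simp
  · simp [Trie.addLeaf]
  · simp [Trie.addLeaf]
  · exact hh'
  · repeat' refine Agree.update ?_ (by decide) _
    exact Agree.refl _ _
  · intro a ha
    dsimp only
    simp (disch := omega) only [Function.update_of_ne]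
  · dsimp only
    omega

/-- At most two entries are pushed, which raises the potential by a constant; so the amortized cost
of an insertion is constant, apart from the computation of `l`. -/
theorem wp_insertCmd {u : ℕ → ℕ} {b l p r : ℕ} {S : Trie} (hS : TreeSetup P x u b)
    {Q : State 64 → Prop} {s : State 64} (hs : TreeState P u b s) (ht : TrieState P b S S.sp s)
    (hB : S.Bounded P.T.length r) (hr : r < b)
    (hl0 : S.count = 1 → l = 0) (hl : l ≤ P.T.length - S.prev) (hp : p < P.T.length)
    (hl' : l ≤ P.T.length - p)
    (h24 : s.reg 24 = l) (h25 : s.reg 25 = p)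
    (hQ : ∀ s', TreeState P u b s' →
      TrieState P b (S.insertAt P.T.length p l) (S.insertAt P.T.length p l).sp s' →
      Agree 17 s.reg s'.reg →
      (∀ a < P.base + 2 * b, s'.mem a = s.mem a) → s'.out = s.out →
      s'.time + 20 * (S.insertAt P.T.length p l).sp ≤ s.time + 20 * S.sp + 420 → Q s') :
    wp P.w P.T x insertCmd Q s := by
  have hplt := hB.pop_lt hl0 hl
  have hple := pop_le S.dep l S.sp
  obtain ⟨b1, b2, b3, b4, b5, b6, -⟩ := hB
  have hsm := hS.small
  rw [insertCmd, wp]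
  refine wp_popCmd hS (s := ⟨s.reg, s.mem, s.out, s.time + 1, s.peak⟩)
    ⟨hs.regs, hs.reg2, hs.reg14, hs.tables, hs.peak_le⟩
    ⟨ht.reg15, ht.reg16, ht.reg17, ht.reg18, ht.reg19, ht.holds⟩ (by omega) b1 h24 ?_
  intro ρ t pk hA e17 hfr e26 ht' hpk
  have hins : S.insertAt P.T.length p l = if S.dep (pop S.dep l S.sp) < l then
    Trie.addLeaf P.T.length p l (pop S.dep l S.sp + 1) (Trie.split p l (pop S.dep l S.sp) S)
  else Trie.addLeaf P.T.length p l (pop S.dep l S.sp) S := rfl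
  rw [hins] at hQ
  generalize pop S.dep l S.sp = j at *
  have a16 : ρ 16 = P.base + (10 * b + 4) := (hA 16 (by decide)).trans ht.reg16
  have a24 : ρ 24 = l := (hfr 24 (by decide) (by decide)).trans h24
  have a25 : ρ 25 = p := (hfr 25 (by decide) (by decide)).trans h25
  have a18 : ρ 18 = S.count := (hfr 18 (by decide) (by decide)).trans ht.reg18
  have a19 : ρ 19 = S.prev := (hfr 19 (by decide) (by decide)).trans ht.reg19
  have a15 : ρ 15 = P.base + 2 * b := (hA 15 (by decide)).trans ht.reg15
  have hst := ht.holds.stk j hple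
  have hd := b5 j hple
  dsimp only at *
  simp only [wp.eq_9, wp.eq_3, Expr.eval, Op.eval, Expr.cost, a16, e17]
  simp (disch := omega) only [mod_two_pow, hst]
  have hTS : TreeState P u b ⟨Function.update ρ 27 (S.stk j), s.mem, s.out, t, pk⟩ :=
    hs.agree (m := 17) (hA.update (by decide) _) (by norm_num) (fun _ _ => rfl) hpk
  have hTr : TrieState P b S j ⟨Function.update ρ 27 (S.stk j), s.mem, s.out, t, pk⟩ :=
    ⟨by simpa using a15, by simpa using a16, by simpa using e17, by simpa using a18,
      by simpa using a19, ht.holds⟩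
  have hpk' : max pk (P.base + (10 * b + 4) + 2 * j + 1) ≤ P.base + 17 * b := by omega
  rw [wp.eq_10]
  simp only [Expr.eval, Op.eval, Expr.cost, Function.update_apply, Fin.reduceEq, if_false, a24, e26]
  by_cases hlt : S.dep j < l
  · rw [if_pos hlt] at hQ
    rw [if_neg (by rw [bit_eq_zero]; exact not_not.2 hlt)]
    have hj := hplt hlt
    refine wp_splitCmd hS (l := l) (p := p) (j := j) (S := S)
      ⟨hTS.regs, hTS.reg2, hTS.reg14, hTS.tables, hpk'⟩
      ⟨hTr.reg15, hTr.reg16, hTr.reg17, hTr.reg18, hTr.reg19, hTr.holds⟩ hj (by omega) (by omega)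
      (b4 _ (by omega)) hd b6 (by omega) hp.le (by simpa using a24) (by simpa using a25)
      (by simpa using e26) (by simp) ?_
    intro s₁ hs₁ ht₁ hA₁ c24 c25 c27 hm₁ ho₁ hti₁
    refine wp_leafCmd hS (l := l) (p := p) (j := j + 1) hs₁ ht₁ le_rfl ?_ ?_ (by omega) hp.le c24
      c25 (by rw [c27]; simp [Trie.split]) ?_
    · simp only [Trie.split]
      omega
    · simp only [Trie.split]
      omega
    intro s₂ hs₂ ht₂ hA₂ hm₂ ho₂ hti₂
    refine hQ _ hs₂ ht₂ ((hA.update (by decide) _).trans (hA₁.trans hA₂)) ?_ (ho₂.trans ho₁) ?_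
    · intro a ha
      rw [hm₂ a ha, hm₁ a ha]
    · dsimp only [Trie.addLeaf] at *
      omega
  · rw [if_neg hlt] at hQ
    rw [if_pos (by rw [bit_eq_zero]; exact hlt), wp]
    refine wp_leafCmd hS (l := l) (p := p) (j := j) (S := S)
      ⟨hTS.regs, hTS.reg2, hTS.reg14, hTS.tables, hpk'⟩
      ⟨hTr.reg15, hTr.reg16, hTr.reg17, hTr.reg18, hTr.reg19, hTr.holds⟩ hple (by omega)
      (by omega) (by omega) hp.le (by simpa using a24) (by simpa using a25) (by simp) ?_
    intro s₂ hs₂ ht₂ hA₂ hm₂ ho₂ hti₂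
    refine hQ _ hs₂ ht₂ ((hA.update (by decide) _).trans hA₂) hm₂ ho₂ ?_
    dsimp only [Trie.addLeaf] at *
    omega

/-! ### The construction of the sparse suffix tree -/

/-- Extract the smallest remaining suffix and insert it into the trie. -/
def roundCmd (κ : ℕ) : Cmd 64 :=
  .load 21 (°14 +ₑ ♯1) ;; .arg 25 (♯3 +ₑ °21) ;; (removeCmd κ ;;
    (.ite (♯1 <ₑ °18) (.set 30 (°19) ;; .set 31 (°25) ;; lcpCmd κ ;; .set 24 (°32))
      (.set 24 (♯0)) ;; (insertCmd ;; .set 12 (°12 +ₑ ♯1))))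

/-- The time for one round. -/
def Par.roundTime (P : Par) (b : ℕ) : ℕ :=
  (Nat.log 2 b + 1) * (P.lcpTime + 150) + P.lcpTime + 600

/-- The invariant of the main loop: the suffixes whose numbers are in `order` have been inserted
into `S`. -/
structure RoundInv (P : Par) (u : ℕ → ℕ) (x : List ℕ) (b τ : ℕ) (good : Prop) (S : Trie)
    (order : List ℕ) (s : State 64) : Prop where
  state : TreeState P u b s
  trie : TrieState P b S S.sp s
  bounded : S.Bounded P.T.length order.length
  prev_lt : order ≠ [] → S.prev < P.T.length
  tour : Tour P u x b (fun i => i ∉ order) 0 s.mem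
  reg12 : s.reg 12 = order.length
  nodup : order.Nodup
  lt : ∀ i ∈ order, i < b
  out : s.out = []
  -- The potential of the stack is included, so that every round has the same amortized bound.
  time_le : s.time + 20 * S.sp ≤ τ + order.length * P.roundTime b
  init : order = [] → S = Trie.empty
  -- All remaining suffixes being greater than the last one inserted is what the next insertion
  -- requires. Only these facts depend on good seeds.
  correct : good → order ≠ [] →
    (∃ str, S.Correct P.T (order.map fun i => x.getD (4 + i) 0) str fun _ => False) ∧
    ∀ i < b, i ∉ order → LessAt P.T (suffixLcp P.T S.prev (x.getD (4 + i) 0)) S.prev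
      (x.getD (4 + i) 0)

theorem exists_not_mem_of_length_lt {order : List ℕ} {b : ℕ} (h : order.length < b) :
    ∃ i < b, i ∉ order := by
  by_contra hc
  push Not at hc
  have : (Finset.range b) ⊆ order.toFinset := fun i hi =>
    List.mem_toFinset.2 (hc i (Finset.mem_range.1 hi))
  have := (Finset.card_le_card this).trans (List.toFinset_card_le order)
  rw [Finset.card_range] at this
  omega

theorem mem_of_nodup_of_length {order : List ℕ} {b : ℕ} (hn : order.Nodup)
    (hlt : ∀ i ∈ order, i < b) (h : order.length = b) {i : ℕ} (hi : i < b) : i ∈ order := by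
  have h₁ : order.toFinset ⊆ Finset.range b := fun i hi =>
    Finset.mem_range.2 (hlt i (List.mem_toFinset.1 hi))
  have h₂ := Finset.eq_of_subset_of_card_le h₁ (by
    rw [Finset.card_range, List.toFinset_card_of_nodup hn, h])
  have := Finset.mem_range.2 hi
  rw [← h₂] at this
  exact List.mem_toFinset.1 this

/-- The suffix extracted from the tournament. -/
theorem RoundInv.next {u : ℕ → ℕ} {b τ : ℕ} {good : Prop} {S : Trie} {order : List ℕ}
    {s : State 64} {σ : ℕ} (h : RoundInv P u x b τ good S order s) (hT : OverAlphabet σ P.T)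
    (hpos : ∀ i < b, x.getD (4 + i) 0 < P.T.length)
    (hinj : ∀ i < b, ∀ j < b, x.getD (4 + i) 0 = x.getD (4 + j) 0 → i = j)
    (hgood : good → ∀ i < P.T.length, ∀ j < P.T.length, P.lcp u i j = suffixLcp P.T i j)
    (hr : order.length < b) : ∃ i < b, i ∉ order ∧ s.mem (P.base + 1) = i + 1 ∧
      (good → ∀ j < b, j ∉ i :: order →
        LessAt P.T (suffixLcp P.T (x.getD (4 + i) 0) (x.getD (4 + j) 0)) (x.getD (4 + i) 0)
          (x.getD (4 + j) 0)) := by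
  obtain ⟨k, hk, hko⟩ := exists_not_mem_of_length_lt hr
  obtain ⟨i, hi, hio, e⟩ := h.tour.leaves.root h.tour.cons hk hko
  refine ⟨i, hi, hio, e, fun hg j hj hjo => ?_⟩
  have hless : ∀ i j, i < b → j < b → (P.Less u x (i + 1) (j + 1) ↔
      LessAt P.T (suffixLcp P.T (x.getD (4 + i) 0) (x.getD (4 + j) 0)) (x.getD (4 + i) 0)
          (x.getD (4 + j) 0)) := by
    intro i j hi hj
    rw [Par.Less, show 3 + (i + 1) = 4 + i by omega, show 3 + (j + 1) = 4 + j by omega,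
      hgood hg _ (hpos i hi) _ (hpos j hj)]
  -- A remaining suffix is a player at its leaf, so the root is at least as small. Good seeds are
  -- needed here because only then the fingerprint order is total and transitive.
  have hj0 := (h.tour.leaves j hj).1 (fun h => hjo (List.mem_cons_of_mem _ h))
  have := h.tour.leaves.root_min h.tour.cons ?_ ?_ (u := b + j) (by omega) (by omega)
    (by rw [hj0]; omega)
  · rw [hj0, e, hless i j hi hj] at this
    refine this.resolve_left fun he => hjo ?_
    obtain rfl : i = j := by omega
    simp
  · intro i j hi hj hij hn
    rw [hless j i hj hi]
    rw [hless i j hi hj] at hn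
    exact LessAt.total hT (hpos i hi) (hpos j hj) (fun h => hij (hinj i hi j hj h)) hn
  · intro i j k hi hj hk h₁ h₂
    rw [hless _ _ hi hj] at h₁
    rw [hless _ _ hj hk] at h₂
    rw [hless _ _ hi hk]
    exact LessAt.trans hT (hpos i hi) (hpos k hk) h₁ h₂

/-- The extracted suffix is the smallest one left and greater than its predecessor. With good seeds
the computed prefix length is exact, so the insertion is correct; otherwise `Par.lcp_le` still keeps
the trie `Bounded`. -/
theorem wp_roundCmd {u : ℕ → ℕ} {b τ : ℕ} {good : Prop} {S : Trie} {order : List ℕ}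
    {s : State 64} {σ : ℕ} (hS : TreeSetup P x u b) (h : RoundInv P u x b τ good S order s)
    (hT : OverAlphabet σ P.T)
    (hinj : ∀ i < b, ∀ j < b, x.getD (4 + i) 0 = x.getD (4 + j) 0 → i = j)
    (hgood : good → ∀ i < P.T.length, ∀ j < P.T.length, P.lcp u i j = suffixLcp P.T i j)
    (hr : order.length < b) :
    wp P.w P.T x (roundCmd P.κ) (fun s' => ∃ S' i, RoundInv P u x b τ good S' (i :: order)
      s') ⟨s.reg, s.mem, s.out, s.time + 4, s.peak⟩ := by
  obtain ⟨i, hi, hio, e1, hmin⟩ := h.next hT hS.pos_lt hinj hgood hr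
  have hsm := hS.small
  have hb := hS.two_le
  have w₄ := hS.ok.w₄
  have hp := hS.pos_lt i hi
  have hpk := h.state.peak_le
  simp only [roundCmd, wp.eq_9, wp.eq_3, wp.eq_6, Expr.eval, Op.eval, Expr.cost,
    Function.update_apply, Fin.reduceEq, if_true, if_false, h.state.reg14]
  simp (disch := omega) only [mod_two_pow, e1]
  rw [show 3 + (i + 1) = 4 + i by omega, mod_two_pow (a := x.getD (4 + i) 0) (by omega)]
  generalize hpp : x.getD (4 + i) 0 = p at *
  have hA₁ : Agree 20 s.reg (Function.update (Function.update s.reg 21 (i + 1)) 25 p) := by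
    repeat' refine Agree.update ?_ (by decide) _
    exact Agree.refl _ _
  refine wp_removeCmd hS (i := i) (D := fun k => k ∉ order)
    (s := ⟨Function.update (Function.update s.reg 21 (i + 1)) 25 p, s.mem, _, _, _⟩)
    (h.state.agree hA₁ (by norm_num) (fun _ _ => rfl) (by dsimp only; omega))
    h.tour hi (by simp) ?_
  intro s₁ hs₁ hA₂ h25 hT₁ hm₁ ho₁ ht₁
  dsimp only at *
  rw [Function.update_self] at h25
  have hA₃ := hA₁.trans hA₂
  have htr : TrieState P b S S.sp s₁ := by
    refine ⟨(hA₃ 15 (by decide)).trans h.trie.reg15, (hA₃ 16 (by decide)).trans h.trie.reg16,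
      (hA₃ 17 (by decide)).trans h.trie.reg17, (hA₃ 18 (by decide)).trans h.trie.reg18,
      (hA₃ 19 (by decide)).trans h.trie.reg19, h.trie.holds.congr (by omega) hm₁⟩
  have e12 := (hA₃ 12 (by decide)).trans h.reg12
  have hcount1 : S.count = 1 ↔ order = [] := by
    constructor
    · intro hc
      by_contra hne
      exact h.bounded.count_ne (by simpa using hne) hc
    · intro hne
      rw [h.init hne]
      rfl
  have hT₂ : Tour P u x b (fun k => k ∉ i :: order) 0 s₁.mem := by
    have : (fun k => k ∉ i :: order) = fun k => k ∉ order ∧ k ≠ i := by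
      funext k
      simp [and_comm]
    rw [this]
    exact hT₁
  -- The common end of both branches. In the first round there is no predecessor and `l` is `0`.
  have fin : ∀ l s₂, (l = if S.count = 1 then 0 else P.lcp u S.prev p) → s₂.reg 24 = l →
      Agree 24 s₁.reg s₂.reg → s₂.reg 25 = p → s₂.mem = s₁.mem → s₂.out = s₁.out →
      s₂.peak ≤ P.base + 17 * b → s₂.time ≤ s₁.time + P.lcpTime + 30 →
      wp P.w P.T x (insertCmd ;; .set 12 (°12 +ₑ ♯1)) (fun s' => ∃ S' i, RoundInv P u x b τ good S'
        (i :: order) s') s₂ := by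
    intro l s₂ hl h24 hA₄ h25' hm₂ ho₂ hpk₂ ht₂
    have hprev : S.count ≠ 1 → l = P.lcp u S.prev p := fun hc => by rw [hl, if_neg hc]
    have hll := P.lcp_le u S.prev p
    have hS₂ := hs₁.agree hA₄ (by norm_num) (fun a _ => by rw [hm₂]) hpk₂
    have hTr₂ : TrieState P b S S.sp s₂ := by
      refine ⟨(hA₄ 15 (by decide)).trans htr.reg15, (hA₄ 16 (by decide)).trans htr.reg16,
        (hA₄ 17 (by decide)).trans htr.reg17, (hA₄ 18 (by decide)).trans htr.reg18,
        (hA₄ 19 (by decide)).trans htr.reg19, by rw [hm₂]; exact htr.holds⟩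
    have hl0 : S.count = 1 → l = 0 := fun hc => by rw [hl, if_pos hc]
    have hl₁ : l ≤ P.T.length - S.prev := by
      by_cases hc : S.count = 1
      · rw [hl0 hc]; omega
      · rw [hprev hc]; exact hll.1
    have hl₂ : l ≤ P.T.length - p := by
      by_cases hc : S.count = 1
      · rw [hl0 hc]; omega
      · rw [hprev hc]; exact hll.2
    rw [wp]
    refine wp_insertCmd hS (l := l) (p := p) (r := order.length) (S := S)
      ⟨hS₂.regs, hS₂.reg2, hS₂.reg14, hS₂.tables, hS₂.peak_le⟩
      ⟨hTr₂.reg15, hTr₂.reg16, hTr₂.reg17, hTr₂.reg18, hTr₂.reg19, hTr₂.holds⟩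
      h.bounded hr hl0 hl₁ hp hl₂ h24 h25' ?_
    intro s₃ hs₃ htr₃ hA₅ hm₃ ho₃ ht₃
    have e12' : s₃.reg 12 = order.length :=
      (hA₅ 12 (by decide)).trans ((hA₄ 12 (by decide)).trans e12)
    simp only [wp, Expr.eval, Op.eval, Expr.cost, e12']
    simp (disch := omega) only [mod_two_pow]
    have hpr : (S.insertAt P.T.length p l).prev = p := by
      unfold Trie.insertAt
      split_ifs <;> rfl
    refine ⟨S.insertAt P.T.length p l, i, ⟨?_, ?_, ?_, hs₃.tables, hs₃.peak_le⟩,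
      ⟨?_, ?_, ?_, ?_, ?_, htr₃.holds⟩, ?_, ?_, ?_, ?_, ?_, ?_, ?_, ?_, ?_, ?_⟩
    · exact hs₃.regs.agree ((Agree.refl _ _).update (by decide) _)
    · simpa using hs₃.reg2
    · simpa using hs₃.reg14
    · simpa using htr₃.reg15
    · simpa using htr₃.reg16
    · simpa using htr₃.reg17
    · simpa using htr₃.reg18
    · simpa using htr₃.reg19
    · exact h.bounded.insertAt hp hl0 hl₁ hl₂
    · intro _
      rw [hpr]
      exact hp
    · refine hT₂.congr fun v h1 h2 => ?_
      dsimp only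
      rw [hm₃ _ (by omega)]
      dsimp only
      rw [hm₂]
    · simp
    · exact List.nodup_cons.2 ⟨hio, h.nodup⟩
    · intro k hk
      rcases List.mem_cons.1 hk with rfl | hk
      · exact hi
      · exact h.lt k hk
    · dsimp only
      rw [ho₃]
      dsimp only
      rw [ho₂, ho₁, h.out]
    · have := h.time_le
      simp only [List.length_cons, Nat.add_mul, Par.roundTime] at *
      omega
    · intro hh
      simp at hh
    · intro hg _
      refine ⟨?_, ?_⟩
      · rw [List.map_cons, hpp]
        by_cases hne : order = []
        · rw [h.init hne, hne, List.map_nil, hl0 (hcount1.2 hne)]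
          exact Trie.correct_first hp
        · have hc := mt hcount1.1 hne
          obtain ⟨⟨str, hstr⟩, hle⟩ := h.correct hg hne
          rw [hprev hc, hgood hg _ (h.prev_lt hne) _ hp]
          refine hstr.insertAt (h.bounded.top hc) ?_
          have := hle i hi hio
          rwa [hpp] at this
      · rw [hpr]
        exact hmin hg
  rw [wp, wp.eq_10]
  have e18 : s₁.reg 18 = S.count := htr.reg18
  have e19 : s₁.reg 19 = S.prev := htr.reg19
  simp only [Expr.eval, Op.eval, Expr.cost, e18]
  rw [mod_two_pow (a := 1) (by omega)]
  by_cases hc : S.count = 1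
  · rw [if_pos (by rw [bit_eq_zero]; omega)]
    simp only [wp.eq_2, Expr.eval, Expr.cost]
    refine fin 0 _ (by rw [if_pos hc]) (by simp) ((Agree.refl _ _).update (by decide) _)
      (by simpa using h25) rfl rfl hs₁.peak_le (by dsimp only; omega)
  · have hc0 : S.count ≠ 0 := by
      have := h.bounded.sp_le
      omega
    have hne := mt hcount1.2 hc
    rw [if_neg (by rw [bit_eq_zero]; omega)]
    simp only [wp.eq_9, wp.eq_2, Expr.eval, Expr.cost, Function.update_apply, Fin.reduceEq,
      if_false, e19, h25]
    have hA₄ : Agree 30 s₁.reg (Function.update (Function.update s₁.reg 30 S.prev) 31 p) := by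
      repeat' refine Agree.update ?_ (by decide) _
      exact Agree.refl _ _
    refine wp_lcpCmd hS.ok (u := u) (I := S.prev) (J := p) (B := P.base + 17 * b)
      (hs₁.regs.agree (hA₄.mono (by norm_num))) hS.seeds hs₁.tables (by simp) (by simp)
      (h.prev_lt hne) hp hs₁.peak_le (by unfold Par.base; omega) ?_
    intro ρ t pk ht hpk' hA₅ h32
    dsimp only at *
    simp only [wp.eq_2, Expr.eval, Expr.cost, h32]
    refine fin (P.lcp u S.prev p) _ (by rw [if_neg hc]) (by simp) ?_ ?_ rfl rfl hpk'
      (by dsimp only; omega)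
    · exact (hA₄.mono (by norm_num)).trans ((hA₅.mono (by norm_num)).update (by decide) _)
    · have := (hA₅ 25 (by decide)).trans (hA₄ 25 (by decide))
      simpa [h25] using this

/-- Output the nodes of the trie. -/
def emitCmd : Cmd 64 :=
  .set 20 (♯0) ;; .loop (°20 <ₑ °18)
    (.load 26 (°15 +ₑ ♯4 *ₑ °20) ;; .emit (°26) ;; .load 26 (°15 +ₑ ♯4 *ₑ °20 +ₑ ♯1) ;; .emit (°26) ;;
      .load 26 (°15 +ₑ ♯4 *ₑ °20 +ₑ ♯2) ;; .emit (°26) ;; .load 26 (°15 +ₑ ♯4 *ₑ °20 +ₑ ♯3) ;;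
      .emit (°26) ;; .set 20 (°20 +ₑ ♯1))

theorem wp_emitCmd {u : ℕ → ℕ} {b j : ℕ} {S : Trie} (hS : TreeSetup P x u b)
    {s : State 64} (hs : TreeState P u b s) (ht : TrieState P b S j s)
    (hcount : S.count ≤ 2 * b + 1) (ho : s.out = []) :
    wp P.w P.T x emitCmd (fun s' => s'.out = encodeTree S.toList ∧
      s'.time ≤ s.time + 20 + (2 * b + 1) * 80 ∧ s'.peak ≤ P.base + 17 * b) s := by
  have hsm := hS.small
  have hb := hS.two_le
  have hpk := hs.peak_le
  have hc : Expr.cost (k := 64) (°20 <ₑ °18) = 3 := rfl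
  obtain ⟨ρ, μ, o, τ, pk⟩ := s
  obtain ⟨h15, h16, h17, h18, h19, hh⟩ := ht
  dsimp only at *
  simp only [emitCmd, wp, Expr.eval, Expr.cost]
  simp (disch := omega) only [mod_two_pow]
  refine wp_for S.count (fun i s => Agree 20 ρ s.reg ∧ s.reg 20 = i ∧ s.mem = μ ∧
    s.out = encodeTree ((List.range i).map S.node) ∧ s.time ≤ τ + 10 + i * 80 ∧
    s.peak ≤ P.base + 17 * b) ?_ ?_ ?_ ?_
  · rintro i ⟨ρ', _, _, _, _⟩ hi ⟨hA, h20, -⟩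
    dsimp only at *
    simp only [Expr.eval, Op.eval, h20, hA 18 (by decide), h18]
    rw [bit_eq_zero]
    omega
  · rintro i ⟨ρ', μ', o', t', pk'⟩ hi ⟨hA, h20, rfl, ho', ht', hpk'⟩
    dsimp only at *
    have a15 := (hA 15 (by decide)).trans h15
    simp only [wp, Expr.eval, Op.eval, Expr.cost, Function.update_apply, Fin.reduceEq, if_true,
      if_false, h20, a15]
    simp (disch := omega) only [mod_two_pow, hh.parent i hi, hh.start i hi, hh.len i hi,
      hh.mark i hi]
    refine ⟨?_, by simp, by trivial, ?_, by omega, by omega⟩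
    · repeat' refine Agree.update ?_ (by decide) _
      exact hA
    · rw [ho', List.range_succ, List.map_append]
      simp [encodeTree]
  · rintro ⟨ρ', μ', o', t', pk'⟩ ⟨hA, h20, rfl, ho', ht', hpk'⟩
    dsimp only at *
    exact ⟨ho', by omega, hpk'⟩
  · exact ⟨(Agree.refl _ _).update (by decide) _, by simp, rfl, by simp [ho, encodeTree],
      by dsimp only; omega, hpk⟩

/-- Store the trie of no suffix. -/
def emptyCmd : Cmd 64 :=
  .set 15 (°14 +ₑ ♯2 *ₑ °2) ;; .set 16 (°14 +ₑ (♯10 *ₑ °2 +ₑ ♯4)) ;; .set 17 (♯0) ;;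
  .set 18 (♯1) ;; .set 19 (♯0) ;; .store (°15) (♯0) ;; .store (°15 +ₑ ♯1) (♯0) ;;
  .store (°15 +ₑ ♯2) (♯0) ;; .store (°15 +ₑ ♯3) (♯0) ;; .store (°16) (♯0) ;;
  .store (°16 +ₑ ♯1) (♯0) ;; .set 12 (♯0)

theorem wp_emptyCmd {u : ℕ → ℕ} {b τ : ℕ} {good : Prop} (hS : TreeSetup P x u b)
    {s : State 64} (hs : TreeState P u b s) (hT : Tour P u x b (fun _ => True) 0 s.mem)
    (ho : s.out = []) (hτ : s.time + 100 ≤ τ) :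
    wp P.w P.T x emptyCmd (RoundInv P u x b τ good Trie.empty []) s := by
  have hsm := hS.small
  have hb := hS.two_le
  have hpk := hs.peak_le
  simp only [emptyCmd, wp, Expr.eval, Op.eval, Expr.cost, Function.update_apply, Fin.reduceEq,
    if_true, if_false, hs.reg2, hs.reg14]
  simp (disch := omega) only [mod_two_pow]
  refine ⟨?_, ⟨by simp, by simp, by simp [Trie.empty], by simp [Trie.empty],
    by simp [Trie.empty], ?_⟩, Trie.bounded_empty _, by simp, ?_, by simp, by simp, by simp, ho, ?_,
    by simp, by simp⟩
  · refine ⟨hs.regs.agree ?_, ?_, ?_, ?_, ?_⟩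
    · repeat' refine Agree.update ?_ (by decide) _
      exact Agree.refl _ _
    · simpa using hs.reg2
    · simpa using hs.reg14
    · refine hs.tables.congr fun a ha => ?_
      have ha : a < P.base := ha
      dsimp only
      simp (disch := omega) only [Function.update_of_ne]
    · dsimp only
      omega
  · constructor <;> intro k hk <;> obtain rfl : k = 0 := by simp [Trie.empty] at hk; exact hk
    all_goals
      dsimp only [Trie.empty]
      simp (disch := omega) only [Function.update_apply, if_neg, if_pos, if_true, Nat.mul_zero,
        Nat.add_zero]
  · have hT' : Tour P u x b (fun i => i ∉ []) 0 s.mem := by simpa using hT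
    refine hT'.congr fun v h1 h2 => ?_
    dsimp only
    simp (disch := omega) only [Function.update_of_ne]
  · dsimp only [Trie.empty, List.length_nil]
    omega

/-- The construction of the sparse suffix tree after the preparations. -/
def treeCmd (κ : ℕ) : Cmd 64 :=
  .set 14 (♯κ +ₑ ♯4 *ₑ (♯κ *ₑ °9)) ;; (initCmd κ ;; (emptyCmd ;;
    (.loop (°12 <ₑ °2) (roundCmd κ) ;; emitCmd)))

theorem treeInput_getD (T : List ℕ) (σ : ℕ) (I : List ℕ) (α : ℕ) {i : ℕ} (hi : i < I.length) :
    (treeInput T σ I α).getD (4 + i) 0 = I[i] := by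
  rw [treeInput, List.getD_append_right _ _ _ _ (by simp), List.getD_eq_getElem _ _ (by simpa)]
  simp

/-- After `b` rounds the list of extracted numbers has length `b`, no repetitions and entries below
`b`; so all positions have been inserted. -/
theorem wp_treeCmd {κ w σ α c : ℕ} {T I : List ℕ} {u : ℕ → ℕ} {s : State 64}
    (hs : Ready κ w T σ I.length α P c u s) (hT : OverAlphabet σ T)
    (hI : I.Nodup) (hIn : ∀ i ∈ I, i < T.length) (hb : 2 ≤ I.length)
    (hw : P.base + 20 * I.length + 64 < 2 ^ w) :
    wp w T (treeInput T σ I α) (treeCmd κ) (fun s' =>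
      s'.time ≤ s.time + 400 + I.length * (P.lcpTime + P.roundTime I.length + 400) ∧
      s'.peak ≤ κ + 4 * (κ * P.G) + 17 * I.length ∧
      (GoodSeeds P.σ P.p P.ν P.T P.κ u → IsTreeOutput T I s'.out)) s := by
  have hlcp := fun hg i hi j hj => hs.toSetup.lcp_eq (u := u) hg (i := i) (j := j) hi hj
  obtain ⟨hSt, hu, hM, hR, h2, ho, -, hpk⟩ := hs
  obtain rfl := hSt.κ_eq
  obtain rfl := hSt.w_eq
  obtain rfl := hSt.T_eq
  generalize hx : treeInput P.T σ I α = x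
  have hget : ∀ i (hi : i < I.length), x.getD (4 + i) 0 = I[i] := fun i hi => by
    rw [← hx]; exact treeInput_getD _ _ _ _ hi
  obtain ⟨b, hb'⟩ : ∃ b, I.length = b := ⟨_, rfl⟩
  rw [hb'] at hSt h2 hb hw ⊢
  have hS : TreeSetup P x u b := ⟨hSt.ok, hu, hb, fun i hi => by
    rw [hget i (by omega)]; exact hIn _ (List.getElem_mem _), hw⟩
  have hinj : ∀ i < b, ∀ j < b, x.getD (4 + i) 0 = x.getD (4 + j) 0 → i = j := by
    intro i hi j hj he
    rw [hget i (by omega), hget j (by omega)] at he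
    exact (List.Nodup.getElem_inj_iff hI).1 he
  have hbase : P.base = P.κ + 4 * (P.κ * P.G) := rfl
  have h9 := hR.2.2.2.2.2.2.1
  have hc : Expr.cost (k := 64) (°12 <ₑ °2) = 3 := rfl
  rw [treeCmd, wp]
  simp only [wp.eq_2, Expr.eval, Op.eval, Expr.cost, h9]
  simp (disch := omega) only [mod_two_pow]
  rw [← hbase, wp]
  have hA : Agree 12 s.reg (Function.update s.reg 14 P.base) :=
    (Agree.refl _ _).update (by decide) _
  refine wp_initCmd hS ⟨hR.agree hA, by simpa using h2, by simp, hM, by dsimp only; omega⟩ ?_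
  intro s₁ hs₁ hA₁ hT₁ ho₁ ht₁
  rw [wp]
  refine wp_mono _ ?_ (wp_emptyCmd (τ := s.time + 200 + b * (P.lcpTime + 170))
    (good := GoodSeeds P.σ P.p P.ν P.T P.κ u) hS
    ⟨hs₁.regs, hs₁.reg2, hs₁.reg14, hs₁.tables, hs₁.peak_le⟩ hT₁ (ho₁.trans ho)
    (by dsimp only at *; omega))
  intro s₂ h₂
  rw [wp]
  refine wp_for b (fun r s' => ∃ S order, order.length = r ∧ RoundInv P u x b
    (s.time + 210 + b * (P.lcpTime + 170)) (GoodSeeds P.σ P.p P.ν P.T P.κ u) S order s')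
    ?_ ?_ ?_ ?_
  · rintro r s' hr ⟨S, order, hlen, h⟩
    simp only [Expr.eval, Op.eval, h.reg12, h.state.reg2]
    rw [bit_eq_zero]
    omega
  · rintro r s' hr ⟨S, order, hlen, h⟩
    refine wp_mono _ ?_ (wp_roundCmd hS h hT hinj hlcp (by omega))
    rintro s'' ⟨S', i, h'⟩
    exact ⟨S', i :: order, by simp [hlen], h'⟩
  · rintro s' ⟨S, order, hlen, h⟩
    have hcount := h.bounded.count_le
    refine wp_mono _ ?_ (wp_emitCmd hS (S := S) (j := S.sp)
      ⟨h.state.regs, h.state.reg2, h.state.reg14, h.state.tables, h.state.peak_le⟩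
      ⟨h.trie.reg15, h.trie.reg16, h.trie.reg17, h.trie.reg18, h.trie.reg19, h.trie.holds⟩
      (by omega) h.out)
    rintro s'' ⟨ho'', ht'', hpk''⟩
    refine ⟨?_, by omega, fun hg => ⟨_, ho'', ?_⟩⟩
    · have := h.time_le
      rw [hlen] at this
      dsimp only at ht''
      simp only [Nat.mul_add] at *
      omega
    · obtain ⟨⟨str, hstr⟩, -⟩ := h.correct hg (by rintro rfl; simp at hlen; omega)
      refine hstr.isSparseSuffixTree fun a => ?_
      simp only [List.mem_map]
      constructor
      · intro ha
        obtain ⟨i, hi, rfl⟩ := List.getElem_of_mem ha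
        exact ⟨i, mem_of_nodup_of_length h.nodup h.lt hlen (by omega), hget i hi⟩
      · rintro ⟨i, hi, rfl⟩
        rw [hget i (by have := h.lt i hi; omega)]
        exact List.getElem_mem _
  · refine ⟨Trie.empty, [], rfl, ?_⟩
    obtain ⟨a1, a2, a3, a4, a5, a6, a7, a8, a9, a10, a11, a12⟩ := h₂
    exact ⟨⟨a1.regs, a1.reg2, a1.reg14, a1.tables, a1.peak_le⟩,
      ⟨a2.reg15, a2.reg16, a2.reg17, a2.reg18, a2.reg19, a2.holds⟩, a3, a4, a5, a6, a7, a8, a9,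
      by dsimp only at *; omega, a11, a12⟩

theorem Valid.treeInput {T I : List ℕ} {σ α κ w : ℕ} (hT : OverAlphabet σ T)
    (hn : 0 < T.length) (h2 : 2 ≤ α) (hb : α ≤ I.length)
    (hw : 20 * (κ + 66) * (Nat.log 2 (T.length + σ + I.length) + 1) ≤ w) :
    Valid κ w T (treeInput T σ I α) σ I.length α :=
  ⟨hT, hn, h2, hb, pow_le_two_pow hw, rfl, rfl, rfl, rfl⟩

theorem Valid.memory_lt {κ w σ b α c : ℕ} {T x : List ℕ} (hV : Valid κ w T x σ b α)
    (hS : Setup κ w T σ b α P c) : P.base + 20 * b + 64 < 2 ^ w := by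
  have hG : P.G ≤ T.length + 1 := by
    rw [hS.ok.G_eq, hS.T_eq]
    exact Nat.succ_le_succ (Nat.div_le_self _ _)
  have hbase : P.base = κ + 4 * (κ * P.G) := by rw [← hS.κ_eq]; rfl
  have h : κ * P.G ≤ κ * (T.length + 1) := Nat.mul_le_mul_left _ hG
  refine lt_of_lt_of_le ?_ hV.w_ge
  rw [hbase]
  calc κ + 4 * (κ * P.G) + 20 * b + 64 ≤ κ + 4 * (κ * (T.length + 1)) + 20 * b + 64 := by omega
    _ ≤ (T.length + σ + b + κ + 64) ^ 3 := by
      have h₁ : κ * (T.length + 1) ≤ (T.length + σ + b + κ + 64) * (T.length + σ + b + κ + 64) :=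
        Nat.mul_le_mul (by omega) (by omega)
      generalize hm : T.length + σ + b + κ + 64 = m at *
      have h₂ : 64 * m ≤ m * m := Nat.mul_le_mul_right _ (by omega)
      have h₃ : 64 * (m * m) ≤ m * (m * m) := Nat.mul_le_mul_right _ (by omega)
      have h₄ : m ^ 3 = m * (m * m) := by ring
      omega
    _ < (T.length + σ + b + κ + 64) ^ 20 := Nat.pow_lt_pow_right (by omega) (by norm_num)

/-- The time for all rounds. -/
theorem mul_roundTime_le {b α κ w σ c : ℕ} {T : List ℕ} (hα : 2 ≤ α) (hαb : α ≤ b)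
    (hS : Setup κ w T σ b α P c) :
    (b : ℝ) * (P.lcpTime + P.roundTime b + 400) ≤
      (8000 + 40000 * κ) * (Real.log b * queryCost T.length b α) := by
  have lb := half_le_log (hα.trans hαb)
  have hΛ := natLog_le_log (b := b) (by omega)
  have q₁ := cast_add_cast_le_queryCost (n := T.length) hα hαb
  have q₂ := mul_lcpTime_le hα hαb hS
  set X := queryCost T.length b α
  have hn : (0 : ℝ) ≤ T.length := by positivity
  have hb : (0 : ℝ) ≤ b := by positivity
  have hκ : (0 : ℝ) ≤ κ := by positivity
  have hX : 0 ≤ X := by linarith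
  have hlX : X ≤ 2 * (Real.log b * X) := by nlinarith
  have hL : (Nat.log 2 b : ℝ) * X ≤ 2 * (Real.log b * X) := by nlinarith
  have hL0 : (0 : ℝ) ≤ Nat.log 2 b := by positivity
  unfold Par.roundTime
  push_cast
  calc (b : ℝ) * (P.lcpTime + ((Nat.log 2 b + 1) * (P.lcpTime + 150) + P.lcpTime + 600) + 400)
      = (Nat.log 2 b + 3) * (b * P.lcpTime) + (150 * Nat.log 2 b + 1150) * b := by ring
    _ ≤ (Nat.log 2 b + 3) * ((600 + 5000 * κ) * X) + (150 * Nat.log 2 b + 1150) * X := by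
      gcongr
      linarith
    _ = (750 + 5000 * κ) * (Nat.log 2 b * X) + (2950 + 15000 * κ) * X := by ring
    _ ≤ (750 + 5000 * κ) * (2 * (Real.log b * X)) +
        (2950 + 15000 * κ) * (2 * (Real.log b * X)) := by gcongr
    _ ≤ _ := by
      have : 0 ≤ Real.log b * X := by positivity
      nlinarith [mul_nonneg hκ this]

theorem achieves_tree (e : ℕ) : ∃ C : ℝ, 0 ≤ C ∧ ∀ (T : List ℕ) (σ : ℕ) (I : List ℕ) (α w : ℕ),
    OverAlphabet σ T → I.Nodup → (∀ i ∈ I, i < T.length) → 2 ≤ α → α ≤ I.length →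
    20 * (3 * (e + 3) + 66) * (Nat.log 2 (T.length + σ + I.length) + 1) ≤ w →
    Achieves (hashedCmd (3 * (e + 3)) (treeCmd (3 * (e + 3)))) w T (treeInput T σ I α)
      (IsTreeOutput T I) (C * (Real.log I.length * queryCost T.length I.length α))
      (C * ((α : ℝ) * I.length)) (1 / (T.length : ℝ) ^ e) := by
  generalize hκ : 3 * (e + 3) = κ
  refine ⟨300000 + 41000 * κ, by positivity, fun T σ I α w hT hI hIn h2 hb hw => ?_⟩
  have hn : 0 < T.length := by
    rcases I with _ | ⟨i, I⟩
    · simp at hb; omega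
    · have := hIn i (by simp); omega
  have hV := Valid.treeInput hT hn h2 hb hw
  refine achieves_hashedCmd hκ.symm hV fun P c u s hs => ?_
  refine wp_mono _ ?_ (wp_treeCmd hs hT hI hIn (h2.trans hb) (hV.memory_lt hs.toSetup))
  rintro s' ⟨ht, hpk, ho⟩
  have hκ0 : (0 : ℝ) ≤ κ := by positivity
  refine ⟨?_, (hs.space_le h2 (by omega) hpk).trans ?_, ho⟩
  · have ht' : s'.time ≤ 110000 * T.length + 12 * I.length + 700 +
        κ * (140 * (T.length + 1) + 120) +
        I.length * (P.lcpTime + P.roundTime I.length + 400) := by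
      have := hs.time_le
      omega
    have ht'' : (s'.time : ℝ) ≤ 110000 * T.length + 12 * I.length + 700 +
        κ * (140 * (T.length + 1) + 120) +
        I.length * (P.lcpTime + P.roundTime I.length + 400) := by exact_mod_cast ht'
    have lb := half_le_log (h2.trans hb)
    have q₁ := cast_add_cast_le_queryCost (n := T.length) h2 hb
    have q₂ := mul_roundTime_le h2 hb hs.toSetup
    have hn' : (1 : ℝ) ≤ T.length := by exact_mod_cast hn
    have h2' : (2 : ℝ) ≤ I.length := by exact_mod_cast h2.trans hb
    set X := queryCost T.length I.length α
    have hX : 0 ≤ X := by linarith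
    have hlX : X ≤ 2 * (Real.log I.length * X) := by nlinarith
    set Y := Real.log I.length * X
    have e₁ : (κ : ℝ) * (140 * (T.length + 1) + 120) ≤ κ * (300 * (2 * Y)) := by
      gcongr
      linarith
    nlinarith [mul_nonneg hκ0 (by linarith : (0 : ℝ) ≤ Y)]
  · gcongr
    push_cast
    linarith

/-! ### The choice `α = ⌈b^ε⌉` and the main theorem. -/

theorem log_mul_queryCost {b : ℕ} (n α : ℕ) : Real.log b * queryCost n b α =
    (n : ℝ) * Real.log b ^ 2 / Real.log α + (α : ℝ) * b * Real.log b ^ 2 / Real.log α := by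
  unfold queryCost
  ring

theorem two_le_ceil_rpow {b : ℕ} (hb : 2 ≤ b) {ε : ℝ} (h0 : 0 < ε) :
    2 ≤ ⌈(b : ℝ) ^ ε⌉₊ := by
  refine Nat.lt_ceil.2 ?_
  rw [Nat.cast_one]
  exact Real.one_lt_rpow (by exact_mod_cast hb) h0

theorem ceil_rpow_le {b : ℕ} (hb : 2 ≤ b) {ε : ℝ} (h1 : ε ≤ 1) : ⌈(b : ℝ) ^ ε⌉₊ ≤ b := by
  refine Nat.ceil_le.2 ?_
  calc (b : ℝ) ^ ε ≤ (b : ℝ) ^ (1 : ℝ) :=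
        Real.rpow_le_rpow_of_exponent_le (by exact_mod_cast (by omega : 1 ≤ b)) h1
    _ = b := Real.rpow_one _

/-- Since `b^ε > 1`, rounding up at most doubles it. -/
theorem ceil_rpow_mul_le {b : ℕ} (hb : 2 ≤ b) {ε : ℝ} (h0 : 0 < ε) :
    (⌈(b : ℝ) ^ ε⌉₊ : ℝ) * b ≤ 2 * (b : ℝ) ^ (1 + ε) := by
  have hb' : (1 : ℝ) < b := by exact_mod_cast hb
  have h := Real.one_lt_rpow hb' h0
  have hc := (Nat.ceil_lt_add_one (by linarith : 0 ≤ (b : ℝ) ^ ε)).le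
  rw [Real.rpow_add (by linarith), Real.rpow_one]
  calc (⌈(b : ℝ) ^ ε⌉₊ : ℝ) * b ≤ (2 * (b : ℝ) ^ ε) * b := by gcongr; linarith
    _ = _ := by ring

/-- From `log α ≥ ε log b` one of the two factors `log b` cancels and leaves `1/ε`; the factor `2`
comes from rounding and is independent of `ε`. -/
theorem log_mul_queryCost_le {n b : ℕ} (hb : 2 ≤ b) {ε : ℝ} (h0 : 0 < ε) :
    Real.log b * queryCost n b ⌈(b : ℝ) ^ ε⌉₊ ≤
      2 * (1 / ε * ((n : ℝ) * Real.log b + (b : ℝ) ^ (1 + ε) * Real.log b)) := by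
  have hb' : (1 : ℝ) < b := by exact_mod_cast hb
  have lb := half_le_log hb
  have hα := two_le_ceil_rpow hb h0
  have hαb := ceil_rpow_mul_le hb h0
  have hl : ε * Real.log b ≤ Real.log ⌈(b : ℝ) ^ ε⌉₊ := by
    rw [← Real.log_rpow (by linarith)]
    exact Real.log_le_log (by positivity) (Nat.le_ceil _)
  generalize ⌈(b : ℝ) ^ ε⌉₊ = α at *
  have hpos : 0 < ε * Real.log b := by positivity
  calc Real.log b * queryCost n b α = (n + α * b) * Real.log b ^ 2 / Real.log α := by
        unfold queryCost; ring
    _ ≤ (n + α * b) * Real.log b ^ 2 / (ε * Real.log b) := by gcongr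
    _ = 1 / ε * ((n + α * b) * Real.log b) := by field_simp
    _ ≤ 1 / ε * ((2 * n + 2 * (b : ℝ) ^ (1 + ε)) * Real.log b) := by
      gcongr
      linarith [(Nat.cast_nonneg n : (0 : ℝ) ≤ n)]
    _ = _ := by ring

end SparseSuffix

theorem mainTheorem4 (c : ℕ) :
    -- batched longest common prefix queries
    (∃ (k : ℕ) (P : SparseSuffix.Cmd k) (K : ℕ) (C : ℝ),
      ∀ (T : List ℕ) (σ : ℕ) (Q : List (ℕ × ℕ)) (n b α w : ℕ),
        T.length = n → Q.length = b →
        SparseSuffix.OverAlphabet σ T →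
        (∀ q ∈ Q, q.1 < n ∧ q.2 < n) →
        2 ≤ α → α ≤ b →
        K * (Nat.log 2 (n + σ + b) + 1) ≤ w →
        SparseSuffix.Achieves P w T (SparseSuffix.lcpInput T σ Q α)
          (fun out => out = SparseSuffix.lcpAnswers T Q)
          (C * ((n : ℝ) * Real.log b / Real.log α + (α : ℝ) * b * Real.log b / Real.log α))
          (C * ((α : ℝ) * b))
          (1 / (n : ℝ) ^ c)) ∧
    -- sparse suffix tree construction
    (∃ (k : ℕ) (P : SparseSuffix.Cmd k) (K : ℕ) (C : ℝ),
      ∀ (T : List ℕ) (σ : ℕ) (I : List ℕ) (n b w : ℕ),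
        T.length = n → I.length = b →
        SparseSuffix.OverAlphabet σ T →
        I.Nodup → (∀ i ∈ I, i < n) → 2 ≤ b →
        K * (Nat.log 2 (n + σ + b) + 1) ≤ w →
        (∀ α : ℕ, 2 ≤ α → α ≤ b →
          SparseSuffix.Achieves P w T (SparseSuffix.treeInput T σ I α)
            (SparseSuffix.IsTreeOutput T I)
            (C * ((n : ℝ) * Real.log b ^ 2 / Real.log α +
              (α : ℝ) * b * Real.log b ^ 2 / Real.log α))
            (C * ((α : ℝ) * b))
            (1 / (n : ℝ) ^ c)) ∧
        (∀ ε : ℝ, 0 < ε → ε ≤ 1 →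
          SparseSuffix.Achieves P w T (SparseSuffix.treeInput T σ I ⌈(b : ℝ) ^ ε⌉₊)
            (SparseSuffix.IsTreeOutput T I)
            (C * (1 / ε * ((n : ℝ) * Real.log b + (b : ℝ) ^ (1 + ε) * Real.log b)))
            (C * (b : ℝ) ^ (1 + ε))
            (1 / (n : ℝ) ^ c))) := by
  refine ⟨?_, ?_⟩
  · obtain ⟨C, hC⟩ := SparseSuffix.achieves_queries c
    refine ⟨64, SparseSuffix.hashedCmd (3 * (c + 3)) (SparseSuffix.queriesCmd (3 * (c + 3))),
      20 * (3 * (c + 3) + 66), C, ?_⟩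
    rintro T σ Q _ _ α w rfl rfl hT hQ h2 hb hw
    exact hC T σ Q α w hT hQ h2 hb hw
  · obtain ⟨C, hC0, hC⟩ := SparseSuffix.achieves_tree c
    -- One program serves both claims. The constant `2 * C` pays for rounding `b^ε` up; the factor
    -- in the word length is the one required by `pow_le_two_pow` for `κ = 3(c + 3)`.
    refine ⟨64, SparseSuffix.hashedCmd (3 * (c + 3)) (SparseSuffix.treeCmd (3 * (c + 3))),
      20 * (3 * (c + 3) + 66), 2 * C, ?_⟩
    rintro T σ I _ _ w rfl rfl hT hI hIn hb hw
    refine ⟨fun α h2 hα => ?_, fun ε h0 h1 => ?_⟩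
    · refine (hC T σ I α w hT hI hIn h2 hα hw).mono ?_ ?_
      · have lb := SparseSuffix.half_le_log hb
        have q := SparseSuffix.cast_add_cast_le_queryCost (n := T.length) h2 hα
        rw [← SparseSuffix.log_mul_queryCost]
        have : 0 ≤ SparseSuffix.queryCost T.length I.length α := by
          refine le_trans ?_ q
          positivity
        gcongr
        linarith
      · gcongr
        linarith
    · refine (hC T σ I _ w hT hI hIn (SparseSuffix.two_le_ceil_rpow hb h0)
        (SparseSuffix.ceil_rpow_le hb h1) hw).mono ?_ ?_
      · rw [mul_comm 2 C, mul_assoc]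
        exact mul_le_mul_of_nonneg_left (SparseSuffix.log_mul_queryCost_le hb h0) hC0
      · rw [mul_comm 2 C, mul_assoc]
        exact mul_le_mul_of_nonneg_left (SparseSuffix.ceil_rpow_mul_le hb h0) hC0
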